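/- Let $q\in\mathbb C$, $q\neq 0$, $q^m\neq 1$ for all integers $m\ge 1$. Put $m_q=(q^m-q^{-m})/(q-q^{-1})$. **Conventions.** The matrix $M_{a_1\dots a_k}^{b_1\dots b_k}$ (lower index: row, upper index: column) represents the operator $e_{a_1}\otimes\dots\otimes e_{a_k}\mapsto\sum_b M_{a_1\dots a_k}^{b_1\dots b_k}\,e_{b_1}\otimes\dots\otimes e_{b_k}$ on $V^{\otimes k}$, where $e_1,\dots,e_n$ is a basis of the complex vector space $V$. Thus $M$ is the transpose of the usual (column) matrix of the operator, and for an operator $f$ we write $f^t$ for this matrix $M$. **$R$-matrix.** Let $R$ be an $n^2\times n^2$ matrix with $R_{12}R_{23}R_{12}=R_{23}R_{12}R_{23}$ and $(R-qI)(R+q^{-1}I)=0$ that is skew-invertible: there is $\Psi$ with $\sum_{a,b}R_{ia}^{jb}\Psi_{bk}^{as}=\delta_i^s\delta_k^j=\sum_{a,b}\Psi_{ia}^{jb}R_{bk}^{as}$. Put $B_i^j=\sum_a\Psi_{ai}^{aj}$. Let $H_k(q)$ be the Hecke algebra with generators $\sigma_1,\dots,\sigma_{k-1}$ and relations $\sigma_i\sigma_{i+1}\sigma_i=\sigma_{i+1}\sigma_i\sigma_{i+1}$,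 $\sigma_i\sigma_j=\sigma_j\sigma_i$ for $|i-j|\ge2$, $(\sigma_i-q)(\sigma_i+q^{-1})=0$, and let $\rho_R:\sigma_i\mapsto R_i:=R_{i,i+1}$ be its local representation by matrices on $V^{\otimes k}$. Assume that $R$ has symmetry rank $p\ge1$: the images under $\rho_R$ of the $q$-antisymmetrizers, given by $A^{(1)}=1$, $A^{(k)}_{1\dots k}=\frac1{k_q}A^{(k-1)}_{2\dots k}\bigl(q^{k-1}-(k-1)_q\sigma_1\bigr)A^{(k-1)}_{2\dots k}$, satisfy $A^{(p+1)}(R)=0$ and $\operatorname{rank}A^{(p)}(R)=1$ (on $V^{\otimes(p+1)}$ and $V^{\otimes p}$). **Young projectors.** Let $J_1=1$, $J_{m+1}=\sigma_mJ_m\sigma_m$ be the Jucys–Murphy elements of $H_k(q)$. For a standard Young tableau $\nu(a)$ of shape $\nu\vdash k$ let $c_m$ be the column number minus the row number of the box containing $m$, and let $$\mathcal Y_{\nu(a)}=\prod_{m=1}^k\ \prod_{|c|<m,\ c\ne c_m}\frac{J_m-q^{2c}}{q^{2c_m}-q^{2c}}\in H_k(q),\qquad Y_{\nu(a)}(R)=\rho_R(\mathcal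 Y_{\nu(a)}),$$ the $q$-Young idempotent on which $J_m$ acts as $q^{2c_m}$, and its image. Let $V_{\nu(a)}\subset V^{\otimes k}$ be the image of the operator with the matrix $Y_{\nu(a)}(R)$. **Algebra and modules.** Let $\mathcal L_q$ be the modified reflection equation algebra: the unital associative $\mathbb C$-algebra with generators $l_i^j$, $1\le i,j\le n$, $L=\|l_i^j\|$, $L_1=L\otimes I$, and relations $R_{12}L_1R_{12}L_1-L_1R_{12}L_1R_{12}=R_{12}L_1-L_1R_{12}$. Let $V$ be its fundamental module of $B$ type, with the action $\pi(l_i^j)e_a=B_a^j\,e_i$. For every integer $k\ge 1$ the space $V^{\otimes k}$ is an $\mathcal L_q$-module with action $\rho_k$, where $$\rho_k^t(l_i^j)=\pi^t(l_i^j)\otimes I^{\otimes(k-1)}+\sum_{s=1}^{k-1}R_s^{-1}\cdots R_1^{-1}\bigl[\pi^t(l_i^j)\otimes I^{\otimes(k-1)}\bigr]R_1^{-1}\cdots R_s^{-1}.$$ **Proposition.** The $Y_{\nu(a)}(R)$ are pairwise orthogonal idempotents, and $$V^{\otimes k}=\bigoplus_{\nu\vdash k}\ \bigoplus_{\nu(a)}V_{\nu(a)},$$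 the inner sum being over the standard tableaux of shape $\nu$. Each $V_{\nu(a)}$ is an $\mathcal L_q$-submodule of $V^{\otimes k}$. If $\pi_{\nu(a)}$ denotes the action on it, and an operator on $V_{\nu(a)}$ is regarded as an operator on $V^{\otimes k}$ by composing it with the projector on $V_{\nu(a)}$, then $$\pi^t_{\nu(a)}(l_i^j)=Y_{\nu(a)}(R)\,\rho_k^t(l_i^j)\,Y_{\nu(a)}(R).$$ For any two standard tableaux $\nu(a),\nu(b)$ of the same partition $\nu\vdash k$ the $\mathcal L_q$-modules $V_{\nu(a)}$ and $V_{\nu(b)}$ are equivalent (isomorphic). -/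

import Mathlib

open scoped BigOperators TensorProduct

noncomputable section

namespace HeckeREA

/-! ### Matrices on tensor powers -/

/-- Matrices with entries in `A` acting on the `k`-th tensor power of an `n`-dimensional space,
written in the basis `e_{i₁} ⊗ ⋯ ⊗ e_{i_k}`, that is, indexed by `(i₁, …, i_k)`.
The first (row) index is the lower one and the second (column) index the upper one, so `M a b` is
`M_{a₁ … a_k}^{b₁ … b_k}`. -/
abbrev TMat (n k : ℕ) (A : Type*) := Matrix (Fin k → Fin n) (Fin k → Fin n) A

/-- The matrix `M` placed in the tensor factors `f 0, f 1, …`, with the identity in all the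
others. -/
def amp {n m k : ℕ} {A : Type*} [Zero A] (f : Fin m → Fin k) (M : TMat n m A) : TMat n k A :=
  fun a b => if ∀ j, (∀ i, f i ≠ j) → a j = b j then M (a ∘ f) (b ∘ f) else 0

/-- `X ⊗ I^{⊗ (k-1)}`: an `n × n` matrix placed in the first tensor factor. -/
def atFirst {n : ℕ} {A : Type*} [Zero A] (k : ℕ) [NeZero k] (X : Matrix (Fin n) (Fin n) A) :
    TMat n k A :=
  amp (fun _ : Fin 1 => (0 : Fin k)) (fun a b => X (a 0) (b 0))

/-- `R` acting in the factors number `i` and `i + 1` of `V^{⊗ k}`, the factors being counted from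
`0` (it is set to `1` when there are no such factors; this value is never used). -/
def siteR {n : ℕ} (R : TMat n 2 ℂ) (k i : ℕ) : TMat n k ℂ :=
  if h : i + 1 < k then amp ![⟨i, by omega⟩, ⟨i + 1, h⟩] R else 1

/-- A Hecke `R`-matrix: a solution of the Yang-Baxter equation on `V^{⊗ 3}` that satisfies the
Hecke condition `(R - q I) (R + q⁻¹ I) = 0`. -/
structure IsHeckeRMatrix {n : ℕ} (q : ℂ) (R : TMat n 2 ℂ) : Prop where
  yangBaxter : siteR R 3 0 * siteR R 3 1 * siteR R 3 0 = siteR R 3 1 * siteR R 3 0 * siteR R 3 1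
  hecke : (R - q • (1 : TMat n 2 ℂ)) * (R + q⁻¹ • (1 : TMat n 2 ℂ)) = 0

/-- `Ψ` is the skew-inverse of `R`:
`∑ R_{ia}^{jb} Ψ_{bk}^{as} = δ_i^s δ_k^j = ∑ Ψ_{ia}^{jb} R_{bk}^{as}`. -/
structure IsSkewInverse {n : ℕ} (R Ψ : TMat n 2 ℂ) : Prop where
  right : ∀ i j k s : Fin n, ∑ a, ∑ b, R ![i, a] ![j, b] * Ψ ![b, k] ![a, s] =
    if i = s ∧ k = j then 1 else 0
  left : ∀ i j k s : Fin n, ∑ a, ∑ b, Ψ ![i, a] ![j, b] * R ![b, k] ![a, s] =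
    if i = s ∧ k = j then 1 else 0

/-- The matrix `B_1 = Tr_{(2)} Ψ_{21}`, that is, `B_i^j = ∑_a Ψ_{ai}^{aj}`. -/
def matB {n : ℕ} (Ψ : TMat n 2 ℂ) : Matrix (Fin n) (Fin n) ℂ :=
  fun i j => ∑ a, Ψ ![a, i] ![a, j]

/-! ### The Hecke algebra -/

/-- The defining relations of the Hecke algebra; the generator `i : Fin (k - 1)` is
`σ_{i + 1}`. -/
inductive HeckeRel (q : ℂ) (k : ℕ) :
    FreeAlgebra ℂ (Fin (k - 1)) → FreeAlgebra ℂ (Fin (k - 1)) → Prop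
  | braid (i j : Fin (k - 1)) (h : (j : ℕ) = i + 1) :
      HeckeRel q k (FreeAlgebra.ι ℂ i * FreeAlgebra.ι ℂ j * FreeAlgebra.ι ℂ i)
        (FreeAlgebra.ι ℂ j * FreeAlgebra.ι ℂ i * FreeAlgebra.ι ℂ j)
  | comm (i j : Fin (k - 1)) (h : (i : ℕ) + 2 ≤ j) :
      HeckeRel q k (FreeAlgebra.ι ℂ i * FreeAlgebra.ι ℂ j)
        (FreeAlgebra.ι ℂ j * FreeAlgebra.ι ℂ i)
  | quad (i : Fin (k - 1)) :
      HeckeRel q k ((FreeAlgebra.ι ℂ i - algebraMap ℂ _ q) *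
        (FreeAlgebra.ι ℂ i + algebraMap ℂ _ q⁻¹)) 0

/-- The Hecke algebra `H_k(q)` of type `A`, generated by `σ_1, …, σ_{k-1}`. -/
abbrev HeckeAlgebra (q : ℂ) (k : ℕ) : Type := RingQuot (HeckeRel q k)

/-- The generators of `H_k(q)`, counted from `0`: `sigma q k i` is `σ_{i+1}` for `i + 1 < k` (it is
set to `1` for other `i`; this value is never used). -/
def sigma (q : ℂ) (k i : ℕ) : HeckeAlgebra q k :=
  if h : i < k - 1 then RingQuot.mkAlgHom ℂ (HeckeRel q k) (FreeAlgebra.ι ℂ ⟨i, h⟩) else 1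

/-- The `q`-analogue `m_q = (q^m - q^{-m}) / (q - q⁻¹)` of the integer `m`. -/
def qNum (q : ℂ) (m : ℕ) : ℂ := (q ^ m - (q ^ m)⁻¹) / (q - q⁻¹)

/-- The `q`-antisymmetrizer of order `m` in `H_k(q)` that acts in the factors number
`s, …, s + m - 1` (counted from `0`): it is `1` in order `1`, and
`A^{(m)}_{1…m} = (1 / m_q) A^{(m-1)}_{2…m} (q^{m-1} - (m-1)_q σ_1) A^{(m-1)}_{2…m}`. -/
def antisymmetrizer (q : ℂ) (k : ℕ) : ℕ → ℕ → HeckeAlgebra q k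
  | 0, _ => 1
  | 1, _ => 1
  | m + 2, s => (qNum q (m + 2))⁻¹ •
      (antisymmetrizer q k (m + 1) (s + 1) *
        (algebraMap ℂ _ (q ^ (m + 1)) - qNum q (m + 1) • sigma q k s) *
        antisymmetrizer q k (m + 1) (s + 1))

/-- The Jucys-Murphy elements of `H_k(q)`, counted from `0`: `J_1 = 1`, and
`J_{m+1} = σ_m J_m σ_m = σ_m ⋯ σ_1 σ_1 ⋯ σ_m`. -/
def jucysMurphy (q : ℂ) (k : ℕ) : ℕ → HeckeAlgebra q k
  | 0 => 1
  | m + 1 => sigma q k m * jucysMurphy q k m * sigma q k m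

/-- A standard Young tableau with `k` boxes of shape `ν`, given by the box that holds each number
(the number `m + 1` stands in the box `box m`). Boxes are pairs (row, column), counted from `0`.
The entries increase along rows and down columns. -/
structure StandardTableau (ν : YoungDiagram) (k : ℕ) where
  box : Fin k ≃ ν.cells
  row_lt : ∀ a b : Fin k, (box a).1.1 = (box b).1.1 → (box a).1.2 < (box b).1.2 → a < b
  col_lt : ∀ a b : Fin k, (box a).1.2 = (box b).1.2 → (box a).1.1 < (box b).1.1 → a < b

/-- All standard Young tableaux with `k` boxes, that is, all pairs `ν(a)` of a partition `ν` of `k`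
and a standard tableau of shape `ν`. -/
abbrev Tableau (k : ℕ) := Σ ν : YoungDiagram, StandardTableau ν k

instance (k : ℕ) : DecidableEq (Tableau k) := Classical.decEq _

/-- Column minus row of the box that holds the number `m + 1`. -/
def StandardTableau.content {ν : YoungDiagram} {k : ℕ} (T : StandardTableau ν k) (m : Fin k) : ℤ :=
  ((T.box m).1.2 : ℤ) - ((T.box m).1.1 : ℤ)

/-- The primitive `q`-Young idempotent of `H_k(q)` that belongs to a standard tableau with content
vector `(c_1, …, c_k)`, by Murphy's formula
`∏_{m=1}^k ∏_{|c| < m, c ≠ c_m} (J_m - q^{2c}) / (q^{2c_m} - q^{2c})`: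
it is the projector on the common eigenspace `J_m = q^{2 c_m}`, `1 ≤ m ≤ k`, of the Jucys-Murphy
elements. The inner product is a Lagrange basis polynomial evaluated at `J_m`. -/
def youngIdempotent (q : ℂ) {k : ℕ} (T : Tableau k) : HeckeAlgebra q k :=
  ((List.finRange k).map fun m : Fin k =>
    Polynomial.aeval (jucysMurphy q k m)
      (Lagrange.basis (Finset.Icc (-(m : ℤ)) m) (fun c : ℤ => q ^ (2 * c)) (T.2.content m))).prod

/-! ### The local representation -/

section amp

variable {n k : ℕ} {A : Type*} [Semiring A]

theorem amp_mul {m : ℕ} (f : Fin m → Fin k) (hf : Function.Injective f) (M N : TMat n m A) :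
    amp f M * amp f N = amp f (M * N) := by
  classical
  ext a b
  simp only [Matrix.mul_apply, amp]
  split_ifs with h
  · symm
    refine Finset.sum_of_injOn (fun d => Function.extend f d a) ?_ (by simp) ?_ ?_
    · intro d _ d' _ hd
      funext i
      have := congrFun hd (f i)
      simpa [hf.extend_apply] using this
    · intro c _ hc
      rw [if_neg, zero_mul]
      intro hac
      refine hc ⟨c ∘ f, by simp, ?_⟩
      funext j
      by_cases hj : ∃ i, f i = j
      · obtain ⟨i, rfl⟩ := hj
        simp [hf.extend_apply]
      · push Not at hj
        simp only
        rw [Function.extend_apply' _ _ _ (by simpa using hj)]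
        exact hac j hj
    · intro d _
      have h1 : ∀ j, (∀ i, f i ≠ j) → a j = Function.extend f d a j := by
        intro j hj
        rw [Function.extend_apply' _ _ _ (by simpa using hj)]
      have h2 : ∀ j, (∀ i, f i ≠ j) → Function.extend f d a j = b j := by
        intro j hj
        rw [← h1 j hj, h j hj]
      rw [if_pos h1, if_pos h2]
      have h3 : Function.extend f d a ∘ f = d := by
        funext i
        simp [hf.extend_apply]
      rw [h3]
  · refine Finset.sum_eq_zero fun c _ => ?_
    by_cases h1 : ∀ j, (∀ i, f i ≠ j) → a j = c j
    · have h2 : ¬ ∀ j, (∀ i, f i ≠ j) → c j = b j := fun h2 =>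
        h fun j hj => (h1 j hj).trans (h2 j hj)
      rw [if_neg h2, mul_zero]
    · rw [if_neg h1, zero_mul]

theorem amp_one {m : ℕ} (f : Fin m → Fin k) : amp f (1 : TMat n m A) = 1 := by
  ext a b
  simp only [amp, Matrix.one_apply]
  by_cases hab : a = b
  · subst hab
    simp
  · rw [if_neg hab]
    split_ifs with h h'
    · refine absurd (funext fun j => ?_) hab
      by_cases hj : ∃ i, f i = j
      · obtain ⟨i, rfl⟩ := hj
        exact congrFun h' i
      · exact h j (by simpa using hj)
    · rfl
    · rfl

theorem amp_add {m : ℕ} (f : Fin m → Fin k) (M N : TMat n m A) :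
    amp f (M + N) = amp f M + amp f N := by
  ext a b
  simp only [amp, Matrix.add_apply]
  split_ifs <;> simp

theorem amp_smul {m : ℕ} (f : Fin m → Fin k) (c : A) (M : TMat n m A) :
    amp f (c • M) = c • amp f M := by
  ext a b
  simp only [amp, Matrix.smul_apply]
  split_ifs <;> simp

theorem amp_zero {m : ℕ} (f : Fin m → Fin k) : amp f (0 : TMat n m A) = 0 := by
  ext a b
  simp [amp]

theorem amp_amp {m l : ℕ} (f : Fin l → Fin k) (hf : Function.Injective f) (g : Fin m → Fin l)
    (M : TMat n m A) : amp f (amp g M) = amp (f ∘ g) M := by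
  ext a b
  simp only [amp]
  by_cases h : ∀ j, (∀ i, (f ∘ g) i ≠ j) → a j = b j
  · rw [if_pos h, if_pos, if_pos]
    · rfl
    · intro j hj
      exact h _ fun i => hf.ne (hj i)
    · intro j hj
      exact h _ fun i => hj (g i)
  · rw [if_neg h]
    split_ifs with h1 h2
    · refine absurd (fun j hj => ?_) h
      by_cases hj' : ∃ i, f i = j
      · obtain ⟨i, rfl⟩ := hj'
        exact h2 i fun i' hi' => hj i' (by simp [hi'])
      · exact h1 j (by simpa using hj')
    · rfl
    · rfl

theorem amp_comm {n k m l : ℕ} {A : Type*} [CommSemiring A] (f : Fin m → Fin k) (g : Fin l → Fin k)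
    (hfg : ∀ i j, f i ≠ g j) (M : TMat n m A) (N : TMat n l A) :
    amp f M * amp g N = amp g N * amp f M := by
  classical
  have key : ∀ {m l : ℕ} (f : Fin m → Fin k) (g : Fin l → Fin k) (_ : ∀ i j, f i ≠ g j)
      (M : TMat n m A) (N : TMat n l A) (a b : Fin k → Fin n),
      (amp f M * amp g N) a b =
        if ∀ j, (∀ i, f i ≠ j) → (∀ i, g i ≠ j) → a j = b j then
          M (a ∘ f) (b ∘ f) * N (a ∘ g) (b ∘ g) else 0 := by
    intro m l f g hfg M N a b
    rw [Matrix.mul_apply]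
    let c₀ : Fin k → Fin n := fun j => if ∃ i, f i = j then b j else a j
    have hf0 : c₀ ∘ f = b ∘ f := by
      funext i
      simp [c₀]
    have hg0 : c₀ ∘ g = a ∘ g := by
      funext i
      have : ¬ ∃ i', f i' = g i := by
        rintro ⟨i', hi'⟩
        exact hfg _ _ hi'
      simp [c₀, this]
    rw [Finset.sum_eq_single c₀]
    · simp only [amp, hf0, hg0]
      have h1 : ∀ j, (∀ i, f i ≠ j) → a j = c₀ j := by
        intro j hj
        have : ¬ ∃ i, f i = j := by simpa using hj
        simp [c₀, this]
      rw [if_pos h1]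
      by_cases h : ∀ j, (∀ i, f i ≠ j) → (∀ i, g i ≠ j) → a j = b j
      · rw [if_pos h, if_pos]
        intro j hj
        by_cases hj' : ∃ i, f i = j
        · simp [c₀, hj']
        · simp only [c₀, if_neg hj']
          exact h j (by simpa using hj') hj
      · rw [if_neg h, if_neg, mul_zero]
        intro h2
        exact h fun j hj hj' => (h1 j hj).trans (h2 j hj')
    · intro c _ hc
      simp only [amp]
      by_cases h1 : ∀ j, (∀ i, f i ≠ j) → a j = c j
      · by_cases h2 : ∀ j, (∀ i, g i ≠ j) → c j = b j
        · refine absurd (funext fun j => ?_) hc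
          by_cases hj : ∃ i, f i = j
          · simp only [c₀, if_pos hj]
            obtain ⟨i, rfl⟩ := hj
            exact h2 _ fun i' => (hfg i i').symm
          · simp only [c₀, if_neg hj]
            exact (h1 j (by simpa using hj)).symm
        · rw [if_neg h2, mul_zero]
      · rw [if_neg h1, zero_mul]
    · simp
  ext a b
  rw [key f g hfg, key g f fun i j => (hfg j i).symm]
  by_cases h : ∀ j, (∀ i, f i ≠ j) → (∀ i, g i ≠ j) → a j = b j
  · rw [if_pos h, if_pos fun j h1 h2 => h j h2 h1, mul_comm]
  · rw [if_neg h, if_neg fun h' => h fun j h1 h2 => h' j h2 h1]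

end amp

section localRep

variable {n : ℕ} {q : ℂ} {R : TMat n 2 ℂ}

theorem siteR_braid (hR : IsHeckeRMatrix q R) (k i : ℕ) (h : i + 2 < k) :
    siteR R k i * siteR R k (i + 1) * siteR R k i =
      siteR R k (i + 1) * siteR R k i * siteR R k (i + 1) := by
  let f : Fin 3 → Fin k := ![⟨i, by omega⟩, ⟨i + 1, by omega⟩, ⟨i + 2, h⟩]
  have hf : Function.Injective f := by
    intro x y hxy
    simp only [f] at hxy
    fin_cases x <;> fin_cases y <;> simp_all
  have h0 : siteR R k i = amp f (siteR R 3 0) := by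
    rw [siteR, siteR, dif_pos (show i + 1 < k by omega), dif_pos (by norm_num), amp_amp _ hf]
    congr 1
    funext x
    fin_cases x <;> rfl
  have h1 : siteR R k (i + 1) = amp f (siteR R 3 1) := by
    rw [siteR, siteR, dif_pos (show i + 1 + 1 < k by omega), dif_pos (by norm_num), amp_amp _ hf]
    congr 1
    funext x
    fin_cases x <;> rfl
  rw [h0, h1, amp_mul _ hf, amp_mul _ hf, amp_mul _ hf, amp_mul _ hf, hR.yangBaxter]

theorem siteR_comm (R : TMat n 2 ℂ) (k i j : ℕ) (h : i + 2 ≤ j) (hj : j + 1 < k) :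
    siteR R k i * siteR R k j = siteR R k j * siteR R k i := by
  rw [siteR, siteR, dif_pos (show i + 1 < k by omega), dif_pos hj]
  refine amp_comm _ _ (fun x y => ?_) _ _
  fin_cases x <;> fin_cases y <;> simp <;> omega

theorem siteR_hecke (hR : IsHeckeRMatrix q R) (k i : ℕ) (h : i + 1 < k) :
    (siteR R k i - q • (1 : TMat n k ℂ)) * (siteR R k i + q⁻¹ • (1 : TMat n k ℂ)) = 0 := by
  have hf : Function.Injective (![⟨i, by omega⟩, ⟨i + 1, h⟩] : Fin 2 → Fin k) := by
    intro x y hxy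
    fin_cases x <;> fin_cases y <;> simp_all
  have h0 := congrArg (amp (![⟨i, by omega⟩, ⟨i + 1, h⟩] : Fin 2 → Fin k)) hR.hecke
  rw [← amp_mul _ hf, sub_eq_add_neg, ← neg_smul, amp_add, amp_add, amp_smul, amp_smul, amp_one,
    amp_zero] at h0
  rw [siteR, dif_pos h, sub_eq_add_neg, ← neg_smul]
  exact h0

/-- The local representation `ρ_R` of `H_k(q)` by matrices on `V^{⊗ k}`, with
`ρ_R(σ_i) = R_{i,i+1}`. -/
def localRep (hR : IsHeckeRMatrix q R) (k : ℕ) : HeckeAlgebra q k →ₐ[ℂ] TMat n k ℂ :=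
  RingQuot.liftAlgHom ℂ ⟨FreeAlgebra.lift ℂ fun i : Fin (k - 1) => siteR R k i, by
    intro x y hxy
    induction hxy with
    | braid i j h =>
      simp only [map_mul, FreeAlgebra.lift_ι_apply, h]
      exact siteR_braid hR k i (by omega)
    | comm i j h =>
      simp only [map_mul, FreeAlgebra.lift_ι_apply]
      exact siteR_comm R k i j h (by omega)
    | quad i =>
      simp only [map_mul, map_sub, map_add, FreeAlgebra.lift_ι_apply, AlgHom.commutes, map_zero]
      simp only [Algebra.algebraMap_eq_smul_one]
      exact siteR_hecke hR k i (by omega)⟩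

theorem localRep_sigma (hR : IsHeckeRMatrix q R) (k i : ℕ) (h : i + 1 < k) :
    localRep hR k (sigma q k i) = siteR R k i := by
  rw [sigma, dif_pos (by omega), localRep, RingQuot.liftAlgHom_mkAlgHom_apply,
    FreeAlgebra.lift_ι_apply]

end localRep

/-- `R` has symmetry rank `p`: the image `A^{(p+1)}(R)` of the `q`-antisymmetrizer of order `p + 1`
under the local representation vanishes, and `A^{(p)}(R)` has rank one. -/
structure HasSymmetryRank {n : ℕ} {q : ℂ} {R : TMat n 2 ℂ} (hR : IsHeckeRMatrix q R) (p : ℕ) :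
    Prop where
  pos : 0 < p
  vanish : localRep hR (p + 1) (antisymmetrizer q (p + 1) (p + 1) 0) = 0
  rank_one : (localRep hR p (antisymmetrizer q p p 0)).rank = 1

/-- The `q`-Young projector `Y_{ν(a)}(R)`, a matrix on `V^{⊗ k}`. -/
def youngMatrix {n : ℕ} {q : ℂ} {R : TMat n 2 ℂ} (hR : IsHeckeRMatrix q R) {k : ℕ}
    (T : Tableau k) : TMat n k ℂ :=
  localRep hR k (youngIdempotent q T)

/-! ### The modified reflection equation algebra -/

/-- The matrix `L_1 = L ⊗ I` over the free algebra on the generators `l_i^j`; the generator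
`(i, j)` is `l_i^j`. -/
def matL1 (n : ℕ) : TMat n 2 (FreeAlgebra ℂ (Fin n × Fin n)) :=
  atFirst 2 fun i j => FreeAlgebra.ι ℂ (i, j)

/-- The matrix `R_{12}` over the free algebra. -/
def matR12 {n : ℕ} (R : TMat n 2 ℂ) : TMat n 2 (FreeAlgebra ℂ (Fin n × Fin n)) :=
  R.map (algebraMap ℂ _)

/-- The defining relations `R_{12} L_1 R_{12} L_1 - L_1 R_{12} L_1 R_{12} = R_{12} L_1 - L_1 R_{12}`
of the modified reflection equation algebra, entry by entry. -/
inductive MREARel {n : ℕ} (R : TMat n 2 ℂ) :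
    FreeAlgebra ℂ (Fin n × Fin n) → FreeAlgebra ℂ (Fin n × Fin n) → Prop
  | entry (a b : Fin 2 → Fin n) :
      MREARel R
        ((matR12 R * matL1 n * matR12 R * matL1 n - matL1 n * matR12 R * matL1 n * matR12 R) a b)
        ((matR12 R * matL1 n - matL1 n * matR12 R) a b)

/-- The modified reflection equation algebra. -/
abbrev MREA {n : ℕ} (R : TMat n 2 ℂ) : Type := RingQuot (MREARel R)

/-- The generator `l_i^j` of the modified reflection equation algebra. -/
def MREA.l {n : ℕ} (R : TMat n 2 ℂ) (i j : Fin n) : MREA R :=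
  RingQuot.mkAlgHom ℂ (MREARel R) (FreeAlgebra.ι ℂ (i, j))

/-! ### Operators and their matrices, and the modules -/

/-- The transposed matrix `M` of an operator `f` in the basis `b`: `f (b_a) = ∑_c M_a^c b_c`. -/
def matrixT {ι W : Type*} [Fintype ι] [DecidableEq ι] [AddCommGroup W] [Module ℂ W]
    (b : Module.Basis ι ℂ W) (f : W →ₗ[ℂ] W) : Matrix ι ι ℂ :=
  (LinearMap.toMatrix b b f).transpose

/-- The operator with the matrix `M`, where the lower (row) index of `M` is the index of the basis
vector that is mapped: `b_a ↦ ∑_c M_a^c b_c`. -/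
def opT {ι W : Type*} [Fintype ι] [DecidableEq ι] [AddCommGroup W] [Module ℂ W]
    (b : Module.Basis ι ℂ W) (M : Matrix ι ι ℂ) : W →ₗ[ℂ] W :=
  Matrix.toLin b b M.transpose

/-- The tensor power `V^{⊗ k}`. -/
abbrev TPow (V : Type*) [AddCommGroup V] [Module ℂ V] (k : ℕ) := ⨂[ℂ] _ : Fin k, V

/-- The basis `e_{i₁} ⊗ ⋯ ⊗ e_{i_k}` of `V^{⊗ k}`. -/
def tensorBasis {n : ℕ} {V : Type*} [AddCommGroup V] [Module ℂ V] (e : Module.Basis (Fin n) ℂ V)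
    (k : ℕ) : Module.Basis (Fin k → Fin n) ℂ (TPow V k) :=
  Basis.piTensorProduct fun _ => e

/-- The chain `R^{-1}_{(s → 1)} = R_s⁻¹ R_{s-1}⁻¹ ⋯ R_1⁻¹` on `V^{⊗ k}`, empty for `s = 0`. -/
def chainDown {n : ℕ} (R : TMat n 2 ℂ) (k : ℕ) : ℕ → TMat n k ℂ
  | 0 => 1
  | s + 1 => (siteR R k s)⁻¹ * chainDown R k s

/-- The chain `R^{-1}_{(1 → s)} = R_1⁻¹ R_2⁻¹ ⋯ R_s⁻¹` on `V^{⊗ k}`, empty for `s = 0`. -/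
def chainUp {n : ℕ} (R : TMat n 2 ℂ) (k : ℕ) : ℕ → TMat n k ℂ
  | 0 => 1
  | s + 1 => chainUp R k s * (siteR R k s)⁻¹

/-- The matrix
`X ⊗ I^{⊗ (k-1)} + ∑_{s=1}^{k-1} R^{-1}_{(s → 1)} (X ⊗ I^{⊗ (k-1)}) R^{-1}_{(1 → s)}`. With the
transposed matrix `X = π^t(l_i^j)` of the fundamental representation this is `ρ_k^t(l_i^j)`. -/
def rhoT {n : ℕ} (R : TMat n 2 ℂ) (k : ℕ) [NeZero k] (X : Matrix (Fin n) (Fin n) ℂ) : TMat n k ℂ :=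
  atFirst k X +
    ∑ s ∈ Finset.Icc 1 (k - 1), chainDown R k s * atFirst k X * chainUp R k s

/-- The operator on `V^{⊗ k}` given by the `q`-Young projector `Y_{ν(a)}(R)`. -/
def youngOp {n : ℕ} {q : ℂ} {R : TMat n 2 ℂ} (hR : IsHeckeRMatrix q R) {V : Type*}
    [AddCommGroup V] [Module ℂ V] (e : Module.Basis (Fin n) ℂ V) {k : ℕ} (T : Tableau k) :
    Module.End ℂ (TPow V k) :=
  opT (tensorBasis e k) (youngMatrix hR T)

/-- The subspace `V_{ν(a)} = Y_{ν(a)}(R) ▷ V^{⊗ k}`. -/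
def youngSubspace {n : ℕ} {q : ℂ} {R : TMat n 2 ℂ} (hR : IsHeckeRMatrix q R) {V : Type*}
    [AddCommGroup V] [Module ℂ V] (e : Module.Basis (Fin n) ℂ V) {k : ℕ} (T : Tableau k) :
    Submodule ℂ (TPow V k) :=
  LinearMap.range (youngOp hR e T)

/-- An operator on `V_{ν(a)}` as an operator on the whole of `V^{⊗ k}`: precomposed with the
projector on `V_{ν(a)}`. -/
def extendOp {n : ℕ} {q : ℂ} {R : TMat n 2 ℂ} (hR : IsHeckeRMatrix q R) {V : Type*}
    [AddCommGroup V] [Module ℂ V] (e : Module.Basis (Fin n) ℂ V) {k : ℕ} (T : Tableau k)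
    (f : Module.End ℂ (youngSubspace hR e T)) : Module.End ℂ (TPow V k) :=
  (youngSubspace hR e T).subtype ∘ₗ f ∘ₗ (youngOp hR e T).rangeRestrict

end HeckeREA

end

open scoped BigOperators TensorProduct

/-! Two families of operators act on V^{⊗k}: the Hecke algebra through the R-matrix, and the
reflection equation algebra through the chains of inverse R-matrices. The proposition rests on two
facts: the Jucys-Murphy operators are simultaneously diagonalizable with spectrum given by the
contents of standard tableaux, and the chains define a representation that commutes with the Hecke
algebra.

Spectrum. Semisimplicity of the Hecke algebra is not presupposed; the argument is an induction on
the number of Jucys-Murphy operators in the manner of Okounkov and Vershik. For consecutive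
operators x, y and the generator s between them, φ = s(x - y) + (q - q⁻¹)y exchanges x and y and
satisfies φ² = (q²x - y)(y - q⁻²x). Let u have the joint weight of a tableau t that ends with x, and
let u lie in the generalized eigenspace of y for b. If φu ≠ 0, then φu is again a joint weight
vector, so by induction b is the weight of a box that can be added to t without its last box; this
box can be appended to t, and y acts on u by b (`weightSpace_inf_maxGen_le`). If φu = 0, then y acts
by q² or q⁻² times the weight of the last box, and the new box stands to the right of it or below
it; the braid relation rules out positions that give no Young diagram (`eq_zero_of_corner`). The
outcome is `isTableauSpanned`. As contents determine a tableau, the Lagrange factors of Murphy's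
formula act on the joint eigenspaces as Kronecker deltas (`youngOp_apply`), so the Young operators
are the projectors of this decomposition.

Equivalence. Tableaux of the same shape are connected by exchanges of consecutive entries in
non-adjacent boxes. On the eigenspaces concerned φ² is a nonzero scalar, so φ is invertible there,
and everything that commutes with the Hecke generators commutes with φ (`exists_exchange`).

Representation. Substituted into the quadratic relation, the sum of chains becomes a double sum.
Off-diagonal terms cancel in pairs against the corrections which the Hecke relation produces on the
diagonal (`sum_chain_mul_chain`). This needs the relation in one tensor factor, which is Tr_1(B_1
R_12) = I, and an identity in two factors, which follows from a partial trace formula and from R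
commuting with B ⊗ B. The same chains commute with the Hecke generators (`commute_chainSum`), so the
joint eigenspaces are submodules and the equivalences are module maps. -/

namespace HeckeREA

/-! ### Box sequences -/

/-- Column minus row of a box. -/
def boxContent (b : ℕ × ℕ) : ℤ := (b.2 : ℤ) - (b.1 : ℤ)

/-- The first `k` terms of `t` are the boxes of a standard tableau with `k` boxes, listed in the
order of their entries. -/
structure IsBoxSeq (k : ℕ) (t : ℕ → ℕ × ℕ) : Prop where
  inj : ∀ i < k, ∀ j < k, t i = t j → i = j
  up : ∀ m < k, ∀ r c, t m = (r + 1, c) → ∃ j < m, t j = (r, c)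
  left : ∀ m < k, ∀ r c, t m = (r, c + 1) → ∃ j < m, t j = (r, c)

namespace IsBoxSeq

variable {k l m i : ℕ} {t t' : ℕ → ℕ × ℕ}

theorem mono (h : IsBoxSeq k t) (hl : l ≤ k) : IsBoxSeq l t where
  inj i hi j hj := h.inj i (by omega) j (by omega)
  up m hm := h.up m (by omega)
  left m hm := h.left m (by omega)

theorem congr (h : IsBoxSeq k t) (e : ∀ j < k, t j = t' j) : IsBoxSeq k t' where
  inj i hi j hj hij := h.inj i hi j hj (by rw [e i hi, e j hj, hij])
  up m hm r c hrc := by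
    obtain ⟨j, hj, hj'⟩ := h.up m hm r c (by rw [e m hm, hrc])
    exact ⟨j, hj, by rw [← e j (by omega), hj']⟩
  left m hm r c hrc := by
    obtain ⟨j, hj, hj'⟩ := h.left m hm r c (by rw [e m hm, hrc])
    exact ⟨j, hj, by rw [← e j (by omega), hj']⟩

/-- Boxes weakly north-west of a box come earlier. -/
theorem lower (h : IsBoxSeq k t) (hm : m < k) {b : ℕ × ℕ} (h1 : b.1 ≤ (t m).1)
    (h2 : b.2 ≤ (t m).2) : ∃ j ≤ m, t j = b := by
  induction m using Nat.strong_induction_on with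
  | _ m ih =>
    rcases hb : t m with ⟨r, c⟩
    rw [hb] at h1 h2
    simp only at h1 h2
    rcases Nat.lt_or_ge b.1 r with h3 | h3
    · obtain ⟨r, rfl⟩ : ∃ r', r = r' + 1 := ⟨r - 1, by omega⟩
      obtain ⟨j, hj, hj'⟩ := h.up m hm r c hb
      obtain ⟨j', hj1, hj2⟩ := ih j hj (by omega) (by rw [hj']; simp only; omega)
        (by rw [hj']; simp only; omega)
      exact ⟨j', by omega, hj2⟩
    · rcases Nat.lt_or_ge b.2 c with h4 | h4
      · obtain ⟨c, rfl⟩ : ∃ r', c = r' + 1 := ⟨c - 1, by omega⟩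
        obtain ⟨j, hj, hj'⟩ := h.left m hm r c hb
        obtain ⟨j', hj1, hj2⟩ := ih j hj (by omega) (by rw [hj']; simp only; omega)
          (by rw [hj']; simp only; omega)
        exact ⟨j', by omega, hj2⟩
      · exact ⟨m, le_rfl, by rw [hb]; ext <;> simp only <;> omega⟩

/-- Two different boxes that can be added to the same diagram have contents that differ by at
least two. -/
theorem addable_unique (h : IsBoxSeq (m + 1) t) (h' : IsBoxSeq (m + 1) t')
    (e : ∀ j < m, t j = t' j) (h1 : boxContent (t m) ≤ boxContent (t' m) + 1)
    (h2 : boxContent (t' m) ≤ boxContent (t m) + 1) : t m = t' m := by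
  have key : ∀ {t t' : ℕ → ℕ × ℕ}, IsBoxSeq (m + 1) t → IsBoxSeq (m + 1) t' →
      (∀ j < m, t j = t' j) → (t m).1 ≤ (t' m).1 → (t m).2 ≤ (t' m).2 → t m = t' m := by
    intro t t' h h' e h3 h4
    -- The last box of `t` lies weakly north-west of the last box of `t'`, hence occurs in `t'`. It
    -- cannot occur before position `m`, where both sequences agree, because it is new in `t`.
    obtain ⟨j, hj, hj'⟩ := h'.lower (Nat.lt_succ_self m) h3 h4
    rcases Nat.lt_or_ge j m with hjm | hjm
    · have := h.inj j (by omega) m (by omega) (by rw [e j hjm, hj'])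
      omega
    · rw [← hj', show j = m by omega]
  simp only [boxContent] at h1 h2
  -- Incomparable boxes differ in row and column in opposite directions, so their contents differ by
  -- at least two. The bounds thus leave only comparable boxes.
  by_cases h3 : (t m).1 ≤ (t' m).1 ∧ (t m).2 ≤ (t' m).2
  · exact key h h' e h3.1 h3.2
  · exact (key h' h (fun j hj => (e j hj).symm) (by omega) (by omega)).symm

/-- A standard tableau is determined by its contents. -/
theorem ext_of_content (h : IsBoxSeq k t) (h' : IsBoxSeq k t')
    (e : ∀ j < k, boxContent (t j) = boxContent (t' j)) : ∀ j < k, t j = t' j := by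
  intro j
  induction j using Nat.strong_induction_on with
  | _ j ih =>
    intro hj
    exact (h.mono hj).addable_unique (h'.mono hj) (fun i hi => ih i hi (by omega))
      (by have := e j hj; omega) (by have := e j hj; omega)

/-- Passing to the upper or left neighbour lowers row plus column by one and the position by at
least one. -/
theorem sum_le (h : IsBoxSeq k t) (hm : m < k) : (t m).1 + (t m).2 ≤ m := by
  induction m using Nat.strong_induction_on with
  | _ m ih =>
    rcases hb : t m with ⟨_ | r, _ | c⟩
    · simp
    · obtain ⟨j, hj, hj'⟩ := h.left m hm _ c hb
      have := ih j hj (by omega)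
      rw [hj'] at this
      simp only at this ⊢
      omega
    · obtain ⟨j, hj, hj'⟩ := h.up m hm _ _ hb
      have := ih j hj (by omega)
      rw [hj'] at this
      simp only at this ⊢
      omega
    · obtain ⟨j, hj, hj'⟩ := h.up m hm _ _ hb
      have := ih j hj (by omega)
      rw [hj'] at this
      simp only at this ⊢
      omega

/-- Ensures that the eigenvalue at position `m` is among the interpolation nodes of Murphy's
formula. -/
theorem content_mem (h : IsBoxSeq k t) (hm : m < k) :
    boxContent (t m) ∈ Finset.Icc (-(m : ℤ)) m := by
  have := h.sum_le hm
  simp only [boxContent, Finset.mem_Icc]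
  omega

/-- Exchanging consecutive entries that do not stand in adjacent boxes. -/
theorem swap (h : IsBoxSeq k t) (hi : i + 1 < k)
    (h1 : t (i + 1) ≠ ((t i).1 + 1, (t i).2)) (h2 : t (i + 1) ≠ ((t i).1, (t i).2 + 1)) :
    IsBoxSeq k (t ∘ Equiv.swap i (i + 1)) := by
  have hs : ∀ j < k, Equiv.swap i (i + 1) j < k := by
    intro j hj
    rw [Equiv.swap_apply_def]
    split_ifs <;> omega
  have key : ∀ m < k, ∀ b : ℕ × ℕ,
      (t (Equiv.swap i (i + 1) m) = (b.1 + 1, b.2) ∨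
        t (Equiv.swap i (i + 1) m) = (b.1, b.2 + 1)) →
      (∃ j < Equiv.swap i (i + 1) m, t j = b) →
      ∃ j < m, (t ∘ Equiv.swap i (i + 1)) j = b := by
    rintro m hm b hb ⟨j, hj, rfl⟩
    refine ⟨Equiv.swap i (i + 1) j, ?_, by simp⟩
    by_cases hm1 : m = i
    · subst hm1
      rw [Equiv.swap_apply_left] at hj hb
      -- The only place where non-adjacency matters: the box moved forward must not have its
      -- neighbour in the box that it overtakes.
      have hjm : j ≠ m := by
        rintro rfl
        rcases hb with hb | hb
        · exact h1 hb
        · exact h2 hb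
      rw [Equiv.swap_apply_of_ne_of_ne] <;> omega
    · by_cases hm2 : m = i + 1
      · subst hm2
        rw [Equiv.swap_apply_right] at hj
        rw [Equiv.swap_apply_of_ne_of_ne] <;> omega
      · rw [Equiv.swap_apply_of_ne_of_ne hm1 hm2] at hj
        rw [Equiv.swap_apply_def]
        split_ifs <;> omega
  refine ⟨fun a ha b hb hab => ?_, fun m hm r c hrc => ?_, fun m hm r c hrc => ?_⟩
  · exact (Equiv.swap i (i + 1)).injective (h.inj _ (hs a ha) _ (hs b hb) hab)
  · exact key m hm (r, c) (Or.inl hrc) (h.up _ (hs m hm) r c hrc)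
  · exact key m hm (r, c) (Or.inr hrc) (h.left _ (hs m hm) r c hrc)

/-- Consecutive entries that can be exchanged have contents that differ by at least two. -/
theorem content_gap (h : IsBoxSeq k t) (hi : i + 1 < k)
    (h' : IsBoxSeq k (t ∘ Equiv.swap i (i + 1))) :
    boxContent (t i) + 1 < boxContent (t (i + 1)) ∨
      boxContent (t (i + 1)) + 1 < boxContent (t i) := by
  by_contra! hc
  -- Both boxes can be added to the diagram of the first `i` boxes: one by `t`, the other by the
  -- exchanged sequence.
  have := (h.mono (l := i + 1) (by omega)).addable_unique (h'.mono (l := i + 1) (by omega))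
    (fun j hj => by
      simp [Equiv.swap_apply_of_ne_of_ne (show j ≠ i by omega) (show j ≠ i + 1 by omega)])
    (by simpa using hc.2) (by simpa using hc.1)
  simp only [Function.comp_apply, Equiv.swap_apply_left] at this
  have := h.inj _ (by omega) _ hi this
  omega

/-- Adding a box. -/
theorem update (h : IsBoxSeq k t) {b : ℕ × ℕ} (hb : ∀ j < k, t j ≠ b)
    (h1 : ∀ r c, b = (r + 1, c) → ∃ j < k, t j = (r, c))
    (h2 : ∀ r c, b = (r, c + 1) → ∃ j < k, t j = (r, c)) :
    IsBoxSeq (k + 1) (Function.update t k b) := by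
  have e : ∀ j < k, Function.update t k b j = t j := fun j hj =>
    Function.update_of_ne (by omega) _ _
  have h0 := h.congr (fun j hj => (e j hj).symm)
  refine ⟨fun i hi j hj hij => ?_, fun m hm r c hrc => ?_, fun m hm r c hrc => ?_⟩
  · rcases Nat.lt_succ_iff_lt_or_eq.1 hi with hi | rfl <;>
      rcases Nat.lt_succ_iff_lt_or_eq.1 hj with hj | rfl
    · exact h0.inj i hi j hj hij
    · rw [e i hi, Function.update_self] at hij
      exact absurd hij (hb i hi)
    · rw [e j hj, Function.update_self] at hij
      exact absurd hij.symm (hb j hj)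
    · rfl
  · rcases Nat.lt_succ_iff_lt_or_eq.1 hm with hm | rfl
    · exact h0.up m hm r c hrc
    · rw [Function.update_self] at hrc
      obtain ⟨j, hj, hj'⟩ := h1 r c hrc
      exact ⟨j, hj, by rw [e j hj, hj']⟩
  · rcases Nat.lt_succ_iff_lt_or_eq.1 hm with hm | rfl
    · exact h0.left m hm r c hrc
    · rw [Function.update_self] at hrc
      obtain ⟨j, hj, hj'⟩ := h2 r c hrc
      exact ⟨j, hj, by rw [e j hj, hj']⟩

/-- Together with the substitution q ↦ -q⁻¹ this reduces statements about columns to statements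
about rows. -/
theorem transpose (h : IsBoxSeq k t) : IsBoxSeq k (Prod.swap ∘ t) := by
  refine ⟨fun i hi j hj hij => h.inj i hi j hj (Prod.swap_injective hij), ?_, ?_⟩
  · intro m hm r c hrc
    obtain ⟨j, hj, hj'⟩ := h.left m hm c r (by rw [← Prod.swap_swap (t m)]; simp_all)
    exact ⟨j, hj, by simp [hj']⟩
  · intro m hm r c hrc
    obtain ⟨j, hj, hj'⟩ := h.up m hm c r (by rw [← Prod.swap_swap (t m)]; simp_all)
    exact ⟨j, hj, by simp [hj']⟩

end IsBoxSeq

theorem boxContent_swap (b : ℕ × ℕ) : boxContent b.swap = -boxContent b := by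
  simp [boxContent]

/-! ### Jucys-Murphy elements and intertwiners -/

section Intertwiner

variable {E : Type*} [Ring E] [Algebra ℂ E]

/-- The relations of `H_k(q)` for the elements `s 0, …, s (k - 2)` of an algebra. -/
structure IsHeckeFamily (q : ℂ) (k : ℕ) (s : ℕ → E) : Prop where
  braid : ∀ i, i + 2 < k → s i * s (i + 1) * s i = s (i + 1) * s i * s (i + 1)
  comm : ∀ i j, i + 2 ≤ j → j + 1 < k → Commute (s i) (s j)
  quad : ∀ i, i + 1 < k → s i * s i = 1 + (q - q⁻¹) • s i

/-- The Jucys-Murphy elements that are built from the family `s`. -/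
def jmElem (s : ℕ → E) : ℕ → E
  | 0 => 1
  | m + 1 => s m * jmElem s m * s m

/-- The element `σ_i (J_i - J_{i+1}) + (q - q⁻¹) J_{i+1}` that exchanges the eigenvalues of
`J_i` and `J_{i+1}`. -/
noncomputable def intertwiner (q : ℂ) (s : ℕ → E) (i : ℕ) : E :=
  s i * (jmElem s i - jmElem s (i + 1)) + (q - q⁻¹) • jmElem s (i + 1)

namespace IsHeckeFamily

variable {q : ℂ} {k i m l : ℕ} {s : ℕ → E}

theorem jm_comm_of_lt (h : IsHeckeFamily q k s) (hm : m < i) (hi : i + 1 < k) :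
    Commute (jmElem s m) (s i) := by
  induction m with
  | zero => exact Commute.one_left _
  | succ m ih =>
    have := h.comm m i (by omega) hi
    exact (this.mul_left (ih (by omega))).mul_left this

/-- The essential case is `m = i + 2`: the element is s_{i+1} s_i J_i s_i s_{i+1} with J_i commuting
with s_{i+1}, and two braid moves carry s_i from one end to the other. -/
theorem jm_comm_of_gt (h : IsHeckeFamily q k s) (hm : i + 1 < m) (hk : m < k) :
    Commute (jmElem s m) (s i) := by
  induction m with
  | zero => omega
  | succ m ih =>
    rcases Nat.lt_or_ge (i + 1) m with hm' | hm'
    · have := (h.comm i m (by omega) (by omega)).symm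
      exact (this.mul_left (ih hm' (by omega))).mul_left this
    · obtain rfl : m = i + 1 := by omega
      have hb := h.braid i (by omega)
      have hJ : jmElem s i * s (i + 1) = s (i + 1) * jmElem s i :=
        h.jm_comm_of_lt (Nat.lt_succ_self i) (by omega)
      symm
      change s i * (s (i + 1) * (s i * jmElem s i * s i) * s (i + 1)) =
        s (i + 1) * (s i * jmElem s i * s i) * s (i + 1) * s i
      calc _ = (s i * s (i + 1) * s i) * jmElem s i * (s i * s (i + 1)) := by simp only [mul_assoc]
        _ = s (i + 1) * s i * (s (i + 1) * jmElem s i) * (s i * s (i + 1)) := by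
          rw [hb]; simp only [mul_assoc]
        _ = s (i + 1) * s i * jmElem s i * (s (i + 1) * s i * s (i + 1)) := by
          rw [← hJ]; simp only [mul_assoc]
        _ = _ := by rw [← hb]; simp only [mul_assoc]

theorem jm_comm (h : IsHeckeFamily q k s) (hm : m < k) (hl : l < k) :
    Commute (jmElem s m) (jmElem s l) := by
  have key : ∀ l m : ℕ, l < m → m < k → Commute (jmElem s m) (jmElem s l) := by
    intro l
    induction l with
    | zero => intro m _ _; exact Commute.one_right _
    | succ l ih =>
      intro m hl hm
      have := h.jm_comm_of_gt hl hm
      exact (this.mul_right (ih m (by omega) hm)).mul_right this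
  rcases lt_trichotomy l m with h1 | rfl | h1
  · exact key l m h1 hm
  · exact Commute.refl _
  · exact (key m l h1 hl).symm

theorem jm_mul_s (h : IsHeckeFamily q k s) (hi : i + 1 < k) :
    jmElem s i * s i = s i * jmElem s (i + 1) - (q - q⁻¹) • jmElem s (i + 1) := by
  have h1 : s i * jmElem s (i + 1) =
      (s i * s i) * (jmElem s i * s i) := by simp only [jmElem, mul_assoc]
  rw [h1, h.quad i hi, add_mul, one_mul, smul_mul_assoc]
  simp only [jmElem, mul_assoc, add_sub_cancel_right]

theorem jm_succ_mul_s (h : IsHeckeFamily q k s) (hi : i + 1 < k) :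
    jmElem s (i + 1) * s i = s i * jmElem s i + (q - q⁻¹) • jmElem s (i + 1) := by
  have h1 : jmElem s (i + 1) * s i =
      (s i * jmElem s i) * (s i * s i) := by simp only [jmElem, mul_assoc]
  rw [h1, h.quad i hi, mul_add, mul_one, mul_smul_comm]
  simp only [jmElem, mul_assoc]

theorem jm_mul_intertwiner (h : IsHeckeFamily q k s) (hi : i + 1 < k) :
    jmElem s i * intertwiner q s i = intertwiner q s i * jmElem s (i + 1) := by
  have h1 := h.jm_mul_s hi
  have h3 : jmElem s i * jmElem s (i + 1) = jmElem s (i + 1) * jmElem s i :=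
    h.jm_comm (by omega) hi
  simp only [intertwiner, mul_add, add_mul, mul_sub, sub_mul, ← mul_assoc, mul_smul_comm,
    smul_mul_assoc, h1]
  simp only [mul_assoc, h3]
  module

theorem jm_succ_mul_intertwiner (h : IsHeckeFamily q k s) (hi : i + 1 < k) :
    jmElem s (i + 1) * intertwiner q s i = intertwiner q s i * jmElem s i := by
  have h1 := h.jm_succ_mul_s hi
  have h3 : jmElem s i * jmElem s (i + 1) = jmElem s (i + 1) * jmElem s i :=
    h.jm_comm (by omega) hi
  simp only [intertwiner, mul_add, add_mul, mul_sub, sub_mul, ← mul_assoc, mul_smul_comm,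
    smul_mul_assoc, h1]
  simp only [mul_assoc, h3]
  module

/-- The exchange relations move the second intertwiner past the Jucys-Murphy elements of the first,
and (q - q⁻¹)² = q² + q⁻² - 2 makes the result factor. On eigenvalues q^{2a}, q^{2b} with q generic,
the factors vanish only for contents that differ by exactly one. -/
theorem intertwiner_sq (h : IsHeckeFamily q k s) (hq : q ≠ 0) (hi : i + 1 < k) :
    intertwiner q s i * intertwiner q s i =
      (q ^ 2 • jmElem s i - jmElem s (i + 1)) *
        (jmElem s (i + 1) - (q ^ 2)⁻¹ • jmElem s i) := by
  have h3 : jmElem s i * jmElem s (i + 1) = jmElem s (i + 1) * jmElem s i :=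
    h.jm_comm (by omega) hi
  have h4 : intertwiner q s i * intertwiner q s i =
      s i * (jmElem s i * intertwiner q s i - jmElem s (i + 1) * intertwiner q s i) +
        (q - q⁻¹) • (jmElem s (i + 1) * intertwiner q s i) := by
    conv_lhs => enter [1]; rw [intertwiner]
    rw [add_mul, mul_assoc, sub_mul, smul_mul_assoc]
  rw [h4, h.jm_mul_intertwiner hi, h.jm_succ_mul_intertwiner hi, intertwiner]
  have h5 : ∀ z, s i * (s i * z) = z + (q - q⁻¹) • (s i * z) := by
    intro z
    rw [← mul_assoc, h.quad i hi, add_mul, one_mul, smul_mul_assoc]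
  have e : (q - q⁻¹) * (q - q⁻¹) = q ^ 2 + (q ^ 2)⁻¹ - 2 := by field_simp; ring
  simp only [mul_add, add_mul, mul_sub, sub_mul, mul_smul_comm, smul_mul_assoc, mul_assoc, h5, h3,
    smul_add, smul_sub, smul_smul, e]
  have e2 : (q ^ 2)⁻¹ * q ^ 2 = 1 := inv_mul_cancel₀ (by positivity)
  rw [e2]
  module

theorem jm_comm_intertwiner (h : IsHeckeFamily q k s) (hi : i + 1 < k) (hm : m < k) (h1 : m ≠ i)
    (h2 : m ≠ i + 1) : Commute (jmElem s m) (intertwiner q s i) := by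
  have h3 : Commute (jmElem s m) (s i) := by
    rcases Nat.lt_or_ge m i with h4 | h4
    · exact h.jm_comm_of_lt h4 hi
    · exact h.jm_comm_of_gt (by omega) hm
  have h4 := h.jm_comm hm (show i < k by omega)
  have h5 := h.jm_comm hm hi
  exact (h3.mul_right (h4.sub_right h5)).add_right (h5.smul_right _)

end IsHeckeFamily

theorem commute_jmElem {E : Type*} [Ring E] {s : ℕ → E} {k m : ℕ} {x : E}
    (h : ∀ i, i + 1 < k → Commute x (s i)) (hm : m < k) : Commute x (jmElem s m) := by
  induction m with
  | zero => exact Commute.one_right _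
  | succ m ih => exact ((h m hm).mul_right (ih (by omega))).mul_right (h m hm)

/-- This makes the intertwiners maps of modules over any algebra that centralizes the Hecke
generators. -/
theorem commute_intertwiner {q : ℂ} {s : ℕ → E} {k i : ℕ} {x : E}
    (h : ∀ i, i + 1 < k → Commute x (s i)) (hi : i + 1 < k) :
    Commute x (intertwiner q s i) := by
  have h1 := commute_jmElem h (show i < k by omega)
  have h2 := commute_jmElem h hi
  exact ((h i hi).mul_right (h1.sub_right h2)).add_right (h2.smul_right _)

end Intertwiner

/-! ### The joint spectrum of the Jucys-Murphy elements -/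

/-- The parameter is nonzero and its square is not a root of unity. -/
structure IsGenericParam (q : ℂ) : Prop where
  ne_zero : q ≠ 0
  pow_ne_one : ∀ m : ℕ, 0 < m → q ^ (2 * m) ≠ 1

namespace IsGenericParam

variable {q : ℂ}

theorem zpow_inj (h : IsGenericParam q) {a b : ℤ} (hab : q ^ (2 * a) = q ^ (2 * b)) : a = b := by
  have key : ∀ {a b : ℤ}, q ^ (2 * a) = q ^ (2 * b) → a ≤ b := by
    intro a b hab
    by_contra! hlt
    obtain ⟨n, hn⟩ := Int.eq_ofNat_of_zero_le (show 0 ≤ a - b by omega)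
    refine h.pow_ne_one n (by omega) ?_
    rw [← zpow_natCast, show ((2 * n : ℕ) : ℤ) = 2 * a - 2 * b by push_cast; omega,
      zpow_sub₀ h.ne_zero, hab, div_self (zpow_ne_zero _ h.ne_zero)]
  exact le_antisymm (key hab) (key hab.symm)

theorem sq_ne_one (h : IsGenericParam q) : q ^ 2 ≠ 1 := h.pow_ne_one 1 one_pos

theorem sub_inv_ne_zero (h : IsGenericParam q) : q - q⁻¹ ≠ 0 := by
  intro h0
  refine h.sq_ne_one ?_
  have := h.ne_zero
  field_simp at h0
  linear_combination h0

/-- The quadratic relation depends only on q - q⁻¹, which q ↦ -q⁻¹ preserves. Since (-q⁻¹)^{2c} =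
q^{-2c}, the substitution negates contents and so corresponds to transposing tableaux. -/
theorem neg_inv (h : IsGenericParam q) : IsGenericParam (-q⁻¹) where
  ne_zero := neg_ne_zero.2 (inv_ne_zero h.ne_zero)
  pow_ne_one m hm h1 := by
    refine h.pow_ne_one m hm ?_
    rw [pow_mul, neg_sq, ← pow_mul, inv_pow] at h1
    exact inv_eq_one.1 h1

theorem neg_inv_zpow (a : ℤ) : (-q⁻¹) ^ (2 * a) = q ^ (2 * -a) := by
  rw [zpow_mul, mul_neg, zpow_neg, zpow_mul, ← inv_zpow]
  congr 1
  simp [zpow_ofNat]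

end IsGenericParam

/-- The eigenvalue `q^{2c}` of the Jucys-Murphy element that belongs to the `m`-th box. -/
noncomputable def boxWeight (q : ℂ) (t : ℕ → ℕ × ℕ) (m : ℕ) : ℂ := q ^ (2 * boxContent (t m))

theorem boxWeight_ne_zero {q : ℂ} (hq : q ≠ 0) (t : ℕ → ℕ × ℕ) (m : ℕ) : boxWeight q t m ≠ 0 :=
  zpow_ne_zero _ hq

/-! ### Joint eigenspaces of the Jucys-Murphy operators and excluded configurations -/

section Module

variable {M : Type*} [AddCommGroup M] [Module ℂ M]

/-- The joint eigenspace of the first `k` Jucys-Murphy elements. -/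
def weightSpace (s : ℕ → Module.End ℂ M) (k : ℕ) (χ : ℕ → ℂ) : Submodule ℂ M where
  carrier := {v | ∀ m < k, jmElem s m v = χ m • v}
  add_mem' hv hw m hm := by rw [map_add, hv m hm, hw m hm, smul_add]
  zero_mem' m _ := by rw [map_zero, smul_zero]
  smul_mem' c v hv m hm := by rw [map_smul, hv m hm, smul_comm]

theorem mem_weightSpace {s : ℕ → Module.End ℂ M} {k : ℕ} {χ : ℕ → ℂ} {v : M} :
    v ∈ weightSpace s k χ ↔ ∀ m < k, jmElem s m v = χ m • v := Iff.rfl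

theorem weightSpace_congr {s : ℕ → Module.End ℂ M} {k : ℕ} {χ χ' : ℕ → ℂ}
    (h : ∀ m < k, χ m = χ' m) : weightSpace s k χ = weightSpace s k χ' := by
  ext v
  simp only [mem_weightSpace]
  exact forall₂_congr fun m hm => by rw [h m hm]

/-- The module is the sum of the joint eigenspaces of the first `k` Jucys-Murphy elements whose
eigenvalues are given by the contents of a standard tableau. -/
def IsTableauSpanned (q : ℂ) (s : ℕ → Module.End ℂ M) (k : ℕ) : Prop :=
  ⨆ t : {t : ℕ → ℕ × ℕ // IsBoxSeq k t}, weightSpace s k (boxWeight q t) = ⊤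

theorem IsTableauSpanned.neg_inv {q : ℂ} {s : ℕ → Module.End ℂ M} {k : ℕ}
    (h : IsTableauSpanned q s k) : IsTableauSpanned (-q⁻¹) s k := by
  rw [IsTableauSpanned, eq_top_iff, ← h]
  refine iSup_le fun t => le_iSup_of_le ⟨_, t.2.transpose⟩ (le_of_eq ?_)
  refine weightSpace_congr fun m _ => ?_
  simp [boxWeight, IsGenericParam.neg_inv_zpow, boxContent_swap]

theorem intertwiner_neg_inv (q : ℂ) (s : ℕ → Module.End ℂ M) (i : ℕ) :
    intertwiner (-q⁻¹) s i = intertwiner q s i := by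
  simp only [intertwiner, inv_neg, inv_inv]
  congr 2
  ring

/-- The eigenspace for μ and the generalized eigenspaces for the other eigenvalues already span. As
the latter meet the generalized eigenspace for μ trivially, the modular law leaves no room beyond
the eigenspace. -/
theorem eigenspace_of_iSup_eq_top {f : Module.End ℂ M} {ι : Type*} {W : ι → Submodule ℂ M}
    (hW : ∀ i, ∃ μ, W i ≤ f.eigenspace μ) (h : ⨆ i, W i = ⊤) (μ : ℂ) :
    f.maxGenEigenspace μ = f.eigenspace μ := by
  refine le_antisymm ?_ Module.End.eigenspace_le_maxGenEigenspace
  have h1 : f.eigenspace μ ⊔ ⨆ ν, ⨆ (_ : ν ≠ μ), f.maxGenEigenspace ν = ⊤ := by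
    rw [eq_top_iff, ← h]
    refine iSup_le fun i => ?_
    obtain ⟨ν, hν⟩ := hW i
    by_cases hνμ : ν = μ
    · subst hνμ
      exact hν.trans le_sup_left
    · exact (hν.trans Module.End.eigenspace_le_maxGenEigenspace).trans
        (le_sup_of_le_right (le_iSup₂_of_le ν hνμ le_rfl))
  have h2 := f.independent_maxGenEigenspace μ
  rw [disjoint_iff, inf_comm] at h2
  calc f.maxGenEigenspace μ = (f.eigenspace μ ⊔ ⨆ ν, ⨆ (_ : ν ≠ μ), f.maxGenEigenspace ν) ⊓
      f.maxGenEigenspace μ := by rw [h1, top_inf_eq]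
    _ = f.eigenspace μ := by
      rw [sup_inf_assoc_of_le _ Module.End.eigenspace_le_maxGenEigenspace, h2, sup_bot_eq]
    _ ≤ _ := le_rfl

theorem eq_zero_of_mem_maxGenEigenspace {f : Module.End ℂ M} {μ ν : ℂ} (h : μ ≠ ν) {v : M}
    (hv : v ∈ f.maxGenEigenspace μ) (h' : f v = ν • v) : v = 0 := by
  have := (f.disjoint_genEigenspace h ⊤ 1).le_bot
    ⟨hv, Module.End.mem_eigenspace_iff.2 h'⟩
  simpa using this

section Hecke

variable {q : ℂ} {s : ℕ → Module.End ℂ M} {k l K : ℕ}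

theorem apply_commute {f g : Module.End ℂ M} (h : Commute f g) (v : M) : f (g v) = g (f v) :=
  LinearMap.congr_fun h.eq v

theorem IsTableauSpanned.maxGenEigenspace_eq (S : IsTableauSpanned q s k) (hl : l < k) (μ : ℂ) :
    (jmElem s l).maxGenEigenspace μ = (jmElem s l).eigenspace μ :=
  eigenspace_of_iSup_eq_top
    (W := fun t : {t : ℕ → ℕ × ℕ // IsBoxSeq k t} => weightSpace s k (boxWeight q t))
    (fun t => ⟨boxWeight q t l, fun v (hv : v ∈ weightSpace s k (boxWeight q t)) =>
      Module.End.mem_eigenspace_iff.2 (hv l hl)⟩) S μ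

/-- Every joint eigenvalue is given by the contents of a standard tableau. -/
theorem IsTableauSpanned.exists_boxSeq (S : IsTableauSpanned q s k) (h : IsHeckeFamily q K s)
    (hk : k ≤ K) {χ : ℕ → ℂ} {v : M} (hv : v ∈ weightSpace s k χ) (hv0 : v ≠ 0) :
    ∃ t, IsBoxSeq k t ∧ ∀ m < k, χ m = boxWeight q t m := by
  by_contra! hc
  let f : Fin k → Module.End ℂ M := fun m => jmElem s m
  have hi := Module.End.independent_iInf_maxGenEigenspace_of_forall_mapsTo f (fun i j φ =>
    Module.End.mapsTo_maxGenEigenspace_of_comm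
      (h.jm_comm (m := j) (l := i) (by omega) (by omega)) φ) (fun m => χ m)
  have hle : ∀ χ : ℕ → ℂ, weightSpace s k χ ≤ ⨅ m, (f m).maxGenEigenspace (χ m) := fun χ =>
    le_iInf fun m => fun _ hv => Module.End.eigenspace_le_maxGenEigenspace
      (Module.End.mem_eigenspace_iff.2 (hv m m.2))
  refine hv0 ?_
  -- If χ came from no tableau, every summand of the spanning family would have a joint eigenvalue
  -- other than χ. The joint generalized eigenspaces different from that of χ would then span,
  -- against independence.
  have htop : (⊤ : Submodule ℂ M) ≤ ⨆ χ', ⨆ (_ : χ' ≠ fun m : Fin k => χ m),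
      ⨅ m, (f m).maxGenEigenspace (χ' m) := by
    rw [← S]
    refine iSup_le fun t => (hle _).trans
      (le_iSup₂_of_le (fun m : Fin k => boxWeight q t m) ?_ le_rfl)
    intro he
    obtain ⟨m, hm, hm'⟩ := hc t.1 t.2
    exact hm' (congrFun he ⟨m, hm⟩).symm
  have := hi.le_bot ⟨hle χ hv, htop Submodule.mem_top⟩
  simpa using this

theorem intertwiner_mem (h : IsHeckeFamily q K s) (hk : k ≤ K) {χ : ℕ → ℂ} {v : M}
    (hv : v ∈ weightSpace s k χ) {i : ℕ} (hi : i + 1 < k) :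
    intertwiner q s i v ∈ weightSpace s k (χ ∘ Equiv.swap i (i + 1)) := by
  intro m hm
  by_cases h1 : m = i
  · subst h1
    have := LinearMap.congr_fun (h.jm_mul_intertwiner (show m + 1 < K by omega)) v
    simp only [Module.End.mul_apply] at this
    rw [this, hv _ hi, map_smul]
    simp
  · by_cases h2 : m = i + 1
    · subst h2
      have := LinearMap.congr_fun (h.jm_succ_mul_intertwiner (show i + 1 < K by omega)) v
      simp only [Module.End.mul_apply] at this
      rw [this, hv i (by omega), map_smul]
      simp
    · rw [apply_commute (h.jm_comm_intertwiner (by omega) (by omega) h1 h2), hv m hm, map_smul]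
      simp [Equiv.swap_apply_of_ne_of_ne h1 h2]

theorem intertwiner_sq_apply (h : IsHeckeFamily q K s) (hq : q ≠ 0) {i : ℕ} (hi : i + 1 < K)
    {v : M} {a b : ℂ} (ha : jmElem s i v = a • v) (hb : jmElem s (i + 1) v = b • v) :
    intertwiner q s i (intertwiner q s i v) = ((q ^ 2 * a - b) * (b - (q ^ 2)⁻¹ * a)) • v := by
  have := LinearMap.congr_fun (h.intertwiner_sq hq hi) v
  simp only [Module.End.mul_apply, LinearMap.sub_apply, LinearMap.smul_apply, ha, hb, map_sub,
    map_smul] at this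
  rw [this]
  module

/-- With both eigenvalues inserted, vanishing of the intertwiner reads (a - q²a) s v + (q - q⁻¹) q²
a v = 0, and the first coefficient is nonzero. -/
theorem s_apply_of_intertwiner_eq_zero (hq : IsGenericParam q) {i : ℕ} {v : M} {a : ℂ}
    (ha0 : a ≠ 0) (ha : jmElem s i v = a • v) (hb : jmElem s (i + 1) v = (q ^ 2 * a) • v)
    (h0 : intertwiner q s i v = 0) : s i v = q • v := by
  simp only [intertwiner, LinearMap.add_apply, Module.End.mul_apply, LinearMap.sub_apply,
    LinearMap.smul_apply, ha, hb, ← sub_smul, map_smul] at h0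
  have h1 : (a - q ^ 2 * a) ≠ 0 := by
    rw [show a - q ^ 2 * a = -(q ^ 2 - 1) * a by ring]
    exact mul_ne_zero (neg_ne_zero.2 (sub_ne_zero.2 hq.sq_ne_one)) ha0
  have hq0 := hq.ne_zero
  refine smul_right_injective M h1 ?_
  simp only
  rw [eq_neg_of_add_eq_zero_left h0, smul_smul, smul_smul, ← neg_smul]
  congr 1
  field_simp
  ring

theorem _root_.HeckeREA.IsHeckeFamily.neg_inv (h : IsHeckeFamily q K s) :
    IsHeckeFamily (-q⁻¹) K s where
  braid := h.braid
  comm := h.comm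
  quad i hi := by
    rw [h.quad i hi, inv_neg, inv_inv]
    congr 2
    ring

/-- On consecutive adjacent boxes the intertwiner vanishes. -/
theorem intertwiner_eq_zero (hq : IsGenericParam q) (h : IsHeckeFamily q K s)
    (S : IsTableauSpanned q s k) (hk : k ≤ K) {t : ℕ → ℕ × ℕ} (ht : IsBoxSeq k t) {i : ℕ}
    (hi : i + 1 < k) (h1 : boxContent (t i) ≤ boxContent (t (i + 1)) + 1)
    (h2 : boxContent (t (i + 1)) ≤ boxContent (t i) + 1)
    (h3 : boxContent (t (i + 1)) ≠ boxContent (t i))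
    {v : M} (hv : v ∈ weightSpace s k (boxWeight q t)) : intertwiner q s i v = 0 := by
  by_contra h0
  -- A nonzero image would have the exchanged weight, hence come from a tableau that agrees with `t`
  -- up to position `i` and continues with the content of `t (i + 1)`. Two boxes addable to the same
  -- diagram cannot have contents that differ by one.
  obtain ⟨t', ht', he⟩ := S.exists_boxSeq h hk (intertwiner_mem h hk hv hi) h0
  have e1 : ∀ j < i, t j = t' j := by
    refine (ht.mono (show i ≤ k by omega)).ext_of_content (ht'.mono (by omega)) fun j hj => ?_
    have := he j (by omega)
    rw [Function.comp_apply, Equiv.swap_apply_of_ne_of_ne (by omega) (by omega)] at this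
    exact hq.zpow_inj this
  have e2 : boxContent (t (i + 1)) = boxContent (t' i) := by
    have := he i (by omega)
    rw [Function.comp_apply, Equiv.swap_apply_left] at this
    exact hq.zpow_inj this
  have := (ht.mono (show i + 1 ≤ k by omega)).addable_unique (ht'.mono (by omega)) e1
    (by rw [← e2]; exact h1) (by rw [← e2]; exact h2)
  rw [this] at h3
  exact h3 e2

theorem boxWeight_mul {t : ℕ → ℕ × ℕ} (hq : q ≠ 0) {i j : ℕ}
    (h : boxContent (t j) = boxContent (t i) + 1) : boxWeight q t j = q ^ 2 * boxWeight q t i := by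
  rw [boxWeight, boxWeight, h, mul_add, zpow_add₀ hq, mul_comm, mul_one]
  rfl

theorem gap_factor_ne_zero (hq : IsGenericParam q) {a b : ℤ} (h1 : b ≠ a + 1) (h2 : a ≠ b + 1) :
    (q ^ 2 * q ^ (2 * a) - q ^ (2 * b)) * (q ^ (2 * b) - (q ^ 2)⁻¹ * q ^ (2 * a)) ≠ 0 := by
  have hq0 := hq.ne_zero
  refine mul_ne_zero (fun h => h1 ?_) (fun h => h2 ?_)
  · refine hq.zpow_inj ?_
    rw [← sub_eq_zero.1 h, mul_add, zpow_add₀ hq0, mul_comm, mul_one]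
    rfl
  · refine hq.zpow_inj ?_
    rw [mul_add, zpow_add₀ hq0, sub_eq_zero.1 h, mul_one]
    have : q ^ (2 : ℤ) = q ^ 2 := rfl
    rw [this]
    field_simp

/-- A box whose upper neighbour is the end of its row cannot be followed by a box with the content
of that neighbour. -/
theorem eq_zero_of_corner (hq : IsGenericParam q) (h : IsHeckeFamily q K s)
    (hl : l + 1 < K) (S : IsTableauSpanned q s (l + 1)) {r c : ℕ} :
    ∀ (d p : ℕ) (t : ℕ → ℕ × ℕ) (_ : IsBoxSeq (l + 1) t) (u : M)
      (_ : u ∈ weightSpace s (l + 1) (boxWeight q t)) (_ : s l u = q • u)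
      (_ : t l = (r + 1, c)) (_ : l = p + 1 + d) (_ : t p = (r, c))
      (_ : ∀ j < l, t j ≠ (r, c + 1)), u = 0 := by
  intro d
  induction d with
  | zero =>
    intro p t ht u hu hsu htl hp htp hcor
    simp only [add_zero] at hp
    subst hp
    have hc : boxContent (t p) = boxContent (t (p + 1)) + 1 := by
      rw [htl, htp]
      simp only [boxContent]
      push_cast
      ring
    have h0 := intertwiner_eq_zero hq h S (by omega) ht (i := p) (by omega) (by omega) (by omega)
      (by omega) hu
    have hw := boxWeight_mul hq.ne_zero hc
    -- Entries `p` and `p + 1` stand one below the other, so the generator acts by -q⁻¹: the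
    -- horizontal case with q replaced by -q⁻¹.
    have hs : s p u = (-q⁻¹) • u := by
      refine s_apply_of_intertwiner_eq_zero hq.neg_inv (boxWeight_ne_zero hq.ne_zero t p)
        (hu p (by omega)) ?_ (by rw [intertwiner_neg_inv]; exact h0)
      rw [hu (p + 1) (by omega), hw]
      congr 1
      have := hq.ne_zero
      field_simp
    -- The two neighbouring generators act on `u` by -q⁻¹ and q. The braid relation would give q⁻¹ =
    -- -q, hence q⁴ = 1.
    have hb := LinearMap.congr_fun (h.braid p (by omega)) u
    simp only [Module.End.mul_apply, hs, hsu, map_smul, smul_smul] at hb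
    by_contra hu0
    have := smul_left_injective ℂ hu0 hb
    have hq0 := hq.ne_zero
    refine hq.pow_ne_one 2 (by norm_num) ?_
    field_simp at this
    linear_combination (q ^ 2 - 1) * this
  | succ d ih =>
    intro p t ht u hu hsu htl hp htp hcor
    -- The entry of the box (r, c) is raised by one, towards the base case. The exchange is legal:
    -- the box below (r, c) holds the last entry, which is not `p + 1`, and the box to its right is
    -- absent.
    have ht' : IsBoxSeq (l + 1) (t ∘ Equiv.swap p (p + 1)) := by
      refine ht.swap (by omega) ?_ ?_
      · intro h1
        rw [htp, ← htl] at h1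
        have := ht.inj _ (by omega) _ (by omega) h1
        omega
      · intro h1
        rw [htp] at h1
        exact hcor _ (by omega) h1
    have hcomm : Commute (s l) (intertwiner q s p) := by
      have h1 := (h.comm p l (by omega) hl).symm
      have h2 := (h.jm_comm_of_lt (show p < l by omega) hl).symm
      have h3 := (h.jm_comm_of_lt (show p + 1 < l by omega) hl).symm
      exact (h1.mul_right (h2.sub_right h3)).add_right (h3.smul_right _)
    have h0 := ih (p + 1) _ ht' (intertwiner q s p u)
      (intertwiner_mem h (by omega) hu (by omega))
      (by rw [apply_commute hcomm, hsu, map_smul])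
      (by
        rw [Function.comp_apply, Equiv.swap_apply_of_ne_of_ne (by omega) (by omega), htl])
      (by omega) (by simpa using htp)
      (by
        intro j hj
        rw [Function.comp_apply]
        refine hcor _ ?_
        rw [Equiv.swap_apply_def]
        split_ifs <;> omega)
    -- The image of `u` is zero by induction, while the intertwiner squares to a nonzero scalar on
    -- `u`.
    have h1 := intertwiner_sq_apply h hq.ne_zero (show p + 1 < K by omega)
      (hu p (by omega)) (hu (p + 1) (by omega))
    rw [h0, map_zero] at h1
    have hgap := ht.content_gap (by omega) ht'
    exact (smul_eq_zero.1 h1.symm).resolve_left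
      (gap_factor_ne_zero hq (by omega) (by omega))

theorem mem_weightSpace_update {t : ℕ → ℕ × ℕ} {u : M} {b : ℕ × ℕ}
    (hu : u ∈ weightSpace s k (boxWeight q t)) (hb : jmElem s k u = q ^ (2 * boxContent b) • u) :
    u ∈ weightSpace s (k + 1) (boxWeight q (Function.update t k b)) := by
  intro m hm
  rcases Nat.lt_succ_iff_lt_or_eq.1 hm with hm | rfl
  · rw [hu m hm, boxWeight, boxWeight, Function.update_of_ne (by omega)]
  · rw [hb, boxWeight, Function.update_self]

/-- The eigenvalue is that of the box to the right of the last one. The box can fail to be addable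
only if the box above it is missing, which `eq_zero_of_corner` excludes because `s l` acts on `u` by
q. -/
theorem exists_boxSeq_right (hq : IsGenericParam q) (h : IsHeckeFamily q K s)
    (hl : l + 1 < K) (S : IsTableauSpanned q s (l + 1)) {t : ℕ → ℕ × ℕ}
    (ht : IsBoxSeq (l + 1) t) {u : M} (hu : u ∈ weightSpace s (l + 1) (boxWeight q t))
    (hu0 : u ≠ 0) (hJ : jmElem s (l + 1) u = (q ^ 2 * boxWeight q t l) • u)
    (h0 : intertwiner q s l u = 0) :
    ∃ t', IsBoxSeq (l + 2) t' ∧ u ∈ weightSpace s (l + 2) (boxWeight q t') := by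
  have hsu := s_apply_of_intertwiner_eq_zero hq (boxWeight_ne_zero hq.ne_zero t l)
    (hu l (by omega)) hJ h0
  rcases htl : t l with ⟨r, c⟩
  refine ⟨Function.update t (l + 1) (r, c + 1), ht.update ?_ ?_ ?_, mem_weightSpace_update hu ?_⟩
  · intro j hj hj'
    -- If (r, c + 1) were present, then (r, c) would precede it, but (r, c) is the last box.
    obtain ⟨i, hi, hi'⟩ := ht.lower hj (b := (r, c)) (by rw [hj']) (by rw [hj']; simp)
    have := ht.inj i (by omega) l (by omega) (by rw [hi', htl])
    obtain rfl : j = l := by omega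
    rw [htl] at hj'
    simp at hj'
  · intro r' c' hrc
    simp only [Prod.mk.injEq] at hrc
    obtain ⟨rfl, rfl⟩ := hrc
    obtain ⟨p, hp, htp⟩ := ht.up l (by omega) _ _ htl
    by_contra! hc
    exact hu0 (eq_zero_of_corner hq h hl S (l - p - 1) p t ht u hu hsu htl (by omega) htp
      fun j hj => hc j (by omega))
  · intro r' c' hrc
    simp only [Prod.mk.injEq, add_left_inj] at hrc
    obtain ⟨rfl, rfl⟩ := hrc
    exact ⟨l, by omega, htl⟩
  · rw [hJ]
    have := boxWeight_mul (t := Function.update t (l + 1) (r, c + 1)) hq.ne_zero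
      (i := l) (j := l + 1) (by
        rw [Function.update_self, Function.update_of_ne (by omega), htl]
        simp only [boxContent]
        push_cast
        ring)
    rw [boxWeight, Function.update_self, boxWeight, Function.update_of_ne (by omega)] at this
    rw [this, boxWeight]

/-- The transpose of `exists_boxSeq_right`, with q replaced by -q⁻¹. -/
theorem exists_boxSeq_below (hq : IsGenericParam q) (h : IsHeckeFamily q K s)
    (hl : l + 1 < K) (S : IsTableauSpanned q s (l + 1)) {t : ℕ → ℕ × ℕ}
    (ht : IsBoxSeq (l + 1) t) {u : M} (hu : u ∈ weightSpace s (l + 1) (boxWeight q t))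
    (hu0 : u ≠ 0) (hJ : jmElem s (l + 1) u = ((q ^ 2)⁻¹ * boxWeight q t l) • u)
    (h0 : intertwiner q s l u = 0) :
    ∃ t', IsBoxSeq (l + 2) t' ∧ u ∈ weightSpace s (l + 2) (boxWeight q t') := by
  have e : ∀ (q : ℂ) (t : ℕ → ℕ × ℕ), boxWeight (-q⁻¹) (Prod.swap ∘ t) = boxWeight q t := by
    intro q t
    funext m
    simp [boxWeight, IsGenericParam.neg_inv_zpow, boxContent_swap]
  obtain ⟨t', ht', hu'⟩ := exists_boxSeq_right hq.neg_inv h.neg_inv hl S.neg_inv ht.transpose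
    (by rw [e]; exact hu) hu0 (by rw [e, hJ]; simp) (by rw [intertwiner_neg_inv]; exact h0)
  refine ⟨_, ht'.transpose, ?_⟩
  have := e (-q⁻¹) t'
  rw [inv_neg, inv_inv, neg_neg] at this
  rwa [this]

end Hecke

end Module

/-! ### The inductive step for the spectrum, and the exchange of tableaux -/

section Spectrum

variable {M : Type*} [AddCommGroup M] [Module ℂ M] {q : ℂ} {s : ℕ → Module.End ℂ M} {k l K : ℕ}

/-- The intertwiner carries generalized eigenvectors of `jmElem s (l + 1)` to those of `jmElem s l`,
which is already known to be diagonalizable. -/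
theorem intertwiner_eigen_of_maxGen (h : IsHeckeFamily q K s) (hl : l + 1 < K)
    (S : IsTableauSpanned q s (l + 1)) {u : M} {b : ℂ}
    (hu : u ∈ (jmElem s (l + 1)).maxGenEigenspace b) :
    jmElem s l (intertwiner q s l u) = b • intertwiner q s l u := by
  rw [← Module.End.mem_eigenspace_iff, ← S.maxGenEigenspace_eq (Nat.lt_succ_self l),
    Module.End.mem_maxGenEigenspace]
  obtain ⟨n, hn⟩ := (Module.End.mem_maxGenEigenspace _ _ _).1 hu
  refine ⟨n, ?_⟩
  have h1 : SemiconjBy (intertwiner q s l) (jmElem s (l + 1) - b • 1) (jmElem s l - b • 1) := by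
    rw [SemiconjBy, mul_sub, sub_mul, h.jm_mul_intertwiner hl]
    simp
  have := LinearMap.congr_fun (h1.pow_right n).eq u
  rw [Module.End.mul_apply, Module.End.mul_apply, hn, map_zero] at this
  exact this.symm

/-- If the factor `(q² a - b) (b - q⁻² a)` does not vanish, the eigenvalue `b` of `J_{l+1}` on
the joint eigenspace with `J_l = a` is semisimple. -/
theorem eigen_of_maxGen (h : IsHeckeFamily q K s) (hq : q ≠ 0) (hl : l + 1 < K)
    (S : IsTableauSpanned q s (l + 1)) {u : M} {a b : ℂ} (ha : jmElem s l u = a • u)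
    (hu : u ∈ (jmElem s (l + 1)).maxGenEigenspace b) (h1 : b ≠ q ^ 2 * a)
    (h2 : b ≠ (q ^ 2)⁻¹ * a) : jmElem s (l + 1) u = b • u := by
  have hcomm := h.jm_comm (show l < K by omega) hl
  set y := jmElem s (l + 1) with hy
  have hmem : ∀ {v}, v ∈ y.maxGenEigenspace b → ∀ c : ℂ, y v - c • v ∈ y.maxGenEigenspace b := by
    intro v hv c
    exact sub_mem (Module.End.mapsTo_maxGenEigenspace_of_comm (Commute.refl y) b hv)
      (Submodule.smul_mem _ _ hv)
  have hx : ∀ {v}, jmElem s l v = a • v → ∀ c : ℂ,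
      jmElem s l (y v - c • v) = a • (y v - c • v) := by
    intro v hv c
    rw [map_sub, map_smul, apply_commute hcomm, hv, map_smul, smul_sub, smul_comm a c]
  -- The image of `u` is a genuine eigenvector for b, so the intertwiner kills the defect (y - b)u.
  -- Its square, a polynomial in y there, then annihilates the defect as well.
  have h3 : intertwiner q s l (y u - b • u) = 0 := by
    have e1 := intertwiner_eigen_of_maxGen h hl S hu
    have e2 := LinearMap.congr_fun (h.jm_mul_intertwiner hl) u
    simp only [Module.End.mul_apply] at e2
    rw [map_sub, map_smul, ← e1, e2, sub_self]
  have h4 := LinearMap.congr_fun (h.intertwiner_sq hq hl) (y u - b • u)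
  rw [Module.End.mul_apply, h3, map_zero, Module.End.mul_apply, LinearMap.sub_apply,
    LinearMap.smul_apply, LinearMap.sub_apply, LinearMap.smul_apply, ← hy, hx ha, smul_smul] at h4
  set w := y u - b • u with hw
  have hw1 := hmem hu b
  have hw2 := hx ha b
  have hz := hx hw2 ((q ^ 2)⁻¹ * a)
  -- The two roots q²a and q⁻²a are both different from b, so each factor can be cancelled on the
  -- generalized eigenspace for b.
  have h5 : y w - ((q ^ 2)⁻¹ * a) • w = 0 := by
    refine eq_zero_of_mem_maxGenEigenspace h1 (hmem hw1 _) ?_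
    rw [hz, smul_smul] at h4
    exact (sub_eq_zero.1 h4.symm).symm
  have h6 := eq_zero_of_mem_maxGenEigenspace h2 hw1 (sub_eq_zero.1 h5)
  exact sub_eq_zero.1 h6

/-- If the intertwiner vanishes on an invariant piece of the generalized eigenspace, then
`J_{l+1}` is given there by a neighbouring content. -/
theorem eigen_of_intertwiner_eq_zero (h : IsHeckeFamily q K s) (hq : IsGenericParam q)
    (hl : l + 1 < K) {u : M} {a b : ℂ} (ha0 : a ≠ 0) (ha : jmElem s l u = a • u)
    (hu : u ∈ (jmElem s (l + 1)).maxGenEigenspace b) (h0 : intertwiner q s l u = 0) :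
    jmElem s (l + 1) u = (q ^ 2 * a) • u ∨ jmElem s (l + 1) u = ((q ^ 2)⁻¹ * a) • u := by
  have hcomm := h.jm_comm (show l < K by omega) hl
  set y := jmElem s (l + 1) with hy
  have hmem : ∀ {v}, v ∈ y.maxGenEigenspace b → ∀ c : ℂ, y v - c • v ∈ y.maxGenEigenspace b := by
    intro v hv c
    exact sub_mem (Module.End.mapsTo_maxGenEigenspace_of_comm (Commute.refl y) b hv)
      (Submodule.smul_mem _ _ hv)
  have h4 := LinearMap.congr_fun (h.intertwiner_sq hq.ne_zero hl) u
  rw [Module.End.mul_apply, h0, map_zero, Module.End.mul_apply, LinearMap.sub_apply,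
    LinearMap.smul_apply, LinearMap.sub_apply, LinearMap.smul_apply, ← hy, ha, smul_smul] at h4
  have hx : jmElem s l (y u - ((q ^ 2)⁻¹ * a) • u) = a • (y u - ((q ^ 2)⁻¹ * a) • u) := by
    rw [map_sub, map_smul, apply_commute hcomm, ha, map_smul, smul_sub, smul_comm a]
  rw [hx, smul_smul] at h4
  -- The vector is killed by (q²a - y)(y - q⁻²a), and at most one of the two distinct roots equals
  -- b. The other factor is cancelled on the generalized eigenspace.
  by_cases hb : b = q ^ 2 * a
  · left
    have h5 : y (y u - (q ^ 2 * a) • u) = ((q ^ 2)⁻¹ * a) • (y u - (q ^ 2 * a) • u) := by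
      have := (sub_eq_zero.1 h4.symm).symm
      rw [map_sub, map_smul] at this ⊢
      rw [sub_eq_iff_eq_add] at this
      rw [this]
      module
    have h6 : b ≠ (q ^ 2)⁻¹ * a := by
      rw [hb]
      intro h7
      have h8 := mul_right_cancel₀ ha0 h7
      have hq0 := hq.ne_zero
      refine hq.pow_ne_one 2 (by norm_num) ?_
      field_simp at h8
      linear_combination h8
    exact sub_eq_zero.1 (eq_zero_of_mem_maxGenEigenspace h6 (hmem hu _) h5)
  · right
    exact sub_eq_zero.1
      (eq_zero_of_mem_maxGenEigenspace hb (hmem hu _) (sub_eq_zero.1 h4.symm).symm)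

/-- The inductive step: a vector with the weight of a tableau, in one generalized eigenspace of the
next operator, is an honest weight vector of an enlarged tableau. A vanishing intertwiner gives a
box adjacent to the last one, a non-vanishing one a box that could also have taken the last place.
-/
theorem weightSpace_inf_maxGen_le (h : IsHeckeFamily q K s) (hq : IsGenericParam q)
    (hl : l + 1 < K) (S : IsTableauSpanned q s (l + 1)) {t : ℕ → ℕ × ℕ}
    (ht : IsBoxSeq (l + 1) t) (b : ℂ) :
    weightSpace s (l + 1) (boxWeight q t) ⊓ (jmElem s (l + 1)).maxGenEigenspace b ≤
      ⨆ t : {t : ℕ → ℕ × ℕ // IsBoxSeq (l + 2) t}, weightSpace s (l + 2) (boxWeight q t) := by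
  rintro u ⟨hu, hub⟩
  by_cases hu0 : u = 0
  · rw [hu0]
    exact zero_mem _
  have key : (∃ t', IsBoxSeq (l + 2) t' ∧ u ∈ weightSpace s (l + 2) (boxWeight q t')) →
      u ∈ ⨆ t : {t : ℕ → ℕ × ℕ // IsBoxSeq (l + 2) t},
        weightSpace s (l + 2) (boxWeight q t) := by
    rintro ⟨t', ht', hu'⟩
    exact Submodule.mem_iSup_of_mem ⟨t', ht'⟩ hu'
  have ha0 := boxWeight_ne_zero hq.ne_zero t l
  refine key ?_
  by_cases h0 : intertwiner q s l u = 0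
  · rcases eigen_of_intertwiner_eq_zero h hq hl ha0 (hu l (by omega)) hub h0 with hJ | hJ
    · exact exists_boxSeq_right hq h hl S ht hu hu0 hJ h0
    · exact exists_boxSeq_below hq h hl S ht hu hu0 hJ h0
  · have hφ := intertwiner_eigen_of_maxGen h hl S hub
    have hφm : intertwiner q s l u ∈
        weightSpace s (l + 1) (Function.update (boxWeight q t) l b) := by
      intro m hm
      rcases Nat.lt_succ_iff_lt_or_eq.1 hm with hm | rfl
      · rw [apply_commute (h.jm_comm_intertwiner hl (by omega) (by omega) (by omega)),
          hu m (by omega), map_smul, Function.update_of_ne (by omega)]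
      · rw [hφ, Function.update_self]
    -- The image has weight b in place of the last weight of `t`. By induction b belongs to a box
    -- `t' l` that can be added to the first `l` boxes of `t`.
    obtain ⟨t', ht', he⟩ := S.exists_boxSeq h (by omega) hφm h0
    have hb : b = boxWeight q t' l := by simpa using he l (by omega)
    have e1 : ∀ j < l, t j = t' j :=
      (ht.mono (Nat.le_succ l)).ext_of_content (ht'.mono (Nat.le_succ l)) fun j hj => by
        have := he j (by omega)
        rw [Function.update_of_ne (by omega)] at this
        exact hq.zpow_inj this
    have hgap : boxContent (t' l) ≠ boxContent (t l) + 1 ∧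
        boxContent (t l) ≠ boxContent (t' l) + 1 := by
      refine ⟨fun hc => ?_, fun hc => ?_⟩ <;>
      · have := ht.addable_unique ht' e1 (by omega) (by omega)
        rw [this] at hc
        omega
    have hne := gap_factor_ne_zero hq hgap.1 hgap.2
    have hne1 := left_ne_zero_of_mul hne
    have hne2 := right_ne_zero_of_mul hne
    have hJ := eigen_of_maxGen h hq.ne_zero hl S (hu l (by omega)) hub
      (fun hc => hne1 (by rw [sub_eq_zero]; exact (hb.symm.trans hc).symm))
      (fun hc => hne2 (by rw [sub_eq_zero]; exact (hb.symm.trans hc)))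
    by_cases htt : t' l = t l
    · exfalso
      have hba : b = boxWeight q t l := by rw [hb, boxWeight, boxWeight, htt]
      have h1 := LinearMap.congr_fun (h.jm_mul_s hl) u
      simp only [Module.End.mul_apply, LinearMap.sub_apply, LinearMap.smul_apply, hJ,
        map_smul] at h1
      -- Equal consecutive weights would make u and s u span a Jordan block of `jmElem s l`: (x - b)
      -- s u is a nonzero multiple of u, while (x - b)² s u = 0. This contradicts diagonalizability.
      have h2 : jmElem s l (s l u) = b • s l u := by
        rw [← Module.End.mem_eigenspace_iff, ← S.maxGenEigenspace_eq (Nat.lt_succ_self l),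
          Module.End.mem_maxGenEigenspace]
        refine ⟨2, ?_⟩
        have hxu : jmElem s l u = b • u := by
          rw [hba]
          exact hu l (by omega)
        simp only [pow_two, Module.End.mul_apply, LinearMap.sub_apply, LinearMap.smul_apply,
          Module.End.one_apply, map_sub, map_smul, h1, hxu]
        module
      rw [h2, eq_comm, sub_eq_self, smul_smul, smul_eq_zero] at h1
      refine hu0 (h1.resolve_left (mul_ne_zero hq.sub_inv_ne_zero ?_))
      rw [hba]
      exact ha0
    -- The new box differs from the last box of `t`, and both fit the same smaller diagram, so it
    -- can be appended to `t`: its neighbours are among the first `l` boxes.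
    · refine ⟨Function.update t (l + 1) (t' l), ?_,
        mem_weightSpace_update hu (by rw [hJ, hb, boxWeight])⟩
      refine ht.update (fun j hj hj' => ?_) (fun r c hrc => ?_) (fun r c hrc => ?_)
      · rcases Nat.lt_succ_iff_lt_or_eq.1 hj with hj | rfl
        · rw [e1 j hj] at hj'
          have := ht'.inj j (by omega) l (by omega) hj'
          omega
        · exact htt hj'.symm
      · obtain ⟨j, hj, hj'⟩ := ht'.up l (by omega) r c hrc
        exact ⟨j, by omega, by rw [e1 j hj, hj']⟩
      · obtain ⟨j, hj, hj'⟩ := ht'.left l (by omega) r c hrc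
        exact ⟨j, by omega, by rw [e1 j hj, hj']⟩

/-- Each joint eigenspace is invariant under the next, commuting operator. In finite dimension over
ℂ it splits into its intersections with generalized eigenspaces, to which the inductive step
applies. The first operator is the identity, of weight q⁰. -/
theorem isTableauSpanned [FiniteDimensional ℂ M] (h : IsHeckeFamily q K s)
    (hq : IsGenericParam q) : ∀ k ≤ K, IsTableauSpanned q s k := by
  intro k
  induction k with
  | zero =>
    intro _
    rw [IsTableauSpanned, eq_top_iff]
    refine le_iSup_of_le ⟨fun _ => (0, 0), ⟨?_, ?_, ?_⟩⟩ fun v _ m hm => ?_ <;> intros <;> omega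
  | succ k ih =>
    intro hk
    have S := ih (by omega)
    rcases k with _ | l
    · rw [IsTableauSpanned, eq_top_iff]
      refine le_iSup_of_le ⟨fun _ => (0, 0), ⟨?_, ?_, ?_⟩⟩ fun v _ m hm => ?_
      · intros; omega
      · intros; simp_all
      · intros; simp_all
      · obtain rfl : m = 0 := by omega
        simp [jmElem, boxWeight, boxContent]
    · rw [IsTableauSpanned, eq_top_iff, ← S]
      refine iSup_le fun t => ?_
      have hinv : ∀ v ∈ weightSpace s (l + 1) (boxWeight q t),
          jmElem s (l + 1) v ∈ weightSpace s (l + 1) (boxWeight q t) := by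
        intro v hv m hm
        rw [apply_commute (h.jm_comm (by omega) (by omega)), hv m hm, map_smul]
      have := Submodule.inf_iSup_genEigenspace hinv ⊤
      rw [Module.End.iSup_maxGenEigenspace_eq_top, inf_top_eq] at this
      rw [this]
      exact iSup_le fun b => weightSpace_inf_maxGen_le h hq (by omega) S t.2 b

/-- The joint eigenspaces of two standard tableaux of the same shape are exchanged by elements
that commute with everything that commutes with the Hecke algebra. -/
theorem exists_exchange (h : IsHeckeFamily q k s) (hq : IsGenericParam q) {t' : ℕ → ℕ × ℕ}
    (ht' : IsBoxSeq k t') (w : ℕ × ℕ → ℕ) (hw : ∀ j < k, w (t' j) = j) :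
    ∀ (N : ℕ) (t : ℕ → ℕ × ℕ) (_ : IsBoxSeq k t) (_ : ∀ j < k, ∃ i < k, t j = t' i)
      (_ : k * (k * k) ≤ N + ∑ j ∈ Finset.range k, j * w (t j)),
      ∃ g g' : Module.End ℂ M,
        (∀ x : Module.End ℂ M, (∀ i, i + 1 < k → Commute x (s i)) → Commute x g) ∧
        (∀ v ∈ weightSpace s k (boxWeight q t), g v ∈ weightSpace s k (boxWeight q t')) ∧
        (∀ v ∈ weightSpace s k (boxWeight q t'), g' v ∈ weightSpace s k (boxWeight q t)) ∧
        (∀ v ∈ weightSpace s k (boxWeight q t), g' (g v) = v) ∧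
        (∀ v ∈ weightSpace s k (boxWeight q t'), g (g' v) = v) := by
  have hwt : ∀ t : ℕ → ℕ × ℕ, (∀ j < k, ∃ i < k, t j = t' i) →
      ∀ j < k, w (t j) < k ∧ t' (w (t j)) = t j := by
    intro t hst j hj
    obtain ⟨i, hi, hji⟩ := hst j hj
    rw [hji, hw i hi]
    exact ⟨hi, rfl⟩
  intro N
  induction N with
  | zero =>
    intro t ht hst hN
    rcases Nat.eq_zero_or_pos k with rfl | hk
    · exact ⟨1, 1, fun x _ => Commute.one_right x, fun v hv m hm => absurd hm (by omega),
        fun v hv m hm => absurd hm (by omega), fun v _ => rfl, fun v _ => rfl⟩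
    -- All values `w (t j)` are below `k`, so the weighted sum is strictly less than k·k² and the
    -- budget of exchanges cannot be exhausted.
    exfalso
    have : ∑ j ∈ Finset.range k, j * w (t j) < ∑ j ∈ Finset.range k, k * k := by
      refine Finset.sum_lt_sum_of_nonempty ⟨0, by simpa using hk⟩ fun j hj => ?_
      have hj := Finset.mem_range.1 hj
      exact Nat.mul_lt_mul'' hj (hwt t hst j hj).1
    simp only [Finset.sum_const, Finset.card_range, smul_eq_mul] at this
    omega
  | succ N ih =>
    intro t ht hst hN
    -- `w` gives positions in `t'`. Without a descent, `w ∘ t` is a strictly increasing self-map of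
    -- {0, …, k - 1}, hence the identity, and `t` agrees with `t'`.
    by_cases hmono : ∀ i, i + 1 < k → w (t i) < w (t (i + 1))
    · have h1 : ∀ j < k, j ≤ w (t j) := by
        intro j
        induction j with
        | zero => intro _; omega
        | succ j ihj =>
          intro hj
          have := ihj (by omega)
          have := hmono j hj
          omega
      have h2 : ∀ d j, j + d + 1 = k → w (t j) ≤ j := by
        intro d
        induction d with
        | zero =>
          intro j hj
          have := (hwt t hst j (by omega)).1
          omega
        | succ d ihd =>
          intro j hj
          have := ihd (j + 1) (by omega)
          have := hmono j (by omega)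
          omega
      have he : ∀ j < k, t j = t' j := by
        intro j hj
        rw [← (hwt t hst j hj).2, le_antisymm (h2 (k - j - 1) j (by omega)) (h1 j hj)]
      have hW : weightSpace s k (boxWeight q t) = weightSpace s k (boxWeight q t') :=
        weightSpace_congr fun m hm => by rw [boxWeight, boxWeight, he m hm]
      rw [hW]
      exact ⟨1, 1, fun x _ => Commute.one_right x, fun v hv => hv, fun v hv => hv,
        fun v _ => rfl, fun v _ => rfl⟩
    · push Not at hmono
      obtain ⟨i, hi, hwi⟩ := hmono
      have hwi : w (t (i + 1)) < w (t i) := by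
        refine lt_of_le_of_ne hwi fun heq => ?_
        have := (hwt t hst i (by omega)).2
        rw [← heq, (hwt t hst (i + 1) hi).2] at this
        have := ht.inj _ hi _ (by omega) this
        omega
      -- In `t'` the box `t (i + 1)` precedes `t i`, whereas boxes weakly north-west come earlier.
      -- Hence `t i` is not north-west of `t (i + 1)` and the exchange is legal.
      have hlow : ¬ ((t i).1 ≤ (t (i + 1)).1 ∧ (t i).2 ≤ (t (i + 1)).2) := by
        rintro ⟨ha, hb⟩
        rw [← (hwt t hst (i + 1) hi).2] at ha hb
        obtain ⟨j, hj, hj'⟩ := ht'.lower (hwt t hst (i + 1) hi).1 ha hb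
        have := hw j (lt_of_le_of_lt hj (hwt t hst (i + 1) hi).1)
        rw [hj'] at this
        omega
      have hts : IsBoxSeq k (t ∘ Equiv.swap i (i + 1)) := by
        refine ht.swap hi (fun he => hlow ?_) (fun he => hlow ?_) <;> rw [he] <;> simp
      have hgap := ht.content_gap hi hts
      have hsk : ∀ j < k, Equiv.swap i (i + 1) j < k := by
        intro j hj
        rw [Equiv.swap_apply_def]
        split_ifs <;> omega
      -- Removing a descent raises the sum by w(t i) - w(t (i + 1)), so the measure strictly
      -- improves.
      have hsum : ∑ j ∈ Finset.range k, j * w (t j) + 1 ≤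
          ∑ j ∈ Finset.range k, j * w ((t ∘ Equiv.swap i (i + 1)) j) := by
        have hsub : ({i, i + 1} : Finset ℕ) ⊆ Finset.range k := by
          intro j hj
          simp only [Finset.mem_insert, Finset.mem_singleton] at hj
          rw [Finset.mem_range]
          omega
        rw [← Finset.sum_sdiff hsub, ← Finset.sum_sdiff hsub (f := fun j => j * w ((t ∘ _) j)),
          Finset.sum_pair (by omega), Finset.sum_pair (by omega)]
        have : ∀ j ∈ Finset.range k \ {i, i + 1}, j * w ((t ∘ Equiv.swap i (i + 1)) j) =
            j * w (t j) := by
          intro j hj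
          simp only [Finset.mem_sdiff, Finset.mem_insert, Finset.mem_singleton, not_or] at hj
          rw [Function.comp_apply, Equiv.swap_apply_of_ne_of_ne hj.2.1 hj.2.2]
        rw [Finset.sum_congr rfl this]
        simp only [Function.comp_apply, Equiv.swap_apply_left, Equiv.swap_apply_right]
        nlinarith
      obtain ⟨g, g', hg, hg1, hg2, hg3, hg4⟩ := ih _ hts
        (fun j hj => hst _ (hsk j hj)) (by omega)
      have hu : ∀ v ∈ weightSpace s k (boxWeight q t),
          intertwiner q s i v ∈ weightSpace s k (boxWeight q (t ∘ Equiv.swap i (i + 1))) :=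
        fun v hv => intertwiner_mem h le_rfl hv hi
      have hu' : ∀ v ∈ weightSpace s k (boxWeight q (t ∘ Equiv.swap i (i + 1))),
          intertwiner q s i v ∈ weightSpace s k (boxWeight q t) := by
        intro v hv
        have := intertwiner_mem h le_rfl hv hi
        rwa [show boxWeight q (t ∘ Equiv.swap i (i + 1)) ∘ Equiv.swap i (i + 1) = boxWeight q t by
          funext m; simp [boxWeight]] at this
      have hne := gap_factor_ne_zero hq (a := boxContent (t i)) (b := boxContent (t (i + 1)))
        (by omega) (by omega)
      have hne' := gap_factor_ne_zero hq (a := boxContent (t (i + 1))) (b := boxContent (t i))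
        (by omega) (by omega)
      set f := (q ^ 2 * q ^ (2 * boxContent (t i)) - q ^ (2 * boxContent (t (i + 1)))) *
        (q ^ (2 * boxContent (t (i + 1))) - (q ^ 2)⁻¹ * q ^ (2 * boxContent (t i))) with hf
      -- The scalar (q²a - b)(b - q⁻²a) is symmetric in a and b, so it serves in both directions.
      have hff : (q ^ 2 * q ^ (2 * boxContent (t (i + 1))) - q ^ (2 * boxContent (t i))) *
          (q ^ (2 * boxContent (t i)) - (q ^ 2)⁻¹ * q ^ (2 * boxContent (t (i + 1)))) = f := by
        have := hq.ne_zero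
        rw [hf]
        field_simp
      have hsq : ∀ v ∈ weightSpace s k (boxWeight q t),
          intertwiner q s i (intertwiner q s i v) = f • v := fun v hv =>
        intertwiner_sq_apply h hq.ne_zero hi (hv i (by omega)) (hv (i + 1) hi)
      have hsq' : ∀ v ∈ weightSpace s k (boxWeight q (t ∘ Equiv.swap i (i + 1))),
          intertwiner q s i (intertwiner q s i v) = f • v := by
        intro v hv
        have h1 := hv i (by omega)
        have h2 := hv (i + 1) hi
        simp only [boxWeight, Function.comp_apply, Equiv.swap_apply_left,
          Equiv.swap_apply_right] at h1 h2
        rw [intertwiner_sq_apply h hq.ne_zero hi h1 h2, hff]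
      refine ⟨g * intertwiner q s i, f⁻¹ • (intertwiner q s i * g'), fun x hx => ?_, fun v hv => ?_,
        fun v hv => ?_, fun v hv => ?_, fun v hv => ?_⟩
      · exact (hg x hx).mul_right (commute_intertwiner hx hi)
      · exact hg1 _ (hu v hv)
      · exact Submodule.smul_mem _ _ (hu' _ (hg2 v hv))
      · simp only [LinearMap.smul_apply, Module.End.mul_apply]
        rw [hg3 _ (hu v hv), hsq v hv, smul_smul, inv_mul_cancel₀ hne, one_smul]
      · simp only [LinearMap.smul_apply, Module.End.mul_apply, map_smul]
        rw [hsq' _ (hg2 v hv), map_smul, hg4 v hv, smul_smul, inv_mul_cancel₀ hne, one_smul]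

end Spectrum

/-! ### Chains of Hecke generators -/

section Chain

variable {E : Type*} [Ring E]

/-- `r_{s-1} ⋯ r_1 r_0`. -/
def downProd (r : ℕ → E) : ℕ → E
  | 0 => 1
  | s + 1 => r s * downProd r s

/-- `r_0 r_1 ⋯ r_{s-1}`. -/
def upProd (r : ℕ → E) : ℕ → E
  | 0 => 1
  | s + 1 => upProd r s * r s

/-- The sum `∑_{s < k} r_{s-1} ⋯ r_0 x r_0 ⋯ r_{s-1}`. -/
def chainSum (r : ℕ → E) (k : ℕ) (x : E) : E :=
  ∑ s ∈ Finset.range k, downProd r s * x * upProd r s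

variable {r : ℕ → E} {k s t i : ℕ}

theorem downProd_succ (r : ℕ → E) (s : ℕ) : downProd r (s + 1) = r s * downProd r s := rfl

theorem upProd_succ (r : ℕ → E) (s : ℕ) : upProd r (s + 1) = upProd r s * r s := rfl

theorem downProd_succ_eq (r : ℕ → E) (s : ℕ) :
    downProd r (s + 1) = downProd (fun i => r (i + 1)) s * r 0 := by
  induction s with
  | zero => simp [downProd]
  | succ s ih => rw [downProd, ih, downProd, mul_assoc]

theorem upProd_succ_eq (r : ℕ → E) (s : ℕ) :
    upProd r (s + 1) = r 0 * upProd (fun i => r (i + 1)) s := by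
  induction s with
  | zero => simp [upProd]
  | succ s ih => rw [upProd, ih, upProd, mul_assoc]

theorem commute_downProd {x : E} (h : ∀ i < s, Commute x (r i)) : Commute x (downProd r s) := by
  induction s with
  | zero => exact Commute.one_right _
  | succ s ih => exact (h s (by omega)).mul_right (ih fun i hi => h i (by omega))

theorem commute_upProd {x : E} (h : ∀ i < s, Commute x (r i)) : Commute x (upProd r s) := by
  induction s with
  | zero => exact Commute.one_right _
  | succ s ih => exact (ih fun i hi => h i (by omega)).mul_right (h s (by omega))

variable [Algebra ℂ E] {q : ℂ}

namespace IsHeckeFamily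

theorem commute_of_ne (h : IsHeckeFamily q k r) {i j : ℕ} (hi : i + 1 < k) (hj : j + 1 < k)
    (h1 : j ≠ i + 1) (h2 : i ≠ j + 1) : Commute (r i) (r j) := by
  rcases lt_trichotomy i j with h3 | rfl | h3
  · exact h.comm i j (by omega) hj
  · exact Commute.refl _
  · exact (h.comm j i (by omega) hi).symm

/-- A generator passes through the chain with its index lowered by one: the braid relation acts
where the indices meet, and the other factors commute with it. -/
theorem downProd_mul (h : IsHeckeFamily q k r) (hs : s < k) (hi : i + 1 < s) :
    downProd r s * r (i + 1) = r i * downProd r s := by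
  induction s with
  | zero => omega
  | succ s ih =>
    rcases Nat.lt_or_ge (i + 1) s with h1 | h1
    · rw [downProd, mul_assoc, ih (by omega) h1, ← mul_assoc, ← mul_assoc,
        (h.commute_of_ne (i := s) (j := i) (by omega) (by omega) (by omega) (by omega)).eq]
    · obtain rfl : s = i + 1 := by omega
      have hc : Commute (r (i + 1)) (downProd r i) := commute_downProd fun j hj =>
        h.commute_of_ne (by omega) (by omega) (by omega) (by omega)
      have hb := h.braid i (by omega)
      simp only [downProd, mul_assoc] at hb ⊢
      rw [← hc.eq, ← mul_assoc (r i), ← mul_assoc (r (i + 1)), ← hb]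
      simp only [mul_assoc]

theorem mul_upProd (h : IsHeckeFamily q k r) (hs : s < k) (hi : i + 1 < s) :
    r (i + 1) * upProd r s = upProd r s * r i := by
  induction s with
  | zero => omega
  | succ s ih =>
    rcases Nat.lt_or_ge (i + 1) s with h1 | h1
    · rw [upProd, ← mul_assoc, ih (by omega) h1, mul_assoc, mul_assoc,
        (h.commute_of_ne (i := s) (j := i) (by omega) (by omega) (by omega) (by omega)).eq]
    · obtain rfl : s = i + 1 := by omega
      have hc : Commute (r (i + 1)) (upProd r i) := commute_upProd fun j hj =>
        h.commute_of_ne (by omega) (by omega) (by omega) (by omega)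
      have hb := h.braid i (by omega)
      simp only [upProd, mul_assoc] at hb ⊢
      rw [← mul_assoc, hc.eq, hb]
      simp only [mul_assoc]

/-- The chain sum commutes with the Hecke algebra. -/
theorem commute_chainSum (h : IsHeckeFamily q k r) {x : E}
    (hx : ∀ i, i + 2 < k → Commute x (r (i + 1))) (hi : i + 1 < k) :
    Commute (r i) (chainSum r k x) := by
  obtain ⟨d, rfl⟩ : ∃ d, k = (i + 2) + d := ⟨k - (i + 2), by omega⟩
  rw [chainSum, Finset.sum_range_add, Finset.sum_range_succ, Finset.sum_range_succ,
    add_assoc (∑ s ∈ Finset.range i, _)]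
  -- Chains with `s < i` commute with `r i` termwise. The terms `s = i` and `s = i + 1` form e + r e
  -- r, which commutes with r by the quadratic relation. Through longer chains `r i` passes,
  -- becoming `r (i + 1)` in the middle, where it commutes with `x`.
  refine ((Commute.sum_right _ _ _ fun s hs => ?_).add_right ?_).add_right
    (Commute.sum_right _ _ _ fun s hs => ?_)
  · rw [Finset.mem_range] at hs
    have h1 : ∀ j < s, Commute (r i) (r j) := fun j hj =>
      h.commute_of_ne (by omega) (by omega) (by omega) (by omega)
    obtain ⟨i, rfl⟩ : ∃ i', i = i' + 1 := ⟨i - 1, by omega⟩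
    exact ((commute_downProd h1).mul_right (hx i (by omega)).symm).mul_right (commute_upProd h1)
  · have hq := h.quad i hi
    simp only [downProd, upProd]
    set e := downProd r i * x * upProd r i with he
    have h1 : r i * downProd r i * x * (upProd r i * r i) = r i * e * r i := by
      simp only [he, mul_assoc]
    rw [h1]
    have h2 : r i * (e + r i * e * r i) = r i * e + (r i * r i) * e * r i := by
      simp only [mul_add, mul_assoc]
    have h3 : (e + r i * e * r i) * r i = e * r i + r i * e * (r i * r i) := by
      simp only [add_mul, mul_assoc]
    rw [commute_iff_eq, h2, h3, hq]
    simp only [add_mul, mul_add, one_mul, mul_one, smul_mul_assoc, mul_smul_comm]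
    abel
  · rw [Finset.mem_range] at hs
    have e1 := h.downProd_mul (s := i + 2 + s) (i := i) (by omega) (by omega)
    have e2 := h.mul_upProd (s := i + 2 + s) (i := i) (by omega) (by omega)
    rw [commute_iff_eq, ← mul_assoc, ← mul_assoc, ← e1, mul_assoc _ _ x,
      ← (hx i (by omega)).eq, mul_assoc _ _ (r i), ← e2]
    simp only [mul_assoc]

/-- A normal form with a single `r 0`. The shifted chains around it act away from the first tensor
factor, so they can be pulled out of a contraction in that factor. -/
theorem upProd_mul_downProd_of_le (h : IsHeckeFamily q k r) (ht : t + 1 < k) (hs : s ≤ t) :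
    upProd r s * downProd r (t + 1) =
      downProd (fun i => r (i + 1)) t * r 0 * upProd (fun i => r (i + 1)) s := by
  rw [← downProd_succ_eq]
  induction s with
  | zero => simp [upProd]
  | succ s ih =>
    rw [upProd, mul_assoc, ← h.downProd_mul ht (by omega), ← mul_assoc, ih (by omega), upProd,
      mul_assoc]

theorem upProd_mul_downProd_of_ge (h : IsHeckeFamily q k r) (ht : t + 1 < k) (hs : s ≤ t) :
    upProd r (t + 1) * downProd r s =
      downProd (fun i => r (i + 1)) s * r 0 * upProd (fun i => r (i + 1)) t := by
  rw [mul_assoc, ← upProd_succ_eq]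
  induction s with
  | zero => simp [downProd]
  | succ s ih =>
    rw [downProd, ← mul_assoc, ← h.mul_upProd ht (by omega), mul_assoc, ih (by omega), downProd,
      mul_assoc]

theorem downProd_mul_shift (h : IsHeckeFamily q k r) (ht : t + 1 < k) (hs : s ≤ t) :
    downProd r s * downProd (fun i => r (i + 1)) t * r 0 =
      downProd r (t + 1) * downProd (fun i => r (i + 1)) s := by
  rw [mul_assoc, ← downProd_succ_eq]
  induction s with
  | zero => simp [downProd]
  | succ s ih =>
    rw [downProd_succ r s, mul_assoc, ih (by omega), ← mul_assoc, ← h.downProd_mul ht (by omega),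
      downProd_succ (fun i => r (i + 1)), mul_assoc]

theorem shift_mul_upProd (h : IsHeckeFamily q k r) (ht : t + 1 < k) (hs : s ≤ t) :
    r 0 * upProd (fun i => r (i + 1)) t * upProd r s =
      upProd (fun i => r (i + 1)) s * upProd r (t + 1) := by
  rw [← upProd_succ_eq]
  induction s with
  | zero => simp [upProd]
  | succ s ih =>
    rw [upProd_succ r s, ← mul_assoc, ih (by omega), mul_assoc, ← h.mul_upProd ht (by omega),
      upProd_succ (fun i => r (i + 1)), mul_assoc]

/-- The square in the middle of the palindrome is resolved by the quadratic relation. Its constant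
term shortens the palindrome, and its linear term has the normal form of
`upProd_mul_downProd_of_le`. -/
theorem upProd_mul_downProd (h : IsHeckeFamily q k r) (ht : t < k) :
    upProd r t * downProd r t = 1 + (q - q⁻¹) • ∑ j ∈ Finset.range t,
      downProd (fun i => r (i + 1)) j * r 0 * upProd (fun i => r (i + 1)) j := by
  induction t with
  | zero => simp [upProd, downProd]
  | succ t ih =>
    have h1 : upProd r (t + 1) * downProd r (t + 1) =
        upProd r t * (r t * r t) * downProd r t := by simp only [upProd, downProd, mul_assoc]
    rw [h1, h.quad t ht, mul_add, add_mul, mul_one, ih (by omega), mul_smul_comm, smul_mul_assoc,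
      Finset.sum_range_succ, smul_add, ← add_assoc, ← h.upProd_mul_downProd_of_le ht le_rfl,
      downProd, mul_assoc]

/-- The quadratic relation for chain sums follows from the one for a single factor (`hψ`) and for
two factors (`hη`, `hΩ`). Here `Φ` stands for the contraction of a quadratic expression. -/
theorem sum_chain_mul_chain (h : IsHeckeFamily q⁻¹ k r) (Φ : E →ₗ[ℂ] E) (β ψ : E)
    (hβ : ∀ i, i + 2 < k → Commute β (r (i + 1))) (hψ : Φ β = ψ)
    (hΦl : ∀ i, i + 2 < k → ∀ x, Φ (r (i + 1) * x) = r (i + 1) * Φ x)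
    (hΦr : ∀ i, i + 2 < k → ∀ x, Φ (x * r (i + 1)) = Φ x * r (i + 1))
    (hΩ : 1 < k → r 0 * (β * Φ (r 0 * β)) + (β * Φ (r 0 * β)) * r 0 =
      -((q - q⁻¹) • (β * Φ (r 0 * β)))) :
    ∑ s ∈ Finset.range k, ∑ t ∈ Finset.range k,
        downProd r s * β * Φ (upProd r s * downProd r t * β) * upProd r t =
      ∑ s ∈ Finset.range k, downProd r s * β * ψ * upProd r s := by
  set a := downProd fun i => r (i + 1) with ha
  set a' := upProd fun i => r (i + 1) with ha'
  set P : ℕ → ℕ → E := fun s t =>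
    downProd r s * β * Φ (upProd r s * downProd r t * β) * upProd r t with hP
  have hΦa : ∀ m, m + 1 < k → ∀ x, Φ (a m * x) = a m * Φ x := by
    intro m
    induction m with
    | zero => intro _ x; simp [ha, downProd]
    | succ m ih =>
      intro hm x
      have : a (m + 1) = r (m + 1) * a m := rfl
      rw [this, mul_assoc, hΦl m hm, ih (by omega), mul_assoc]
  have hΦa' : ∀ m, m + 1 < k → ∀ x, Φ (x * a' m) = Φ x * a' m := by
    intro m
    induction m with
    | zero => intro _ x; simp [ha', upProd]
    | succ m ih =>
      intro hm x
      have : a' (m + 1) = a' m * r (m + 1) := rfl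
      rw [this, ← mul_assoc, hΦr m hm, ih (by omega), mul_assoc]
  have hβa : ∀ m, m + 1 < k → Commute β (a m) := fun m hm =>
    commute_downProd fun i hi => hβ i (by omega)
  have hβa' : ∀ m, m + 1 < k → Commute β (a' m) := fun m hm =>
    commute_upProd fun i hi => hβ i (by omega)
  have hΦ3 : ∀ m m', m + 1 < k → m' + 1 < k →
      Φ (a m * r 0 * a' m' * β) = a m * Φ (r 0 * β) * a' m' := by
    intro m m' hm hm'
    rw [mul_assoc _ (a' m'), ← (hβa' m' hm').eq, mul_assoc (a m), hΦa m hm, ← mul_assoc (r 0),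
      hΦa' m' hm', mul_assoc]
  -- Since the family has parameter q⁻¹, the inverse of `r 0` is `r 0 + (q - q⁻¹)`.
  have hinv : 1 < k → r 0 * (r 0 + (q - q⁻¹) • 1) = 1 ∧ (r 0 + (q - q⁻¹) • 1) * r 0 = 1 := by
    intro hk
    have := h.quad 0 hk
    constructor
    · rw [mul_add, this, mul_smul_comm, mul_one, inv_inv]
      module
    · rw [add_mul, this, smul_mul_assoc, one_mul, inv_inv]
      module
  -- Transposed off-diagonal terms combine into r₀⁻¹Ω + Ωr₀⁻¹ between the same outer chains. By `hΩ`
  -- this equals (q - q⁻¹)Ω.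
  have hpair : ∀ t s, t + 1 < k → s ≤ t → P s (t + 1) + P (t + 1) s = (q - q⁻¹) •
      (downProd r (t + 1) * a s * (β * Φ (r 0 * β)) * a' s * upProd r (t + 1)) := by
    intro t s ht hs
    obtain ⟨hi1, hi2⟩ := hinv (by omega)
    set Ω := β * Φ (r 0 * β) with hΩdef
    have e1 : downProd r s * a t =
        downProd r (t + 1) * a s * (r 0 + (q - q⁻¹) • 1) := by
      rw [← h.downProd_mul_shift ht hs, mul_assoc _ (r 0), hi1, mul_one]
    have e2 : a' t * upProd r s =
        (r 0 + (q - q⁻¹) • 1) * (a' s * upProd r (t + 1)) := by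
      rw [← h.shift_mul_upProd ht hs, mul_assoc (r 0), ← mul_assoc, hi2, one_mul]
    have p1 : P s (t + 1) = downProd r (t + 1) * a s *
        ((r 0 + (q - q⁻¹) • 1) * Ω) * a' s * upProd r (t + 1) := by
      simp only [hP]
      rw [h.upProd_mul_downProd_of_le ht hs, hΦ3 t s ht (by omega)]
      calc _ = downProd r s * (β * a t) * Φ (r 0 * β) * a' s * upProd r (t + 1) := by
            simp only [mul_assoc]
        _ = (downProd r s * a t) * Ω * a' s * upProd r (t + 1) := by
            rw [(hβa t ht).eq, hΩdef]; simp only [mul_assoc]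
        _ = _ := by rw [e1]; simp only [mul_assoc]
    have p2 : P (t + 1) s = downProd r (t + 1) * a s *
        (Ω * (r 0 + (q - q⁻¹) • 1)) * a' s * upProd r (t + 1) := by
      simp only [hP]
      rw [h.upProd_mul_downProd_of_ge ht hs, hΦ3 s t (by omega) ht]
      calc _ = downProd r (t + 1) * (β * a s) * Φ (r 0 * β) * (a' t * upProd r s) := by
            simp only [mul_assoc]
        _ = downProd r (t + 1) * a s * Ω * (a' t * upProd r s) := by
            rw [(hβa s (by omega)).eq, hΩdef]; simp only [mul_assoc]
        _ = _ := by rw [e2]; simp only [mul_assoc]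
    have e3 : (r 0 + (q - q⁻¹) • 1) * Ω + Ω * (r 0 + (q - q⁻¹) • 1) = (q - q⁻¹) • Ω := by
      have := hΩ (by omega)
      rw [add_mul, mul_add, smul_mul_assoc, one_mul, mul_smul_comm, mul_one,
        eq_sub_of_add_eq this]
      module
    rw [p1, p2, ← add_mul, ← add_mul, ← mul_add, e3]
    simp only [mul_smul_comm, smul_mul_assoc]
  -- The quadratic relation inside the diagonal term produces the same expressions with the opposite
  -- sign.
  have hdiag : ∀ t < k, P t t = downProd r t * β * ψ * upProd r t - (q - q⁻¹) •
      ∑ s ∈ Finset.range t,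
        (downProd r t * a s * (β * Φ (r 0 * β)) * a' s * upProd r t) := by
    intro t ht
    have e1 : Φ (upProd r t * downProd r t * β) = ψ - (q - q⁻¹) • ∑ j ∈ Finset.range t,
        a j * Φ (r 0 * β) * a' j := by
      rw [h.upProd_mul_downProd ht, add_mul, one_mul, map_add, hψ, smul_mul_assoc, map_smul,
        Finset.sum_mul, map_sum, inv_inv, ← neg_sub q, neg_smul, ← sub_eq_add_neg]
      congr 2
      refine Finset.sum_congr rfl fun j hj => ?_
      rw [Finset.mem_range] at hj
      exact hΦ3 j j (by omega) (by omega)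
    simp only [hP]
    rw [e1, mul_sub, sub_mul, mul_smul_comm, smul_mul_assoc, Finset.mul_sum, Finset.sum_mul]
    congr 2
    refine Finset.sum_congr rfl fun j hj => ?_
    rw [Finset.mem_range] at hj
    calc _ = downProd r t * (β * a j) * Φ (r 0 * β) * a' j * upProd r t := by
          simp only [mul_assoc]
      _ = _ := by rw [(hβa j (by omega)).eq]; simp only [mul_assoc]
  -- Enlarging the square by row and column `m` adds the off-diagonal pairs, which cancel the
  -- correction of the diagonal term.
  have main : ∀ m ≤ k, ∑ s ∈ Finset.range m, ∑ t ∈ Finset.range m, P s t =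
      ∑ s ∈ Finset.range m, downProd r s * β * ψ * upProd r s := by
    intro m
    induction m with
    | zero => intro _; simp
    | succ m ih =>
      intro hm
      simp only [Finset.sum_range_succ, Finset.sum_add_distrib]
      rw [ih (by omega), hdiag m hm]
      have : ∑ s ∈ Finset.range m, P s m + ∑ s ∈ Finset.range m, P m s = (q - q⁻¹) •
          ∑ s ∈ Finset.range m,
            (downProd r m * a s * (β * Φ (r 0 * β)) * a' s * upProd r m) := by
        rw [← Finset.sum_add_distrib, Finset.smul_sum]
        refine Finset.sum_congr rfl fun s hs => ?_
        rw [Finset.mem_range] at hs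
        obtain ⟨m, rfl⟩ : ∃ m', m = m' + 1 := ⟨m - 1, by omega⟩
        exact hpair m s (by omega) (by omega)
      rw [eq_sub_of_add_eq this]
      abel
  exact main k le_rfl

end IsHeckeFamily

end Chain

/-! ### Identities for the matrix `B` -/

section Tensor

variable {ι : Type*} [Fintype ι] [DecidableEq ι] {R Ψ : ι → ι → ι → ι → ℂ} {B : ι → ι → ℂ}

/-- The identity Tr_1(B_1 R_12) = I: `B` is a partial trace of Ψ, and the trace is taken of the
defining relation between Ψ and `R`. -/
theorem sum_trace_mul (hB : ∀ i j, B i j = ∑ p, Ψ p i p j)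
    (hΨ : ∀ i j k s, ∑ a, ∑ b, Ψ i a j b * R b k a s = if i = s ∧ k = j then 1 else 0) (j z : ι) :
    ∑ l, ∑ i, B l i * R i j l z = if j = z then 1 else 0 := by
  have h1 : ∑ l, ∑ i, B l i * R i j l z = ∑ p, ∑ l, ∑ i, Ψ p l p i * R i j l z := by
    conv_rhs => rw [Finset.sum_comm]
    refine Finset.sum_congr rfl fun l _ => ?_
    conv_rhs => rw [Finset.sum_comm]
    exact Finset.sum_congr rfl fun i _ => by rw [hB, Finset.sum_mul]
  rw [h1, Finset.sum_congr rfl fun p _ => hΨ p p j z]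
  by_cases hjz : j = z
  · subst hjz
    rw [Finset.sum_eq_single j] <;> simp_all [eq_comm]
  · rw [if_neg hjz]
    refine Finset.sum_eq_zero fun p _ => if_neg ?_
    rintro ⟨rfl, rfl⟩
    exact hjz rfl

/-- The partial trace `Tr_1 (B_1 A_{13} C_{12}) = P B`, in components. -/
theorem sum_trace_mul_mul (hB : ∀ i j, B i j = ∑ p, Ψ p i p j)
    (hΨl : ∀ i j k s, ∑ a, ∑ b, Ψ i a j b * R b k a s = if i = s ∧ k = j then 1 else 0)
    (hΨr : ∀ i j k s, ∑ a, ∑ b, R i a j b * Ψ b k a s = if i = s ∧ k = j then 1 else 0)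
    {A C : ι → ι → ι → ι → ℂ}
    (hCA : ∀ j k m p, ∑ x, ∑ y, C j k x y * A x y m p = if j = m ∧ k = p then 1 else 0)
    (hYB : ∀ i j k l m p, ∑ x, ∑ y, ∑ z, C j k x y * R i x l z * A z y m p =
      ∑ x, ∑ y, ∑ z, A i j x y * R y k z p * C x z l m) (j u v m : ι) :
    ∑ l, ∑ i, ∑ x, B l i * A i j x v * C x u l m = if j = m then B u v else 0 := by
  -- Contract the Yang-Baxter relation with `B`. On the other side the trace of B R is the identity,
  -- which leaves the product of `C` and `A`, again the identity.
  have h1 : ∀ k p, ∑ l, ∑ i, ∑ x, ∑ y, ∑ z, B l i * (A i j x y * R y k z p * C x z l m) =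
      if j = m ∧ k = p then 1 else 0 := by
    intro k p
    simp only [← Finset.mul_sum]
    simp only [← hYB]
    have h2 := Finset.sum_comm (s := Finset.univ) (t := Finset.univ)
      (f := fun (li : ι × ι) (xyz : ι × ι × ι) => B li.1 li.2 *
        (C j k xyz.1 xyz.2.1 * R li.2 xyz.1 li.1 xyz.2.2 * A xyz.2.2 xyz.2.1 m p))
    simp only [Fintype.sum_prod_type, ← Finset.mul_sum] at h2
    rw [h2, ← hCA]
    refine Finset.sum_congr rfl fun x _ => Finset.sum_congr rfl fun y _ => ?_
    calc _ = ∑ z, C j k x y * A z y m p * (∑ l, ∑ i, B l i * R i x l z) := by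
          refine Finset.sum_congr rfl fun z _ => ?_
          simp only [Finset.mul_sum]
          exact Finset.sum_congr rfl fun l _ => Finset.sum_congr rfl fun i _ => by ring
      _ = _ := by
          simp only [sum_trace_mul hB hΨl, mul_ite, mul_one, mul_zero, Finset.sum_ite_eq,
            Finset.mem_univ, if_true]
  -- Contracting the free indices `k`, `p` with Ψ removes the middle `R` on one side and turns the
  -- deltas into `B` on the other.
  have h3 := Finset.sum_comm (s := Finset.univ) (t := Finset.univ)
    (f := fun (w : ι × ι × ι × ι × ι) (kp : ι × ι) =>
      B w.1 w.2.1 * (A w.2.1 j w.2.2.1 w.2.2.2.1 * R w.2.2.2.1 kp.1 w.2.2.2.2 kp.2 *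
        C w.2.2.1 w.2.2.2.2 w.1 m) * Ψ kp.2 u kp.1 v)
  simp only [Fintype.sum_prod_type] at h3
  calc _ = ∑ l, ∑ i, ∑ x, ∑ y, ∑ z, ∑ k, ∑ p,
        B l i * (A i j x y * R y k z p * C x z l m) * Ψ p u k v := by
        refine Finset.sum_congr rfl fun l _ => Finset.sum_congr rfl fun i _ =>
          Finset.sum_congr rfl fun x _ => ?_
        have h4 : ∀ y z, ∑ k, ∑ p, B l i * (A i j x y * R y k z p * C x z l m) * Ψ p u k v =
            B l i * A i j x y * C x z l m * if y = v ∧ u = z then 1 else 0 := by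
          intro y z
          rw [← hΨr y z u v]
          simp only [Finset.mul_sum]
          exact Finset.sum_congr rfl fun k _ => Finset.sum_congr rfl fun p _ => by ring
        simp only [h4]
        rw [Finset.sum_eq_single v, Finset.sum_eq_single u]
        · simp
        · intro z _ hz
          simp [hz.symm]
        · simp
        · intro y _ hy
          simp [hy]
        · simp
    _ = ∑ k, ∑ p, (∑ l, ∑ i, ∑ x, ∑ y, ∑ z,
        B l i * (A i j x y * R y k z p * C x z l m)) * Ψ p u k v := by
        rw [h3]
        simp only [Finset.sum_mul]
    _ = _ := by
        simp only [h1]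
        by_cases hjm : j = m
        · simp [hjm, hB]
        · simp [hjm]

/-- `R⁻¹` commutes with `B ⊗ B`, in components. -/
theorem sum_mul_B_mul_B (hB : ∀ i j, B i j = ∑ p, Ψ p i p j)
    (hΨl : ∀ i j k s, ∑ a, ∑ b, Ψ i a j b * R b k a s = if i = s ∧ k = j then 1 else 0)
    (hΨr : ∀ i j k s, ∑ a, ∑ b, R i a j b * Ψ b k a s = if i = s ∧ k = j then 1 else 0)
    {r : ι → ι → ι → ι → ℂ}
    (hrR : ∀ j k m p, ∑ x, ∑ y, r j k x y * R x y m p = if j = m ∧ k = p then 1 else 0)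
    (hRr : ∀ j k m p, ∑ x, ∑ y, R j k x y * r x y m p = if j = m ∧ k = p then 1 else 0)
    (hYB : ∀ i j k l m p, ∑ x, ∑ y, ∑ z, r j k x y * R i x l z * R z y m p =
      ∑ x, ∑ y, ∑ z, R i j x y * R y k z p * r x z l m)
    (hYB' : ∀ i j k l m p, ∑ x, ∑ y, ∑ z, R j k x y * R i x l z * r z y m p =
      ∑ x, ∑ y, ∑ z, r i j x y * R y k z p * R x z l m) (k u s w : ι) :
    ∑ l, ∑ m, r k u l m * (B l s * B m w) = ∑ x, ∑ y, B k x * B u y * r x y s w := by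
  -- A further contraction with Ψ strips the remaining `R` from the partial trace formula and
  -- expresses B r through Ψ; `hb` does so for the other order of the two factors.
  have ha : ∀ k u s m, ∑ l, B l s * r k u l m = ∑ v, B u v * Ψ v k m s := by
    intro k u s m
    have h3 := Finset.sum_comm (s := Finset.univ) (t := Finset.univ)
      (f := fun (w : ι × ι × ι) (jv : ι × ι) =>
        B w.1 w.2.1 * R w.2.1 jv.1 w.2.2 jv.2 * r w.2.2 u w.1 m * Ψ jv.2 k jv.1 s)
    simp only [Fintype.sum_prod_type, ← Finset.sum_mul] at h3
    simp only [sum_trace_mul_mul hB hΨl hΨr hrR hYB] at h3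
    have h4 : ∀ l i x, ∑ j, ∑ v, B l i * R i j x v * r x u l m * Ψ v k j s =
        B l i * r x u l m * if i = s ∧ k = x then 1 else 0 := by
      intro l i x
      rw [← hΨr i x k s]
      simp only [Finset.mul_sum]
      exact Finset.sum_congr rfl fun _ _ => Finset.sum_congr rfl fun _ _ => by ring
    simp only [h4] at h3
    refine Eq.trans ?_ (h3.trans (by simp))
    refine Finset.sum_congr rfl fun l _ => ?_
    rw [Finset.sum_eq_single s, Finset.sum_eq_single k]
    · simp only [and_self, if_true, mul_one]
    · intro z _ hz
      simp [hz.symm]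
    · simp
    · intro y _ hy
      simp [hy]
    · simp
  have hb : ∀ k j s v, ∑ i, B k i * r i j s v = ∑ u, B u v * Ψ j k u s := by
    intro k j s v
    have h3 := Finset.sum_comm (s := Finset.univ) (t := Finset.univ)
      (f := fun (w : ι × ι × ι) (jv : ι × ι) =>
        B w.1 w.2.1 * r w.2.1 j w.2.2 v * R w.2.2 jv.1 w.1 jv.2 * Ψ jv.2 k jv.1 s)
    simp only [Fintype.sum_prod_type, ← Finset.sum_mul] at h3
    simp only [sum_trace_mul_mul hB hΨl hΨr hRr hYB'] at h3
    have h4 : ∀ l i x, ∑ u, ∑ m, B l i * r i j x v * R x u l m * Ψ m k u s =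
        B l i * r i j x v * if x = s ∧ k = l then 1 else 0 := by
      intro l i x
      rw [← hΨr x l k s]
      simp only [Finset.mul_sum]
      exact Finset.sum_congr rfl fun _ _ => Finset.sum_congr rfl fun _ _ => by ring
    simp only [h4] at h3
    refine Eq.trans ?_ (h3.trans (by simp))
    symm
    rw [Finset.sum_eq_single k]
    · refine Finset.sum_congr rfl fun i _ => ?_
      rw [Finset.sum_eq_single s]
      · simp only [and_self, if_true, mul_one]
      · intro y _ hy
        simp [hy]
      · simp
    · intro z _ hz
      simp [hz.symm]
    · simp
  -- Both sides equal the same double contraction of Ψ with two copies of `B`.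
  calc _ = ∑ m, (∑ l, B l s * r k u l m) * B m w := by
        rw [Finset.sum_comm]
        simp only [Finset.sum_mul]
        exact Finset.sum_congr rfl fun _ _ => Finset.sum_congr rfl fun _ _ => by ring
    _ = ∑ v, B u v * ∑ m, B m w * Ψ v k m s := by
        simp only [ha, Finset.sum_mul, Finset.mul_sum]
        rw [Finset.sum_comm]
        exact Finset.sum_congr rfl fun _ _ => Finset.sum_congr rfl fun _ _ => by ring
    _ = _ := by
        simp only [← hb, Finset.mul_sum]
        rw [Finset.sum_comm]
        exact Finset.sum_congr rfl fun _ _ => Finset.sum_congr rfl fun _ _ => by ring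

end Tensor

/-! ### Tensor components -/

theorem sum_fin_two_arrow {n : ℕ} {A : Type*} [AddCommMonoid A] (f : (Fin 2 → Fin n) → A) :
    ∑ x, f x = ∑ i, ∑ j, f ![i, j] := by
  rw [← (finTwoArrowEquiv (Fin n)).symm.sum_comp, Fintype.sum_prod_type]
  rfl

theorem sum_fin_three_arrow {n : ℕ} {A : Type*} [AddCommMonoid A] (f : (Fin 3 → Fin n) → A) :
    ∑ x, f x = ∑ i, ∑ j, ∑ k, f ![i, j, k] := by
  rw [← (Fin.consEquiv fun _ : Fin 3 => Fin n).sum_comp, Fintype.sum_prod_type]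
  refine Finset.sum_congr rfl fun i _ => ?_
  rw [sum_fin_two_arrow]
  rfl

theorem eq_vec_two {n : ℕ} (a : Fin 2 → Fin n) : a = ![a 0, a 1] := by
  funext i
  fin_cases i <;> rfl

section Site

variable {n : ℕ} (A B C : TMat n 2 ℂ)

theorem siteR_zero_apply (i j k l m p : Fin n) :
    siteR A 3 0 ![i, j, k] ![l, m, p] = if k = p then A ![i, j] ![l, m] else 0 := by
  rw [siteR, dif_pos (by norm_num), amp]
  have e : (∀ x : Fin 3, (∀ y, (![⟨0, by omega⟩, ⟨0 + 1, by omega⟩] : Fin 2 → Fin 3) y ≠ x) →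
      (![i, j, k] : Fin 3 → Fin n) x = (![l, m, p] : Fin 3 → Fin n) x) ↔ k = p := by
    simp [Fin.forall_fin_succ]
  simp only [e]
  congr 2 <;> · funext x; fin_cases x <;> rfl

theorem siteR_one_apply (i j k l m p : Fin n) :
    siteR A 3 1 ![i, j, k] ![l, m, p] = if i = l then A ![j, k] ![m, p] else 0 := by
  rw [siteR, dif_pos (by norm_num), amp]
  have e : (∀ x : Fin 3, (∀ y, (![⟨1, by omega⟩, ⟨1 + 1, by omega⟩] : Fin 2 → Fin 3) y ≠ x) →
      (![i, j, k] : Fin 3 → Fin n) x = (![l, m, p] : Fin 3 → Fin n) x) ↔ i = l := by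
    simp [Fin.forall_fin_succ]
  simp only [e]
  congr 2 <;> · funext x; fin_cases x <;> rfl

theorem siteR_one_zero_one_apply (i j k l m p : Fin n) :
    (siteR A 3 1 * siteR B 3 0 * siteR C 3 1) ![i, j, k] ![l, m, p] =
      ∑ x, ∑ y, ∑ z, A ![j, k] ![x, y] * B ![i, x] ![l, z] * C ![z, y] ![m, p] := by
  simp only [Matrix.mul_apply, sum_fin_three_arrow, siteR_zero_apply, siteR_one_apply, ite_mul,
    mul_ite, zero_mul, mul_zero, Finset.sum_ite_eq, Finset.sum_ite_eq', Finset.mem_univ, if_true,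
    Finset.sum_ite_irrel, Finset.sum_const_zero, Finset.sum_mul]
  rw [Finset.sum_comm_cycle]
  refine Finset.sum_congr rfl fun x _ => ?_
  rw [Finset.sum_comm]

theorem siteR_zero_one_zero_apply (i j k l m p : Fin n) :
    (siteR A 3 0 * siteR B 3 1 * siteR C 3 0) ![i, j, k] ![l, m, p] =
      ∑ x, ∑ y, ∑ z, A ![i, j] ![x, y] * B ![y, k] ![z, p] * C ![x, z] ![l, m] := by
  simp only [Matrix.mul_apply, sum_fin_three_arrow, siteR_zero_apply, siteR_one_apply, ite_mul,
    mul_ite, zero_mul, mul_zero, Finset.sum_ite_eq, Finset.sum_ite_eq', Finset.mem_univ, if_true,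
    Finset.sum_ite_irrel, Finset.sum_const_zero, Finset.sum_mul]
  refine Finset.sum_congr rfl fun x _ => ?_
  rw [Finset.sum_comm]

end Site

theorem siteR_mul_siteR {n k : ℕ} (A B : TMat n 2 ℂ) (i : ℕ) (h : i + 1 < k) :
    siteR A k i * siteR B k i = siteR (A * B) k i := by
  rw [siteR, siteR, siteR, dif_pos h, dif_pos h, dif_pos h, amp_mul]
  intro x y hxy
  fin_cases x <;> fin_cases y <;> simp_all

theorem siteR_one {n k : ℕ} (i : ℕ) : siteR (1 : TMat n 2 ℂ) k i = 1 := by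
  rw [siteR]
  split_ifs
  · exact amp_one _
  · rfl

/-! ### Consequences of the Hecke and Yang-Baxter relations for R -/

section RMatrix

variable {n : ℕ} {q : ℂ} {R Ψ : TMat n 2 ℂ}

namespace IsHeckeRMatrix

theorem mul_self (hR : IsHeckeRMatrix q R) (hq : q ≠ 0) : R * R = 1 + (q - q⁻¹) • R := by
  have := hR.hecke
  rw [sub_mul, mul_add, mul_add, mul_smul_comm, smul_mul_assoc, smul_mul_assoc, mul_one, one_mul,
    one_mul, smul_smul, mul_inv_cancel₀ hq, one_smul] at this
  rw [← sub_eq_zero, ← this]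
  module

theorem mul_inv (hR : IsHeckeRMatrix q R) (hq : q ≠ 0) : R * R⁻¹ = 1 ∧ R⁻¹ * R = 1 ∧
    R⁻¹ = R - (q - q⁻¹) • 1 := by
  have h1 : R * (R - (q - q⁻¹) • 1) = 1 := by
    rw [mul_sub, hR.mul_self hq, mul_smul_comm, mul_one, add_sub_cancel_right]
  have h2 := Matrix.inv_eq_right_inv h1
  refine ⟨by rw [h2, h1], ?_, h2⟩
  rw [h2, mul_eq_one_comm, h1]

theorem sum_mul_inv (hR : IsHeckeRMatrix q R) (hq : q ≠ 0) (j k m p : Fin n) :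
    ∑ x, ∑ y, R ![j, k] ![x, y] * R⁻¹ ![x, y] ![m, p] = if j = m ∧ k = p then 1 else 0 := by
  rw [← sum_fin_two_arrow (fun x => R ![j, k] x * R⁻¹ x ![m, p]), ← Matrix.mul_apply,
    (hR.mul_inv hq).1, Matrix.one_apply]
  simp

theorem sum_inv_mul (hR : IsHeckeRMatrix q R) (hq : q ≠ 0) (j k m p : Fin n) :
    ∑ x, ∑ y, R⁻¹ ![j, k] ![x, y] * R ![x, y] ![m, p] = if j = m ∧ k = p then 1 else 0 := by
  rw [← sum_fin_two_arrow (fun x => R⁻¹ ![j, k] x * R x ![m, p]), ← Matrix.mul_apply,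
    (hR.mul_inv hq).2.1, Matrix.one_apply]
  simp

/-- The Yang-Baxter equation with one outer factor moved across on each side. This is the form in
which the partial trace argument produces the product R⁻¹R. -/
theorem sum_yangBaxter (hR : IsHeckeRMatrix q R) (hq : q ≠ 0) (i j k l m p : Fin n) :
    ∑ x, ∑ y, ∑ z, R⁻¹ ![j, k] ![x, y] * R ![i, x] ![l, z] * R ![z, y] ![m, p] =
      ∑ x, ∑ y, ∑ z, R ![i, j] ![x, y] * R ![y, k] ![z, p] * R⁻¹ ![x, z] ![l, m] := by
  obtain ⟨h1, h2, -⟩ := hR.mul_inv hq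
  have e1 : siteR R 3 0 * siteR R⁻¹ 3 0 = 1 := by
    rw [siteR_mul_siteR _ _ _ (by omega), h1, siteR_one]
  have e2 : siteR R⁻¹ 3 1 * siteR R 3 1 = 1 := by
    rw [siteR_mul_siteR _ _ _ (by omega), h2, siteR_one]
  have key : siteR R⁻¹ 3 1 * siteR R 3 0 * siteR R 3 1 =
      siteR R 3 0 * siteR R 3 1 * siteR R⁻¹ 3 0 := by
    have := congrArg (fun z => siteR R⁻¹ 3 1 * z * siteR R⁻¹ 3 0) hR.yangBaxter
    simp only [mul_assoc, e1, mul_one] at this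
    rw [mul_assoc, this, ← mul_assoc, e2, one_mul]
    simp only [mul_assoc]
  rw [← siteR_one_zero_one_apply, ← siteR_zero_one_zero_apply, key]

theorem sum_yangBaxter' (hR : IsHeckeRMatrix q R) (hq : q ≠ 0) (i j k l m p : Fin n) :
    ∑ x, ∑ y, ∑ z, R ![j, k] ![x, y] * R ![i, x] ![l, z] * R⁻¹ ![z, y] ![m, p] =
      ∑ x, ∑ y, ∑ z, R⁻¹ ![i, j] ![x, y] * R ![y, k] ![z, p] * R ![x, z] ![l, m] := by
  obtain ⟨h1, h2, -⟩ := hR.mul_inv hq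
  have e1 : siteR R 3 1 * siteR R⁻¹ 3 1 = 1 := by
    rw [siteR_mul_siteR _ _ _ (by omega), h1, siteR_one]
  have e2 : siteR R⁻¹ 3 0 * siteR R 3 0 = 1 := by
    rw [siteR_mul_siteR _ _ _ (by omega), h2, siteR_one]
  have key : siteR R⁻¹ 3 0 * siteR R 3 1 * siteR R 3 0 =
      siteR R 3 1 * siteR R 3 0 * siteR R⁻¹ 3 1 := by
    have := congrArg (fun z => siteR R⁻¹ 3 0 * z * siteR R⁻¹ 3 1) hR.yangBaxter
    simp only [mul_assoc, e1, mul_one] at this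
    rw [mul_assoc, ← this, ← mul_assoc, e2, one_mul]
    simp only [mul_assoc]
  rw [← siteR_one_zero_one_apply, ← siteR_zero_one_zero_apply, key]

theorem sum_B_mul (hΨ : IsSkewInverse R Ψ) (j z : Fin n) :
    ∑ l, ∑ i, matB Ψ l i * R ![i, j] ![l, z] = if j = z then 1 else 0 :=
  sum_trace_mul (R := fun i j k l => R ![i, j] ![k, l]) (Ψ := fun i j k l => Ψ ![i, j] ![k, l])
    (B := matB Ψ) (fun _ _ => rfl) hΨ.left j z

theorem sum_B_mul_mul_inv (hR : IsHeckeRMatrix q R) (hq : q ≠ 0) (hΨ : IsSkewInverse R Ψ)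
    (j u v m : Fin n) :
    ∑ l, ∑ i, ∑ x, matB Ψ l i * R ![i, j] ![x, v] * R⁻¹ ![x, u] ![l, m] =
      if j = m then matB Ψ u v else 0 :=
  sum_trace_mul_mul (R := fun i j k l => R ![i, j] ![k, l])
    (Ψ := fun i j k l => Ψ ![i, j] ![k, l]) (A := fun i j k l => R ![i, j] ![k, l])
    (C := fun i j k l => R⁻¹ ![i, j] ![k, l]) (B := matB Ψ) (fun _ _ => rfl) hΨ.left hΨ.right
    (hR.sum_inv_mul hq) (hR.sum_yangBaxter hq) j u v m

/-- The matrix `B ⊗ B` commutes with `R`. -/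
theorem commute_B (hR : IsHeckeRMatrix q R) (hq : q ≠ 0) (hΨ : IsSkewInverse R Ψ) :
    Commute R (Matrix.of fun a b : Fin 2 → Fin n => matB Ψ (a 0) (b 0) * matB Ψ (a 1) (b 1)) := by
  have h1 : Commute R⁻¹
      (Matrix.of fun a b : Fin 2 → Fin n => matB Ψ (a 0) (b 0) * matB Ψ (a 1) (b 1)) := by
    ext a b
    have := sum_mul_B_mul_B (R := fun i j k l => R ![i, j] ![k, l])
      (Ψ := fun i j k l => Ψ ![i, j] ![k, l])
      (r := fun i j k l => R⁻¹ ![i, j] ![k, l]) (B := matB Ψ) (fun _ _ => rfl) hΨ.left hΨ.right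
      (hR.sum_inv_mul hq) (hR.sum_mul_inv hq) (hR.sum_yangBaxter hq) (hR.sum_yangBaxter' hq)
      (a 0) (a 1) (b 0) (b 1)
    rw [eq_vec_two a, eq_vec_two b, Matrix.mul_apply, Matrix.mul_apply, sum_fin_two_arrow,
      sum_fin_two_arrow]
    simpa using this
  have h2 : R = R⁻¹ + (q - q⁻¹) • 1 := by rw [(hR.mul_inv hq).2.2]; abel
  rw [h2]
  exact h1.add_left ((Commute.one_left _).smul_left _)

end IsHeckeRMatrix

end RMatrix

/-! ### Embeddings of matrices -/

/-- The embedding `amp f` as a homomorphism of algebras. -/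
noncomputable def ampHom {n m k : ℕ} (f : Fin m → Fin k) (hf : Function.Injective f) :
    TMat n m ℂ →ₐ[ℂ] TMat n k ℂ :=
  AlgHom.ofLinearMap
    { toFun := amp f
      map_add' := amp_add f
      map_smul' := fun c M => amp_smul f c M } (amp_one f) fun M N => (amp_mul f hf M N).symm

/-- The embedding of matrices into the first tensor factor. -/
noncomputable def firstHom (n k : ℕ) [NeZero k] : Matrix (Fin n) (Fin n) ℂ →ₐ[ℂ] TMat n k ℂ :=
  (ampHom (fun _ : Fin 1 => (0 : Fin k)) (Function.injective_of_subsingleton _)).comp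
    (Matrix.reindexAlgEquiv ℂ ℂ (Equiv.funUnique (Fin 1) (Fin n)).symm).toAlgHom

theorem firstHom_apply {n k : ℕ} [NeZero k] (X : Matrix (Fin n) (Fin n) ℂ) :
    firstHom n k X = atFirst k X := rfl

theorem ampHom_firstHom {n k : ℕ} [NeZero k] (f : Fin 2 → Fin k) (hf : Function.Injective f)
    (h0 : f 0 = 0) (X : Matrix (Fin n) (Fin n) ℂ) :
    ampHom f hf (firstHom n 2 X) = firstHom n k X := by
  refine (amp_amp f hf (fun _ : Fin 1 => (0 : Fin 2)) _).trans ?_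
  have : (f ∘ fun _ : Fin 1 => (0 : Fin 2)) = fun _ => (0 : Fin k) := funext fun _ => h0
  rw [this]
  rfl

theorem firstHom_two_apply {n : ℕ} (X : Matrix (Fin n) (Fin n) ℂ) (a b : Fin 2 → Fin n) :
    firstHom n 2 X a b = if a 1 = b 1 then X (a 0) (b 0) else 0 := by
  have e : (∀ j : Fin 2, (∀ i : Fin 1, (fun _ => (0 : Fin 2)) i ≠ j) → a j = b j) ↔ a 1 = b 1 := by
    simp [Fin.forall_fin_succ]
  exact if_congr e rfl rfl

/-! ### Representations of the modified reflection equation algebra -/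

section Contraction

variable {n : ℕ} (R : TMat n 2 ℂ) {E : Type*} [Ring E] [Algebra ℂ E]

/-- The contraction of `R` with a product of two matrix units around `x`, in the form in which it
enters the quadratic part of the reflection equation. -/
noncomputable def contraction (ε : Matrix (Fin n) (Fin n) ℂ →ₐ[ℂ] E) (a b : Fin 2 → Fin n) :
    E →ₗ[ℂ] E where
  toFun x :=
    ∑ c, ∑ c', ∑ d, ∑ e, (R a ![c, c'] * R ![d, c'] ![e, b 1]) •
      (ε (Matrix.single (b 0) e 1) * x * ε (Matrix.single d c 1)) -
    ∑ c, ∑ d, ∑ d', ∑ e, (R ![c, a 1] ![d, d'] * R ![e, d'] b) •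
      (ε (Matrix.single e d 1) * x * ε (Matrix.single c (a 0) 1))
  map_add' x y := by
    simp only [mul_add, add_mul, smul_add, Finset.sum_add_distrib]
    abel
  map_smul' t x := by
    simp only [mul_smul_comm, smul_mul_assoc, Finset.smul_sum, smul_sub, RingHom.id_apply,
      smul_comm t]

theorem contraction_apply (ε : Matrix (Fin n) (Fin n) ℂ →ₐ[ℂ] E) (a b : Fin 2 → Fin n) (x : E) :
    contraction R ε a b x =
      ∑ c, ∑ c', ∑ d, ∑ e, (R a ![c, c'] * R ![d, c'] ![e, b 1]) •
        (ε (Matrix.single (b 0) e 1) * x * ε (Matrix.single d c 1)) -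
      ∑ c, ∑ d, ∑ d', ∑ e, (R ![c, a 1] ![d, d'] * R ![e, d'] b) •
        (ε (Matrix.single e d 1) * x * ε (Matrix.single c (a 0) 1)) := rfl

/-- The linear part of the reflection equation. -/
noncomputable def linearPart (a b : Fin 2 → Fin n) : Matrix (Fin n) (Fin n) ℂ :=
  ∑ c, R a ![c, b 1] • Matrix.single (b 0) c 1 - ∑ e, R ![e, a 1] b • Matrix.single e (a 0) 1

variable {R}

theorem map_contraction {E' : Type*} [Ring E'] [Algebra ℂ E'] (φ : E →ₐ[ℂ] E')
    (ε : Matrix (Fin n) (Fin n) ℂ →ₐ[ℂ] E) (a b : Fin 2 → Fin n) (x : E) :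
    φ (contraction R ε a b x) = contraction R (φ.comp ε) a b (φ x) := by
  simp only [contraction_apply, map_sub, map_sum, map_smul, map_mul, AlgHom.comp_apply]

theorem contraction_mul_left (ε : Matrix (Fin n) (Fin n) ℂ →ₐ[ℂ] E) (a b : Fin 2 → Fin n)
    {f : E} (hf : ∀ X, Commute f (ε X)) (x : E) :
    contraction R ε a b (f * x) = f * contraction R ε a b x := by
  have : ∀ X Y, ε X * (f * x) * ε Y = f * (ε X * x * ε Y) := by
    intro X Y
    rw [← mul_assoc, ← (hf X).eq]
    simp only [mul_assoc]
  simp only [contraction_apply, this, mul_sub, Finset.mul_sum, mul_smul_comm]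

theorem contraction_mul_right (ε : Matrix (Fin n) (Fin n) ℂ →ₐ[ℂ] E) (a b : Fin 2 → Fin n)
    {f : E} (hf : ∀ X, Commute f (ε X)) (x : E) :
    contraction R ε a b (x * f) = contraction R ε a b x * f := by
  have : ∀ X Y, ε X * (x * f) * ε Y = (ε X * x * ε Y) * f := by
    intro X Y
    rw [mul_assoc _ (x * f), mul_assoc x, (hf Y).eq]
    simp only [mul_assoc]
  simp only [contraction_apply, this, sub_mul, Finset.sum_mul, smul_mul_assoc]

end Contraction

/-! ### The quadratic relation in one and in two tensor factors -/

section OneFactor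

variable {n : ℕ} {q : ℂ} {R Ψ : TMat n 2 ℂ}

theorem single_mul_mul_single {m : Type*} [Fintype m] [DecidableEq m] (X : Matrix m m ℂ)
    (i j k l : m) :
    Matrix.single i j 1 * X * Matrix.single k l 1 = X j k • Matrix.single i l 1 := by
  ext u v
  simp [Matrix.single, Matrix.mul_apply, ite_and]
  aesop

/-- Matrix units around `B` reduce it to its entries. What remains is the trace Tr_1(B_1 R_12) = I,
which removes one of the two R-matrices. -/
theorem contraction_B (hΨ : IsSkewInverse R Ψ) (a b : Fin 2 → Fin n) :
    contraction R (AlgHom.id ℂ _) a b (matB Ψ) = linearPart R a b := by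
  have hF := IsHeckeRMatrix.sum_B_mul hΨ
  simp only [contraction_apply, AlgHom.id_apply, single_mul_mul_single, smul_smul, linearPart]
  congr 1
  · refine Finset.sum_congr rfl fun c _ => ?_
    simp only [← Finset.sum_smul]
    congr 1
    calc _ = ∑ c', R a ![c, c'] * ∑ e, ∑ d, matB Ψ e d * R ![d, c'] ![e, b 1] := by
          refine Finset.sum_congr rfl fun c' _ => ?_
          rw [Finset.sum_comm, Finset.mul_sum]
          refine Finset.sum_congr rfl fun e _ => ?_
          rw [Finset.mul_sum]
          exact Finset.sum_congr rfl fun d _ => by ring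
      _ = _ := by simp [hF]
  · have h := Finset.sum_comm (s := Finset.univ) (t := Finset.univ)
      (f := fun (e : Fin n) (w : Fin n × Fin n × Fin n) =>
        (R ![w.2.2, a 1] ![w.2.1, w.1] * R ![e, w.1] b * matB Ψ w.2.1 w.2.2) •
          Matrix.single e (a 0) (1 : ℂ))
    have h' := Finset.sum_comm (s := Finset.univ) (t := Finset.univ)
      (f := fun (c : Fin n) (w : Fin n × Fin n) =>
        ∑ e, (R ![c, a 1] ![w.1, w.2] * R ![e, w.2] b * matB Ψ w.1 c) •
          Matrix.single e (a 0) (1 : ℂ))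
    simp only [Fintype.sum_prod_type] at h h'
    rw [h', Finset.sum_comm]
    have h2 : ∀ e, ∑ d', ∑ d, ∑ c, (R ![c, a 1] ![d, d'] * R ![e, d'] b * matB Ψ d c) •
        Matrix.single e (a 0) (1 : ℂ) = R ![e, a 1] b • Matrix.single e (a 0) (1 : ℂ) := by
      intro e
      simp only [← Finset.sum_smul]
      congr 1
      calc _ = ∑ d', R ![e, d'] b * ∑ d, ∑ c, matB Ψ d c * R ![c, a 1] ![d, d'] := by
            refine Finset.sum_congr rfl fun d' _ => ?_
            rw [Finset.mul_sum]
            refine Finset.sum_congr rfl fun d _ => ?_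
            rw [Finset.mul_sum]
            exact Finset.sum_congr rfl fun c _ => by ring
        _ = _ := by simp [hF]
    rw [← Finset.sum_congr rfl fun e _ => h2 e, h]

theorem firstHom_single_mul_mul_apply (X : TMat n 2 ℂ) (i j k l : Fin n) (u v : Fin 2 → Fin n) :
    (firstHom n 2 (Matrix.single i j 1) * X * firstHom n 2 (Matrix.single k l 1)) u v =
      if u 0 = i ∧ v 0 = l then X ![j, u 1] ![k, v 1] else 0 := by
  simp only [Matrix.mul_apply, sum_fin_two_arrow, firstHom_two_apply, Matrix.single,
    Matrix.of_apply, Matrix.cons_val_zero, Matrix.cons_val_one]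
  by_cases h1 : u 0 = i <;> by_cases h2 : v 0 = l <;>
    simp [h1, h2, eq_comm (a := i) (b := u 0), eq_comm (a := l) (b := v 0)]

/-- `X ⊗ Y` as a matrix on the second tensor power. -/
def tensorTwo (X Y : Matrix (Fin n) (Fin n) ℂ) : TMat n 2 ℂ :=
  Matrix.of fun a b => X (a 0) (b 0) * Y (a 1) (b 1)

theorem firstHom_mul_tensorTwo (X Y : Matrix (Fin n) (Fin n) ℂ) :
    firstHom n 2 X * tensorTwo 1 Y = tensorTwo X Y := by
  ext u v
  rw [Matrix.mul_apply, sum_fin_two_arrow]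
  simp [firstHom_two_apply, tensorTwo, Matrix.one_apply]

/-- In two factors the inner sums are partial traces Tr_1(B_1 R R⁻¹), so each half of the
contraction keeps one `R` and a copy of `B` in the second factor. The result is a commutator with a
matrix unit. -/
theorem contraction_inv_mul_B (hR : IsHeckeRMatrix q R) (hq : q ≠ 0) (hΨ : IsSkewInverse R Ψ)
    (a b : Fin 2 → Fin n) :
    contraction R (firstHom n 2) a b (R⁻¹ * firstHom n 2 (matB Ψ)) =
      tensorTwo 1 (matB Ψ) * (Matrix.single b a 1 * R - R * Matrix.single b a 1) := by
  have hF := hR.sum_B_mul_mul_inv hq hΨ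
  have hK : ∀ e x d y : Fin n, (R⁻¹ * firstHom n 2 (matB Ψ)) ![e, x] ![d, y] =
      ∑ l, R⁻¹ ![e, x] ![l, y] * matB Ψ l d := by
    intro e x d y
    rw [Matrix.mul_apply, sum_fin_two_arrow]
    simp [firstHom_two_apply]
  have h1 : ∀ u v : Fin 2 → Fin n,
      (tensorTwo 1 (matB Ψ) * (Matrix.single b a 1 * R) : TMat n 2 ℂ) u v =
      if u 0 = b 0 then R a v * matB Ψ (u 1) (b 1) else 0 := by
    intro u v
    rw [Matrix.mul_apply, Finset.sum_eq_single b]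
    · simp [tensorTwo, Matrix.one_apply, mul_comm]
    · intro x _ hx
      simp [hx]
    · simp
  have h2 : ∀ u v : Fin 2 → Fin n,
      (tensorTwo 1 (matB Ψ) * (R * Matrix.single b a 1) : TMat n 2 ℂ) u v =
      if v = a then ∑ d, matB Ψ (u 1) d * R ![u 0, d] b else 0 := by
    intro u v
    rw [← mul_assoc]
    by_cases hv : v = a
    · subst hv
      rw [Matrix.mul_single_apply_same, Matrix.mul_apply, sum_fin_two_arrow]
      simp [tensorTwo, Matrix.one_apply]
    · rw [Matrix.mul_single_apply_of_ne _ _ _ _ _ hv, if_neg hv]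
  ext u v
  rw [mul_sub, Matrix.sub_apply, h1, h2, contraction_apply, Matrix.sub_apply]
  simp only [Matrix.sum_apply, Matrix.smul_apply, firstHom_single_mul_mul_apply, smul_eq_mul, hK]
  congr 1
  · by_cases hu : u 0 = b 0
    · rw [Finset.sum_eq_single (v 0)]
      · simp only [hu, and_self, if_true]
        calc _ = ∑ c', R a ![v 0, c'] * ∑ l, ∑ d, ∑ e,
              matB Ψ l d * R ![d, c'] ![e, b 1] * R⁻¹ ![e, u 1] ![l, v 1] := by
              refine Finset.sum_congr rfl fun c' _ => ?_
              have h := Finset.sum_comm (s := Finset.univ) (t := Finset.univ)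
                (f := fun (l : Fin n) (w : Fin n × Fin n) =>
                  matB Ψ l w.1 * R ![w.1, c'] ![w.2, b 1] * R⁻¹ ![w.2, u 1] ![l, v 1])
              simp only [Fintype.sum_prod_type] at h
              rw [h, Finset.mul_sum]
              refine Finset.sum_congr rfl fun d _ => ?_
              rw [Finset.mul_sum]
              refine Finset.sum_congr rfl fun e _ => ?_
              rw [Finset.mul_sum, Finset.mul_sum]
              exact Finset.sum_congr rfl fun l _ => by ring
          _ = _ := by
              simp only [hF, mul_ite, mul_zero, Finset.sum_ite_eq', Finset.mem_univ, if_true]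
              rw [← eq_vec_two v]
      · intro c _ hc
        simp [hc.symm]
      · simp
    · simp [hu]
  · by_cases hv : v 0 = a 0
    · calc _ = ∑ c, ∑ d, ∑ d', (R ![c, a 1] ![d, d'] * R ![u 0, d'] b) *
              ∑ l, R⁻¹ ![d, u 1] ![l, v 1] * matB Ψ l c := by
            refine Finset.sum_congr rfl fun c _ => Finset.sum_congr rfl fun d _ =>
              Finset.sum_congr rfl fun d' _ => ?_
            rw [Finset.sum_eq_single (u 0)]
            · simp [hv]
            · intro e _ he
              simp [he.symm]
            · simp
        _ = ∑ d', R ![u 0, d'] b * ∑ l, ∑ c, ∑ d,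
              matB Ψ l c * R ![c, a 1] ![d, d'] * R⁻¹ ![d, u 1] ![l, v 1] := by
            have h := Finset.sum_comm (s := Finset.univ) (t := Finset.univ)
              (f := fun (w : Fin n × Fin n) (d' : Fin n) =>
                (R ![w.1, a 1] ![w.2, d'] * R ![u 0, d'] b) *
                ∑ l, R⁻¹ ![w.2, u 1] ![l, v 1] * matB Ψ l w.1)
            simp only [Fintype.sum_prod_type] at h
            rw [h]
            refine Finset.sum_congr rfl fun d' _ => ?_
            have h' := Finset.sum_comm (s := Finset.univ) (t := Finset.univ)
              (f := fun (l : Fin n) (w : Fin n × Fin n) =>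
                matB Ψ l w.1 * R ![w.1, a 1] ![w.2, d'] * R⁻¹ ![w.2, u 1] ![l, v 1])
            simp only [Fintype.sum_prod_type] at h'
            rw [h', Finset.mul_sum]
            refine Finset.sum_congr rfl fun c _ => ?_
            rw [Finset.mul_sum]
            refine Finset.sum_congr rfl fun d _ => ?_
            rw [Finset.mul_sum, Finset.mul_sum]
            exact Finset.sum_congr rfl fun l _ => by ring
        _ = _ := by
            simp only [hF]
            by_cases hv1 : a 1 = v 1
            · have : v = a := by
                rw [eq_vec_two v, eq_vec_two a, hv, hv1]
              simp only [if_pos hv1, if_pos this]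
              exact Finset.sum_congr rfl fun d _ => mul_comm _ _
            · have : v ≠ a := fun h => hv1 (by rw [h])
              simp [hv1, this]
    · have : v ≠ a := fun h => hv (by rw [h])
      simp [hv, this]

end OneFactor

/-! ### Homomorphisms out of the reflection equation algebra -/

section Lift

variable {n : ℕ} {q : ℂ} {R Ψ : TMat n 2 ℂ} {E : Type*} [Ring E] [Algebra ℂ E]

theorem matL1_apply (u v : Fin 2 → Fin n) :
    matL1 n u v = if u 1 = v 1 then FreeAlgebra.ι ℂ (u 0, v 0) else 0 := by
  have e : (∀ j : Fin 2, (∀ i : Fin 1, (fun _ => (0 : Fin 2)) i ≠ j) → u j = v j) ↔ u 1 = v 1 := by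
    simp [Fin.forall_fin_succ]
  exact if_congr e rfl rfl

theorem matR12_apply (u v : Fin 2 → Fin n) :
    matR12 R u v = algebraMap ℂ (FreeAlgebra ℂ (Fin n × Fin n)) (R u v) := rfl

theorem mul_matL1_apply (X : TMat n 2 (FreeAlgebra ℂ (Fin n × Fin n))) (a b : Fin 2 → Fin n) :
    (X * matL1 n) a b = ∑ c, X a ![c, b 1] * FreeAlgebra.ι ℂ (c, b 0) := by
  rw [Matrix.mul_apply, sum_fin_two_arrow]
  refine Finset.sum_congr rfl fun c _ => ?_
  rw [Finset.sum_eq_single (b 1)]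
  · simp [matL1_apply]
  · intro x _ hx
    simp [matL1_apply, hx]
  · simp

theorem matL1_mul_apply (X : TMat n 2 (FreeAlgebra ℂ (Fin n × Fin n))) (a b : Fin 2 → Fin n) :
    (matL1 n * X) a b = ∑ c, FreeAlgebra.ι ℂ (a 0, c) * X ![c, a 1] b := by
  rw [Matrix.mul_apply, sum_fin_two_arrow]
  refine Finset.sum_congr rfl fun c _ => ?_
  rw [Finset.sum_eq_single (a 1)]
  · simp [matL1_apply]
  · intro x _ hx
    simp [matL1_apply, hx.symm]
  · simp

/-- A family of elements that satisfies the opposite of the reflection equation gives a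
homomorphism to the opposite algebra. -/
theorem exists_mreaHom (N : Matrix (Fin n) (Fin n) ℂ →ₗ[ℂ] E)
    (hN : ∀ a b : Fin 2 → Fin n,
      ∑ c, ∑ c', ∑ d, ∑ e, (R a ![c, c'] * R ![d, c'] ![e, b 1]) •
        (N (Matrix.single (b 0) e 1) * N (Matrix.single d c 1)) -
      ∑ c, ∑ d, ∑ d', ∑ e, (R ![c, a 1] ![d, d'] * R ![e, d'] b) •
        (N (Matrix.single e d 1) * N (Matrix.single c (a 0) 1)) = N (linearPart R a b)) :
    ∃ f : MREA R →ₐ[ℂ] Eᵐᵒᵖ, ∀ i j,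
      f (MREA.l R i j) = MulOpposite.op (N (Matrix.single j i 1)) := by
  let g : FreeAlgebra ℂ (Fin n × Fin n) →ₐ[ℂ] Eᵐᵒᵖ :=
    FreeAlgebra.lift ℂ fun ij => MulOpposite.op (N (Matrix.single ij.2 ij.1 1))
  have hg : ∀ i j, g (FreeAlgebra.ι ℂ (i, j)) = MulOpposite.op (N (Matrix.single j i 1)) :=
    fun i j => FreeAlgebra.lift_ι_apply _ _
  let G : FreeAlgebra ℂ (Fin n × Fin n) →ₗ[ℂ] E :=
    (MulOpposite.opLinearEquiv ℂ).symm.toLinearMap ∘ₗ g.toLinearMap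
  have hG : ∀ i j, G (FreeAlgebra.ι ℂ (i, j)) = N (Matrix.single j i 1) :=
    fun i j => congrArg MulOpposite.unop (hg i j)
  have hGmul : ∀ x y, G (x * y) = G y * G x :=
    fun x y => congrArg MulOpposite.unop (map_mul g x y)
  have h1 : ∀ a b : Fin 2 → Fin n, (matR12 R * matL1 n * matR12 R * matL1 n) a b =
      ∑ c, ∑ c', ∑ d, ∑ e, (R a ![c, c'] * R ![d, c'] ![e, b 1]) •
        (FreeAlgebra.ι ℂ (c, d) * FreeAlgebra.ι ℂ (e, b 0)) := by
    intro a b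
    rw [mul_assoc (matR12 R * matL1 n), Matrix.mul_apply, sum_fin_two_arrow]
    have h := Finset.sum_comm (s := Finset.univ) (t := Finset.univ)
      (f := fun (d : Fin n) (w : Fin n × Fin n) =>
        ∑ e, (R a ![w.1, w.2] * R ![d, w.2] ![e, b 1]) •
        (FreeAlgebra.ι ℂ (w.1, d) * FreeAlgebra.ι ℂ (e, b 0)))
    simp only [Fintype.sum_prod_type] at h
    rw [← h]
    refine Finset.sum_congr rfl fun d _ => ?_
    rw [Finset.sum_comm]
    refine Finset.sum_congr rfl fun c' _ => ?_
    simp only [mul_matL1_apply, matR12_apply, ← Algebra.smul_def, Finset.sum_mul_sum,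
      smul_mul_smul_comm, Matrix.cons_val_zero, Matrix.cons_val_one]
  have h2 : ∀ a b : Fin 2 → Fin n, (matL1 n * matR12 R * matL1 n * matR12 R) a b =
      ∑ c, ∑ d, ∑ d', ∑ e, (R ![c, a 1] ![d, d'] * R ![e, d'] b) •
        (FreeAlgebra.ι ℂ (a 0, c) * FreeAlgebra.ι ℂ (d, e)) := by
    intro a b
    rw [mul_assoc (matL1 n * matR12 R), Matrix.mul_apply, sum_fin_two_arrow]
    have h := Finset.sum_comm (s := Finset.univ) (t := Finset.univ)
      (f := fun (c : Fin n) (w : Fin n × Fin n) =>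
        ∑ e, (R ![c, a 1] ![w.1, w.2] * R ![e, w.2] b) •
        (FreeAlgebra.ι ℂ (a 0, c) * FreeAlgebra.ι ℂ (w.1, e)))
    simp only [Fintype.sum_prod_type] at h
    rw [h]
    refine Finset.sum_congr rfl fun d _ => Finset.sum_congr rfl fun d' _ => ?_
    simp only [matL1_mul_apply, matR12_apply, ← Algebra.commutes, ← Algebra.smul_def,
      Finset.sum_mul_sum, smul_mul_smul_comm, Matrix.cons_val_zero, Matrix.cons_val_one]
  have hrel : ∀ ⦃x y⦄, MREARel R x y → g x = g y := by
    rintro _ _ ⟨a, b⟩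
    have key : G ((matR12 R * matL1 n * matR12 R * matL1 n -
          matL1 n * matR12 R * matL1 n * matR12 R) a b) =
        G ((matR12 R * matL1 n - matL1 n * matR12 R) a b) := by
      rw [Matrix.sub_apply, h1, h2, Matrix.sub_apply, mul_matL1_apply, matL1_mul_apply]
      simp only [matR12_apply, ← Algebra.commutes, ← Algebra.smul_def, map_sub, map_sum, map_smul,
        hGmul, hG]
      rw [hN, linearPart]
      simp only [map_sub, map_sum, map_smul]
    exact MulOpposite.unop_injective key
  refine ⟨RingQuot.liftAlgHom ℂ ⟨g, hrel⟩, fun i j => ?_⟩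
  rw [MREA.l, RingQuot.liftAlgHom_mkAlgHom_apply, hg]

end Lift

/-! ### The inverse generators -/

section HeckeFamily

variable {n : ℕ} {q : ℂ} {R Ψ : TMat n 2 ℂ}

theorem siteR_inv (hR : IsHeckeRMatrix q R) (hq : q ≠ 0) (k i : ℕ) :
    (siteR R k i)⁻¹ = siteR R⁻¹ k i := by
  by_cases h : i + 1 < k
  · refine Matrix.inv_eq_right_inv ?_
    rw [siteR_mul_siteR _ _ _ h, (hR.mul_inv hq).1, siteR_one]
  · simp [siteR, dif_neg h]

theorem siteR_mul_inv (hR : IsHeckeRMatrix q R) (hq : q ≠ 0) (k i : ℕ) :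
    siteR R k i * (siteR R k i)⁻¹ = 1 := by
  by_cases h : i + 1 < k
  · rw [siteR_inv hR hq, siteR_mul_siteR _ _ _ h, (hR.mul_inv hq).1, siteR_one]
  · simp [siteR, dif_neg h]

theorem siteR_mul_self (hR : IsHeckeRMatrix q R) (hq : q ≠ 0) {k i : ℕ} (h : i + 1 < k) :
    siteR R k i * siteR R k i = 1 + (q - q⁻¹) • siteR R k i := by
  have := siteR_hecke hR k i h
  rw [sub_mul, mul_add, mul_add, mul_smul_comm, smul_mul_assoc, smul_mul_assoc, mul_one, one_mul,
    one_mul, smul_smul, mul_inv_cancel₀ hq, one_smul] at this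
  rw [← sub_eq_zero, ← this]
  module

/-- The inverses have eigenvalues q⁻¹ and -q, hence form a Hecke family with parameter q⁻¹. -/
theorem isHeckeFamily_siteR_inv (hR : IsHeckeRMatrix q R) (hq : q ≠ 0) (k : ℕ) :
    IsHeckeFamily q⁻¹ k (fun i => (siteR R k i)⁻¹) where
  braid _ h := by
    have := congrArg (fun X => X⁻¹) (siteR_braid hR k _ h)
    simpa only [Matrix.mul_inv_rev, mul_assoc] using this
  comm _ _ h hj := by
    have := congrArg (fun X => X⁻¹) (siteR_comm R k _ _ h hj)
    simp only [Matrix.mul_inv_rev] at this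
    exact this.symm
  quad i h := by
    have h1 : siteR R k i * (siteR R k i - (q - q⁻¹) • 1) = 1 := by
      rw [mul_sub, siteR_mul_self hR hq h, mul_smul_comm, mul_one, add_sub_cancel_right]
    rw [Matrix.inv_eq_right_inv h1, sub_mul, h1, inv_inv, smul_mul_assoc, one_mul]
    module

end HeckeFamily

section QuadForm

variable {n : ℕ} (R : TMat n 2 ℂ) {E : Type*} [Ring E] [Algebra ℂ E]

/-- The quadratic part of the reflection equation, evaluated on a function of two matrices. -/
noncomputable def quadForm (a b : Fin 2 → Fin n)
    (F : Matrix (Fin n) (Fin n) ℂ → Matrix (Fin n) (Fin n) ℂ → E) : E :=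
  ∑ c, ∑ c', ∑ d, ∑ e, (R a ![c, c'] * R ![d, c'] ![e, b 1]) •
    F (Matrix.single (b 0) e 1) (Matrix.single d c 1) -
  ∑ c, ∑ d, ∑ d', ∑ e, (R ![c, a 1] ![d, d'] * R ![e, d'] b) •
    F (Matrix.single e d 1) (Matrix.single c (a 0) 1)

theorem contraction_eq_quadForm (ε : Matrix (Fin n) (Fin n) ℂ →ₐ[ℂ] E) (a b : Fin 2 → Fin n)
    (x : E) : contraction R ε a b x = quadForm R a b fun X Y => ε X * x * ε Y := rfl

theorem quadForm_add (a b : Fin 2 → Fin n)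
    (F G : Matrix (Fin n) (Fin n) ℂ → Matrix (Fin n) (Fin n) ℂ → E) :
    quadForm R a b (fun X Y => F X Y + G X Y) = quadForm R a b F + quadForm R a b G := by
  simp only [quadForm, smul_add, Finset.sum_add_distrib]
  abel

theorem quadForm_sum {ι : Type*} (s : Finset ι) (a b : Fin 2 → Fin n)
    (F : ι → Matrix (Fin n) (Fin n) ℂ → Matrix (Fin n) (Fin n) ℂ → E) :
    quadForm R a b (fun X Y => ∑ i ∈ s, F i X Y) = ∑ i ∈ s, quadForm R a b (F i) := by
  classical
  induction s using Finset.induction_on with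
  | empty => simp [quadForm]
  | insert i s hi ih => simp only [Finset.sum_insert hi, quadForm_add, ih]

theorem quadForm_mul_mul (a b : Fin 2 → Fin n) (x y : E)
    (F : Matrix (Fin n) (Fin n) ℂ → Matrix (Fin n) (Fin n) ℂ → E) :
    quadForm R a b (fun X Y => x * F X Y * y) = x * quadForm R a b F * y := by
  simp only [quadForm, mul_sub, sub_mul, Finset.mul_sum, Finset.sum_mul, mul_smul_comm,
    smul_mul_assoc]

end QuadForm

/-! ### The reflection equation on tensor powers -/

section TensorPower

variable {n : ℕ} {q : ℂ} {R Ψ : TMat n 2 ℂ}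

theorem commute_firstHom_siteR (A : TMat n 2 ℂ) {k i : ℕ} [NeZero k] (h : i + 2 < k)
    (X : Matrix (Fin n) (Fin n) ℂ) : Commute (siteR A k (i + 1)) (firstHom n k X) := by
  rw [siteR, dif_pos (show i + 1 + 1 < k by omega), firstHom_apply, atFirst]
  refine amp_comm _ _ (fun x y => ?_) _ _
  fin_cases x <;> simp [Fin.ext_iff]

/-- The expression is (B ⊗ B)[E, R] with E a matrix unit. As B ⊗ B commutes with R⁻¹, it remains
that R⁻¹[E, R] + [E, R]R⁻¹ = R⁻¹ER - RER⁻¹, which is -(q - q⁻¹)[E, R] because R⁻¹ = R - (q - q⁻¹).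
-/
theorem inv_mul_add_mul_inv (hR : IsHeckeRMatrix q R) (hq : q ≠ 0) (hΨ : IsSkewInverse R Ψ)
    (a b : Fin 2 → Fin n) :
    R⁻¹ * (firstHom n 2 (matB Ψ) *
        contraction R (firstHom n 2) a b (R⁻¹ * firstHom n 2 (matB Ψ))) +
      (firstHom n 2 (matB Ψ) *
        contraction R (firstHom n 2) a b (R⁻¹ * firstHom n 2 (matB Ψ))) * R⁻¹ =
      -((q - q⁻¹) • (firstHom n 2 (matB Ψ) *
        contraction R (firstHom n 2) a b (R⁻¹ * firstHom n 2 (matB Ψ)))) := by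
  obtain ⟨h1, h2, h3⟩ := hR.mul_inv hq
  have hc : R * tensorTwo (matB Ψ) (matB Ψ) = tensorTwo (matB Ψ) (matB Ψ) * R :=
    (hR.commute_B hq hΨ).eq
  have hc' : R⁻¹ * tensorTwo (matB Ψ) (matB Ψ) = tensorTwo (matB Ψ) (matB Ψ) * R⁻¹ := by
    rw [h3, sub_mul, mul_sub, hc, smul_mul_assoc, one_mul, mul_smul_comm, mul_one]
  rw [contraction_inv_mul_B hR hq hΨ, ← mul_assoc (firstHom n 2 _), firstHom_mul_tensorTwo,
    ← mul_assoc, hc', mul_assoc, mul_assoc, ← mul_add, ← mul_smul_comm, ← mul_neg]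
  congr 1
  have e1 : (Matrix.single b a 1 * R) * R⁻¹ = Matrix.single b a 1 := by
    rw [mul_assoc, h1, mul_one]
  have e2 : R⁻¹ * (R * Matrix.single b a 1) = Matrix.single b a 1 := by
    rw [← mul_assoc, h2, one_mul]
  rw [mul_sub, sub_mul, e1, e2, h3, sub_mul, mul_sub, smul_mul_assoc, one_mul, mul_smul_comm,
    mul_one, mul_assoc]
  module

/-- The relations of the reflection equation algebra for the matrices on `V^{⊗ k}`. -/
theorem quadForm_chainSum (hR : IsHeckeRMatrix q R) (hq : q ≠ 0) (hΨ : IsSkewInverse R Ψ)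
    (k : ℕ) [NeZero k] (a b : Fin 2 → Fin n) :
    quadForm R a b (fun X Y =>
      chainSum (fun i => (siteR R k i)⁻¹) k (firstHom n k (matB Ψ * X)) *
        chainSum (fun i => (siteR R k i)⁻¹) k (firstHom n k (matB Ψ * Y))) =
      chainSum (fun i => (siteR R k i)⁻¹) k (firstHom n k (matB Ψ * linearPart R a b)) := by
  set r : ℕ → TMat n k ℂ := fun i => (siteR R k i)⁻¹ with hr
  have hfam : IsHeckeFamily q⁻¹ k r := isHeckeFamily_siteR_inv hR hq k
  have hcomm : ∀ i, i + 2 < k → ∀ X, Commute (r (i + 1)) (firstHom n k X) := fun i h X => by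
    simp only [hr, siteR_inv hR hq]
    exact commute_firstHom_siteR _ h X
  set β := firstHom n k (matB Ψ) with hβ
  have key := hfam.sum_chain_mul_chain (contraction R (firstHom n k) a b) β
    (firstHom n k (linearPart R a b)) (fun i h => (hcomm i h _).symm)
    (by rw [← contraction_B hΨ a b, map_contraction]; rfl)
    (fun i h _ => contraction_mul_left _ _ _ (hcomm i h) _)
    (fun i h _ => contraction_mul_right _ _ _ (hcomm i h) _) ?_
  · simp only [chainSum, map_mul, ← mul_assoc, ← hβ] at key ⊢
    rw [← key]
    simp only [Finset.sum_mul_sum, quadForm_sum, contraction_eq_quadForm]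
    refine Finset.sum_congr rfl fun s _ => Finset.sum_congr rfl fun t _ => ?_
    rw [← quadForm_mul_mul]
    simp only [mul_assoc]
  -- The two-factor condition lives in the first two tensor factors and is the image of an identity
  -- on V^{⊗2} under the embedding.
  · intro h1
    have hinj : Function.Injective (![⟨0, by omega⟩, ⟨1, h1⟩] : Fin 2 → Fin k) := by
      intro x y hxy
      fin_cases x <;> fin_cases y <;> simp_all
    have h0 : (![⟨0, by omega⟩, ⟨1, h1⟩] : Fin 2 → Fin k) 0 = 0 := rfl
    have e1 : r 0 = ampHom _ hinj R⁻¹ := by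
      simp only [hr, siteR_inv hR hq]
      rw [siteR, dif_pos (by omega)]
      rfl
    have e2 : β = ampHom _ hinj (firstHom n 2 (matB Ψ)) := (ampHom_firstHom _ hinj h0 _).symm
    have e3 : firstHom n k = (ampHom _ hinj).comp (firstHom n 2) :=
      AlgHom.ext fun X => (ampHom_firstHom _ hinj h0 X).symm
    rw [e1, e2, e3, ← map_mul, ← map_contraction]
    simp only [← map_mul, ← map_add, ← map_smul, ← map_neg]
    rw [inv_mul_add_mul_inv hR hq hΨ]

end TensorPower

/-! ### Transposed matrices and operators -/

section Operators

variable {ι W : Type*} [Fintype ι] [DecidableEq ι] [AddCommGroup W] [Module ℂ W]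

/-- The correspondence between transposed matrices and operators. -/
noncomputable def opEquiv (b : Module.Basis ι ℂ W) : (Matrix ι ι ℂ)ᵐᵒᵖ ≃ₐ[ℂ] Module.End ℂ W :=
  (Matrix.transposeAlgEquiv ι ℂ ℂ).symm.trans (Matrix.toLinAlgEquiv b)

theorem opEquiv_op (b : Module.Basis ι ℂ W) (M : Matrix ι ι ℂ) :
    opEquiv b (MulOpposite.op M) = opT b M := rfl

theorem opT_mul (b : Module.Basis ι ℂ W) (M N : Matrix ι ι ℂ) :
    opT b (M * N) = opT b N * opT b M := by
  rw [← opEquiv_op, MulOpposite.op_mul, map_mul]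
  rfl

theorem opT_one (b : Module.Basis ι ℂ W) : opT b 1 = 1 := by
  rw [opT, Matrix.transpose_one, Matrix.toLin_one]
  rfl

theorem opT_zero (b : Module.Basis ι ℂ W) : opT b 0 = 0 := by
  rw [opT, Matrix.transpose_zero, map_zero]

theorem opT_add (b : Module.Basis ι ℂ W) (M N : Matrix ι ι ℂ) :
    opT b (M + N) = opT b M + opT b N := by
  rw [opT, Matrix.transpose_add, map_add, opT, opT]

theorem opT_smul (b : Module.Basis ι ℂ W) (c : ℂ) (M : Matrix ι ι ℂ) :
    opT b (c • M) = c • opT b M := by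
  rw [opT, Matrix.transpose_smul, map_smul, opT]

theorem opT_injective (b : Module.Basis ι ℂ W) : Function.Injective (opT b) :=
  (opEquiv b).injective.comp MulOpposite.op_injective

theorem matrixT_opT (b : Module.Basis ι ℂ W) (M : Matrix ι ι ℂ) : matrixT b (opT b M) = M := by
  simp [matrixT, opT]

theorem opT_apply (b : Module.Basis ι ℂ W) (M : Matrix ι ι ℂ) (a : ι) :
    opT b M (b a) = ∑ c, M a c • b c := by
  simp [opT, Matrix.toLin_self]

end Operators

/-- The separate first summand is the term `s = 0` with empty chains. -/
theorem rhoT_eq_chainSum {n : ℕ} (R : TMat n 2 ℂ) (k : ℕ) [NeZero k]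
    (X : Matrix (Fin n) (Fin n) ℂ) :
    rhoT R k X = chainSum (fun i => (siteR R k i)⁻¹) k (firstHom n k X) := by
  have h1 : ∀ s, chainDown R k s = downProd (fun i => (siteR R k i)⁻¹) s := by
    intro s
    induction s with
    | zero => rfl
    | succ s ih => rw [chainDown, downProd_succ, ih]
  have h2 : ∀ s, chainUp R k s = upProd (fun i => (siteR R k i)⁻¹) s := by
    intro s
    induction s with
    | zero => rfl
    | succ s ih => rw [chainUp, upProd_succ, ih]
  have h3 : Finset.Icc 1 (k - 1) = Finset.Ico (0 + 1) k := by
    ext x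
    have := NeZero.pos k
    simp only [Finset.mem_Icc, Finset.mem_Ico]
    omega
  simp only [rhoT, chainSum, h1, h2, h3]
  rw [Finset.range_eq_Ico, Finset.sum_eq_sum_Ico_succ_bot (NeZero.pos k), firstHom_apply]
  simp [downProd, upProd]

/-! ### The fundamental module and its tensor powers -/

section Representations

variable {n : ℕ} {q : ℂ} {R Ψ : TMat n 2 ℂ} {V : Type*} [AddCommGroup V] [Module ℂ V]

/-- The transposed matrix of l_i^j is B E_{ji}. Multiplying `contraction_B` by `B` on the left gives
the relations for these matrices. -/
theorem exists_fundamental (hΨ : IsSkewInverse R Ψ) (e : Module.Basis (Fin n) ℂ V) :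
    ∃ π : MREA R →ₐ[ℂ] Module.End ℂ V, ∀ i j,
      π (MREA.l R i j) = opT e (matB Ψ * Matrix.single j i 1) := by
  obtain ⟨f, hf⟩ := exists_mreaHom (R := R) (LinearMap.mulLeft ℂ (matB Ψ)) fun a b => by
    have h := quadForm_mul_mul R a b (matB Ψ) 1
      (fun X Y => AlgHom.id ℂ _ X * matB Ψ * AlgHom.id ℂ _ Y)
    rw [← contraction_eq_quadForm, contraction_B hΨ, mul_one] at h
    rw [LinearMap.mulLeft_apply, ← h]
    simp only [quadForm, mul_one, LinearMap.mulLeft_apply, AlgHom.id_apply, mul_assoc]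
  refine ⟨(opEquiv e).toAlgHom.comp f, fun i j => ?_⟩
  rw [AlgHom.comp_apply, hf, LinearMap.mulLeft_apply]
  exact opEquiv_op e (matB Ψ * Matrix.single j i 1)

theorem opT_B_single_apply (e : Module.Basis (Fin n) ℂ V) (i j a : Fin n) :
    opT e (matB Ψ * Matrix.single j i 1) (e a) = matB Ψ a j • e i := by
  rw [opT_apply, Finset.sum_eq_single i]
  · simp
  · intro c _ hc
    rw [Matrix.mul_single_apply_of_ne _ _ _ _ _ hc, zero_smul]
  · simp

theorem exists_tensorPower (hR : IsHeckeRMatrix q R) (hq : q ≠ 0) (hΨ : IsSkewInverse R Ψ)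
    (e : Module.Basis (Fin n) ℂ V) (k : ℕ) [NeZero k] :
    ∃ ρ : MREA R →ₐ[ℂ] Module.End ℂ (TPow V k), ∀ i j,
      ρ (MREA.l R i j) = opT (tensorBasis e k) (rhoT R k (matB Ψ * Matrix.single j i 1)) := by
  set r : ℕ → TMat n k ℂ := fun i => (siteR R k i)⁻¹ with hr
  let N : Matrix (Fin n) (Fin n) ℂ →ₗ[ℂ] TMat n k ℂ :=
    (∑ s ∈ Finset.range k, LinearMap.mulRight ℂ (upProd r s) ∘ₗ
      LinearMap.mulLeft ℂ (downProd r s)) ∘ₗ (firstHom n k).toLinearMap ∘ₗ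
        LinearMap.mulLeft ℂ (matB Ψ)
  have hN : ∀ Z, N Z = chainSum r k (firstHom n k (matB Ψ * Z)) := by
    intro Z
    simp [N, chainSum]
  obtain ⟨f, hf⟩ := exists_mreaHom (R := R) N fun a b => by
    simpa only [hN, quadForm] using quadForm_chainSum hR hq hΨ k a b
  refine ⟨(opEquiv (tensorBasis e k)).toAlgHom.comp f, fun i j => ?_⟩
  rw [AlgHom.comp_apply, hf, rhoT_eq_chainSum, ← hN]
  exact opEquiv_op (tensorBasis e k) _

theorem MREA.induction {P : MREA R → Prop} (hl : ∀ i j, P (MREA.l R i j))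
    (hc : ∀ c : ℂ, P (algebraMap ℂ _ c)) (hadd : ∀ x y, P x → P y → P (x + y))
    (hmul : ∀ x y, P x → P y → P (x * y)) (x : MREA R) : P x := by
  obtain ⟨y, rfl⟩ := RingQuot.mkAlgHom_surjective ℂ (MREARel R) x
  induction y using FreeAlgebra.induction with
  | grade0 c => rw [AlgHom.commutes]; exact hc c
  | grade1 ij => exact hl ij.1 ij.2
  | mul x y hx hy => rw [map_mul]; exact hmul _ _ hx hy
  | add x y hx hy => rw [map_add]; exact hadd _ _ hx hy

theorem commute_opT {ι W : Type*} [Fintype ι] [DecidableEq ι] [AddCommGroup W] [Module ℂ W]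
    (b : Module.Basis ι ℂ W) {M N : Matrix ι ι ℂ} (h : Commute M N) :
    Commute (opT b M) (opT b N) := by
  rw [commute_iff_eq, ← opT_mul, ← opT_mul, h.eq]

/-- The chains consist of inverse generators, so commutation is first obtained for the inverse and
then carried over by conjugation. -/
theorem commute_siteR_rhoT (hR : IsHeckeRMatrix q R) (hq : q ≠ 0) {k i : ℕ} [NeZero k]
    (h : i + 1 < k) (X : Matrix (Fin n) (Fin n) ℂ) : Commute (siteR R k i) (rhoT R k X) := by
  have h1 : Commute (siteR R k i)⁻¹ (rhoT R k X) := by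
    rw [rhoT_eq_chainSum]
    refine (isHeckeFamily_siteR_inv hR hq k).commute_chainSum (fun j hj => ?_) h
    simp only [siteR_inv hR hq]
    exact (commute_firstHom_siteR _ hj X).symm
  have h2 := siteR_mul_inv hR hq k i
  have h3 : (siteR R k i)⁻¹ * siteR R k i = 1 := by rw [mul_eq_one_comm, h2]
  calc siteR R k i * rhoT R k X
      = siteR R k i * (rhoT R k X * (siteR R k i)⁻¹) * siteR R k i := by
        rw [mul_assoc, mul_assoc, h3, mul_one]
    _ = rhoT R k X * siteR R k i := by
        rw [← h1.eq, ← mul_assoc, h2, one_mul]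

theorem commute_site_rho (hR : IsHeckeRMatrix q R) (hq : q ≠ 0) (e : Module.Basis (Fin n) ℂ V)
    {k : ℕ} [NeZero k] {ρ : MREA R →ₐ[ℂ] Module.End ℂ (TPow V k)}
    (hρ : ∀ i j, ∃ X, ρ (MREA.l R i j) = opT (tensorBasis e k) (rhoT R k X)) (x : MREA R)
    {i : ℕ} (h : i + 1 < k) : Commute (ρ x) (opT (tensorBasis e k) (siteR R k i)) := by
  induction x using MREA.induction with
  | hl a b =>
    obtain ⟨X, hX⟩ := hρ a b
    rw [hX]
    exact commute_opT _ (commute_siteR_rhoT hR hq h X).symm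
  | hc c =>
    rw [AlgHom.commutes]
    exact Algebra.commutes c _
  | hadd x y hx hy =>
    rw [map_add]
    exact hx.add_left hy
  | hmul x y hx hy =>
    rw [map_mul]
    exact hx.mul_left hy

end Representations

/-! ### Standard tableaux and box sequences -/

/-- The boxes of a standard tableau in the order of their entries. -/
def Tableau.boxSeq {k : ℕ} (T : Tableau k) (m : ℕ) : ℕ × ℕ :=
  if h : m < k then (T.2.box ⟨m, h⟩).1 else (0, 0)

namespace Tableau

variable {k : ℕ}

theorem boxSeq_of_lt (T : Tableau k) {m : ℕ} (h : m < k) :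
    T.boxSeq m = (T.2.box ⟨m, h⟩).1 := dif_pos h

theorem exists_boxSeq_eq (T : Tableau k) {b : ℕ × ℕ} (hb : b ∈ T.1.cells) :
    ∃ j, ∃ h : j < k, T.boxSeq j = b ∧ T.2.box ⟨j, h⟩ = ⟨b, hb⟩ := by
  refine ⟨T.2.box.symm ⟨b, hb⟩, Fin.is_lt _, ?_, ?_⟩
  · rw [boxSeq_of_lt _ (Fin.is_lt _), Fin.eta, Equiv.apply_symm_apply]
  · rw [Fin.eta, Equiv.apply_symm_apply]

theorem boxSeq_mem (T : Tableau k) {m : ℕ} (h : m < k) : T.boxSeq m ∈ T.1.cells := by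
  rw [boxSeq_of_lt _ h]
  exact Subtype.property _

/-- The neighbours belong to the shape because it is a lower set, and they carry smaller entries
because the tableau is standard. -/
theorem isBoxSeq (T : Tableau k) : IsBoxSeq k T.boxSeq where
  inj i hi j hj hij := by
    rw [boxSeq_of_lt _ hi, boxSeq_of_lt _ hj] at hij
    simpa using T.2.box.injective (Subtype.ext hij)
  up m hm r c hrc := by
    have h1 : (r, c) ∈ T.1.cells :=
      T.1.up_left_mem (Nat.le_succ r) le_rfl (hrc ▸ T.boxSeq_mem hm)
    obtain ⟨j, hj, hj1, hj2⟩ := T.exists_boxSeq_eq h1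
    rw [boxSeq_of_lt _ hm] at hrc
    refine ⟨j, ?_, hj1⟩
    have := T.2.col_lt ⟨j, hj⟩ ⟨m, hm⟩ (by rw [hj2, hrc]) (by rw [hj2, hrc]; simp)
    exact this
  left m hm r c hrc := by
    have h1 : (r, c) ∈ T.1.cells :=
      T.1.up_left_mem le_rfl (Nat.le_succ c) (hrc ▸ T.boxSeq_mem hm)
    obtain ⟨j, hj, hj1, hj2⟩ := T.exists_boxSeq_eq h1
    rw [boxSeq_of_lt _ hm] at hrc
    refine ⟨j, ?_, hj1⟩
    have := T.2.row_lt ⟨j, hj⟩ ⟨m, hm⟩ (by rw [hj2, hrc]) (by rw [hj2, hrc]; simp)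
    exact this

theorem cells_eq (T : Tableau k) : T.1.cells = (Finset.range k).image T.boxSeq := by
  ext b
  simp only [Finset.mem_image, Finset.mem_range]
  constructor
  · intro hb
    obtain ⟨j, hj, hj1, -⟩ := T.exists_boxSeq_eq hb
    exact ⟨j, hj, hj1⟩
  · rintro ⟨j, hj, rfl⟩
    exact T.boxSeq_mem hj

theorem ext_boxSeq {S T : Tableau k} (h : ∀ m < k, S.boxSeq m = T.boxSeq m) : S = T := by
  have h1 : S.1.cells = T.1.cells := by
    rw [cells_eq, cells_eq]
    exact Finset.image_congr fun m hm => h m (Finset.mem_range.1 hm)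
  obtain ⟨ν, S⟩ := S
  obtain ⟨μ, T⟩ := T
  obtain rfl : ν = μ := YoungDiagram.ext h1
  congr 1
  have h2 : S.box = T.box := by
    ext m : 2
    have := h m m.2
    rwa [boxSeq_of_lt _ m.2, boxSeq_of_lt _ m.2] at this
  cases S
  cases T
  simp only at h2
  subst h2
  rfl

theorem exists_of_isBoxSeq {t : ℕ → ℕ × ℕ} (ht : IsBoxSeq k t) :
    ∃ T : Tableau k, ∀ m < k, T.boxSeq m = t m := by
  let ν : YoungDiagram :=
    { cells := (Finset.range k).image t
      isLowerSet := by
        intro a b hba ha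
        simp only [Finset.coe_image, Set.mem_image, Finset.coe_range, Set.mem_Iio] at ha ⊢
        obtain ⟨m, hm, rfl⟩ := ha
        obtain ⟨j, hj, hj'⟩ := ht.lower hm hba.1 hba.2
        exact ⟨j, by omega, hj'⟩ }
  have hmem : ∀ m : Fin k, t m ∈ ν.cells := fun m =>
    Finset.mem_image_of_mem _ (Finset.mem_range.2 m.2)
  let f : Fin k → ν.cells := fun m => ⟨t m, hmem m⟩
  have hf : Function.Bijective f := by
    constructor
    · intro a b hab
      exact Fin.ext (ht.inj a a.2 b b.2 (congrArg Subtype.val hab))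
    · rintro ⟨b, hb⟩
      obtain ⟨m, hm, rfl⟩ := Finset.mem_image.1 hb
      exact ⟨⟨m, Finset.mem_range.1 hm⟩, rfl⟩
  have hle : ∀ a b : Fin k, (t a).1 ≤ (t b).1 → (t a).2 ≤ (t b).2 → t a ≠ t b → a < b := by
    intro a b h1 h2 h3
    obtain ⟨j, hj, hj'⟩ := ht.lower b.2 h1 h2
    have := ht.inj j (by omega) a a.2 hj'
    have : (a : ℕ) ≠ b := fun h => h3 (by rw [h])
    exact Fin.lt_def.2 (by omega)
  refine ⟨⟨ν, ⟨Equiv.ofBijective f hf, fun a b h1 h2 => ?_, fun a b h1 h2 => ?_⟩⟩, fun m hm => ?_⟩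
  · exact hle a b h1.le h2.le fun h => h2.ne (congrArg Prod.snd h)
  · exact hle a b h2.le h1.le fun h => h2.ne (congrArg Prod.fst h)
  · rw [boxSeq_of_lt _ hm]
    rfl

theorem content_eq (T : Tableau k) (m : Fin k) : T.2.content m = boxContent (T.boxSeq m) := by
  rw [boxSeq_of_lt _ m.2]
  rfl

/-- Provides the factor of Murphy's product that vanishes on the eigenspace of another tableau. -/
theorem exists_content_ne {S T : Tableau k} (h : S ≠ T) :
    ∃ m : Fin k, T.2.content m ≠ boxContent (S.boxSeq m) := by
  by_contra! h'
  refine h (ext_boxSeq (S.isBoxSeq.ext_of_content T.isBoxSeq fun j hj => ?_))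
  rw [← h' ⟨j, hj⟩, content_eq]

end Tableau

/-! ### Families of projectors -/

section Projectors

variable {M ι : Type*} [AddCommGroup M] [Module ℂ M] [DecidableEq ι] {W : ι → Submodule ℂ M}
  {P : ι → Module.End ℂ M}

theorem end_ext_of_iSup_eq_top {M' : Type*} [AddCommGroup M'] [Module ℂ M'] {ι : Type*}
    {W : ι → Submodule ℂ M} (hW : ⨆ i, W i = ⊤) {f g : M →ₗ[ℂ] M'}
    (h : ∀ i, ∀ v ∈ W i, f v = g v) : f = g := by
  ext v
  refine Submodule.iSup_induction W (motive := fun v => f v = g v) (hW ▸ Submodule.mem_top)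
    h (by simp) fun x y hx hy => by rw [map_add, map_add, hx, hy]

/-- Operators that act as Kronecker deltas on a spanning family of subspaces are its orthogonal
projectors; no independence has to be assumed, since it follows from their existence. -/
theorem projector_mul (hW : ⨆ i, W i = ⊤)
    (hP : ∀ i j, ∀ v ∈ W j, P i v = if i = j then v else 0) (i j : ι) :
    P i * P j = if i = j then P j else 0 := by
  refine end_ext_of_iSup_eq_top hW fun l v hv => ?_
  rw [Module.End.mul_apply, hP j l v hv]
  by_cases hjl : j = l
  · rw [if_pos hjl, hP i l v hv]
    subst hjl
    by_cases hij : i = j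
    · simp [hij, hP j j v hv]
    · simp [hij]
  · rw [if_neg hjl, map_zero]
    by_cases hij : i = j
    · simp [hij, hP j l v hv, hjl]
    · simp [hij]

theorem range_projector (hW : ⨆ i, W i = ⊤)
    (hP : ∀ i j, ∀ v ∈ W j, P i v = if i = j then v else 0) (i : ι) :
    LinearMap.range (P i) = W i := by
  apply le_antisymm
  · rintro _ ⟨v, rfl⟩
    refine Submodule.iSup_induction W (motive := fun v => P i v ∈ W i) (hW ▸ Submodule.mem_top)
      (fun j v hv => ?_) (by simp) fun x y hx hy => by rw [map_add]; exact add_mem hx hy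
    rw [hP i j v hv]
    split_ifs with h
    · exact h ▸ hv
    · exact zero_mem _
  · intro v hv
    exact ⟨v, by rw [hP i i v hv, if_pos rfl]⟩

theorem isInternal_of_projectors (hW : ⨆ i, W i = ⊤)
    (hP : ∀ i j, ∀ v ∈ W j, P i v = if i = j then v else 0) :
    DirectSum.IsInternal W := by
  refine DirectSum.isInternal_submodule_of_iSupIndep_of_iSup_eq_top ?_ hW
  intro i
  rw [Submodule.disjoint_def]
  intro v hv hv'
  have : (⨆ j, ⨆ (_ : j ≠ i), W j) ≤ LinearMap.ker (P i) :=
    iSup₂_le fun j hj w hw => by rw [LinearMap.mem_ker, hP i j w hw, if_neg hj.symm]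
  have h := LinearMap.mem_ker.1 (this hv')
  rwa [hP i i v hv, if_pos rfl] at h

end Projectors

theorem isGenericParam_of_pow_ne_one {q : ℂ} (hq : q ≠ 0) (hgen : ∀ m : ℕ, 0 < m → q ^ m ≠ 1) :
    IsGenericParam q := ⟨hq, fun m hm => hgen _ (by omega)⟩

theorem IsGenericParam.eval_basis {q : ℂ} (hq : IsGenericParam q) {s : Finset ℤ} {a b : ℤ}
    (hb : b ∈ s) : (Lagrange.basis s (fun c : ℤ => q ^ (2 * c)) a).eval (q ^ (2 * b)) =
      if a = b then 1 else 0 := by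
  by_cases hab : a = b
  · subst hab
    rw [if_pos rfl]
    exact Lagrange.eval_basis_self (v := fun c : ℤ => q ^ (2 * c)) (i := a)
      (fun _ _ _ _ h => hq.zpow_inj h) hb
  · rw [if_neg hab]
    exact Lagrange.eval_basis_of_ne (v := fun c : ℤ => q ^ (2 * c)) hab hb

theorem jmElem_apply_mem {M : Type*} [AddCommGroup M] [Module ℂ M] {s : ℕ → Module.End ℂ M}
    {k : ℕ} {f : Module.End ℂ M} (hf : ∀ i, i + 1 < k → Commute f (s i)) {χ : ℕ → ℂ} {v : M}
    (hv : v ∈ weightSpace s k χ) : f v ∈ weightSpace s k χ := by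
  intro m hm
  rw [← apply_commute (commute_jmElem hf hm), hv m hm, map_smul]

/-! ### Young projectors as projectors on joint eigenspaces -/

section Young

variable {n : ℕ} {q : ℂ} {R : TMat n 2 ℂ} {V : Type*} [AddCommGroup V] [Module ℂ V]

/-- The operators of the local representation on `V^{⊗ k}`. -/
noncomputable def siteOp (R : TMat n 2 ℂ) (e : Module.Basis (Fin n) ℂ V) (k i : ℕ) :
    Module.End ℂ (TPow V k) :=
  opT (tensorBasis e k) (siteR R k i)

theorem isHeckeFamily_siteOp (hR : IsHeckeRMatrix q R) (hq : q ≠ 0)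
    (e : Module.Basis (Fin n) ℂ V) (k : ℕ) : IsHeckeFamily q k (siteOp R e k) where
  braid i h := by
    simp only [siteOp, ← opT_mul, ← mul_assoc]
    rw [siteR_braid hR k i h]
  comm i j h hj := commute_opT _ (siteR_comm R k i j h hj)
  quad i h := by
    rw [siteOp, ← opT_mul, siteR_mul_self hR hq h, opT_add, opT_smul, opT_one]

/-- The operator on `V^{⊗ k}` that represents an element of the Hecke algebra. -/
noncomputable def heckeOp (hR : IsHeckeRMatrix q R) (e : Module.Basis (Fin n) ℂ V) {k : ℕ}
    (x : HeckeAlgebra q k) : Module.End ℂ (TPow V k) :=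
  opT (tensorBasis e k) (localRep hR k x)

theorem heckeOp_mul (hR : IsHeckeRMatrix q R) (e : Module.Basis (Fin n) ℂ V) {k : ℕ}
    (x y : HeckeAlgebra q k) : heckeOp hR e (x * y) = heckeOp hR e y * heckeOp hR e x := by
  rw [heckeOp, map_mul, opT_mul]
  rfl

theorem heckeOp_one (hR : IsHeckeRMatrix q R) (e : Module.Basis (Fin n) ℂ V) {k : ℕ} :
    heckeOp hR e (1 : HeckeAlgebra q k) = 1 := by
  rw [heckeOp, map_one, opT_one]

/-- `heckeOp` reverses products, but Jucys-Murphy elements are palindromes in the generators and are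
unaffected. -/
theorem heckeOp_jucysMurphy (hR : IsHeckeRMatrix q R) (e : Module.Basis (Fin n) ℂ V) {k m : ℕ}
    (hm : m < k) : heckeOp hR e (jucysMurphy q k m) = jmElem (siteOp R e k) m := by
  induction m with
  | zero => exact heckeOp_one hR e
  | succ m ih =>
    have h : heckeOp hR e (sigma q k m) = siteOp R e k m := by
      rw [heckeOp, localRep_sigma hR k m hm, siteOp]
    rw [jucysMurphy, heckeOp_mul, heckeOp_mul, ih (by omega), h, jmElem, mul_assoc]

theorem heckeOp_aeval_apply (hR : IsHeckeRMatrix q R) (e : Module.Basis (Fin n) ℂ V) {k : ℕ}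
    {x : HeckeAlgebra q k} {μ : ℂ} {v : TPow V k} (hv : heckeOp hR e x v = μ • v)
    (p : Polynomial ℂ) : heckeOp hR e (Polynomial.aeval x p) v = p.eval μ • v := by
  have hpow : ∀ m : ℕ, heckeOp hR e (x ^ m) v = μ ^ m • v := by
    intro m
    induction m with
    | zero => rw [pow_zero, heckeOp_one, pow_zero, one_smul, Module.End.one_apply]
    | succ m ih => rw [pow_succ', heckeOp_mul, Module.End.mul_apply, hv, map_smul, ih, smul_smul,
        pow_succ']
  induction p using Polynomial.induction_on' with
  | add p r hp hr =>
    rw [map_add, heckeOp, map_add, opT_add, LinearMap.add_apply, Polynomial.eval_add, add_smul,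
      ← hp, ← hr]
    rfl
  | monomial m c =>
    rw [Polynomial.aeval_monomial, ← Algebra.smul_def, heckeOp, map_smul, opT_smul,
      LinearMap.smul_apply, Polynomial.eval_monomial, mul_smul, ← hpow m]
    rfl

theorem heckeOp_list_prod_apply (hR : IsHeckeRMatrix q R) (e : Module.Basis (Fin n) ℂ V) {k : ℕ}
    {ι : Type*} (x : ι → HeckeAlgebra q k) (c : ι → ℂ) {v : TPow V k}
    (hv : ∀ i, heckeOp hR e (x i) v = c i • v) (l : List ι) :
    heckeOp hR e (l.map x).prod v = (l.map c).prod • v := by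
  induction l with
  | nil => rw [List.map_nil, List.prod_nil, heckeOp_one, List.map_nil, List.prod_nil, one_smul,
      Module.End.one_apply]
  | cons i l ih =>
    rw [List.map_cons, List.prod_cons, heckeOp_mul, Module.End.mul_apply, hv, map_smul, ih,
      smul_smul, List.map_cons, List.prod_cons]

/-- The joint eigenspace of the Jucys-Murphy elements that belongs to a standard tableau. -/
noncomputable def tableauSpace (q : ℂ) (R : TMat n 2 ℂ) (e : Module.Basis (Fin n) ℂ V) {k : ℕ}
    (T : Tableau k) : Submodule ℂ (TPow V k) :=
  weightSpace (siteOp R e k) k (boxWeight q T.boxSeq)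

/-- On a joint eigenvector each Lagrange factor takes the value 1 or 0 according to whether the
contents agree at that position, and contents determine the tableau. -/
theorem youngOp_apply (hR : IsHeckeRMatrix q R) (hq : IsGenericParam q)
    (e : Module.Basis (Fin n) ℂ V) {k : ℕ} (S T : Tableau k) (v : TPow V k)
    (hv : v ∈ tableauSpace q R e T) : youngOp hR e S v = if S = T then v else 0 := by
  have h : ∀ m : Fin k, heckeOp hR e (Polynomial.aeval (jucysMurphy q k m)
      (Lagrange.basis (Finset.Icc (-(m : ℤ)) m) (fun c : ℤ => q ^ (2 * c)) (S.2.content m))) v =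
      (if S.2.content m = boxContent (T.boxSeq m) then (1 : ℂ) else 0) • v := by
    intro m
    rw [← hq.eval_basis (T.isBoxSeq.content_mem m.2)]
    refine heckeOp_aeval_apply hR e ?_ _
    rw [heckeOp_jucysMurphy hR e m.2]
    exact hv m m.2
  rw [youngOp, youngMatrix, youngIdempotent, ← heckeOp,
    heckeOp_list_prod_apply hR e _ _ h (List.finRange k)]
  by_cases hST : S = T
  · subst hST
    rw [if_pos rfl, List.prod_eq_one, one_smul]
    intro x hx
    obtain ⟨m, -, rfl⟩ := List.mem_map.1 hx
    rw [if_pos (S.content_eq m)]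
  · obtain ⟨m, hm⟩ := Tableau.exists_content_ne (Ne.symm hST)
    rw [if_neg hST, List.prod_eq_zero, zero_smul]
    exact List.mem_map.2 ⟨m, List.mem_finRange m, if_neg hm⟩

theorem iSup_tableauSpace (hR : IsHeckeRMatrix q R) (hq : IsGenericParam q)
    (e : Module.Basis (Fin n) ℂ V) (k : ℕ) :
    ⨆ T : Tableau k, tableauSpace q R e T = ⊤ := by
  have : FiniteDimensional ℂ (TPow V k) := Module.Finite.of_basis (tensorBasis e k)
  have h := isTableauSpanned (isHeckeFamily_siteOp hR hq.ne_zero e k) hq k le_rfl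
  rw [IsTableauSpanned] at h
  rw [eq_top_iff, ← h]
  refine iSup_le fun t => ?_
  obtain ⟨T, hT⟩ := Tableau.exists_of_isBoxSeq t.2
  refine le_iSup_of_le T (le_of_eq (weightSpace_congr fun m hm => ?_))
  rw [boxWeight, boxWeight, hT m hm]

theorem youngSubspace_eq (hR : IsHeckeRMatrix q R) (hq : IsGenericParam q)
    (e : Module.Basis (Fin n) ℂ V) {k : ℕ} (T : Tableau k) :
    youngSubspace hR e T = tableauSpace q R e T :=
  range_projector (iSup_tableauSpace hR hq e k) (youngOp_apply hR hq e) T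

theorem youngOp_apply_of_mem (hR : IsHeckeRMatrix q R) (hq : IsGenericParam q)
    (e : Module.Basis (Fin n) ℂ V) {k : ℕ} (T : Tableau k) {v : TPow V k}
    (hv : v ∈ youngSubspace hR e T) : youngOp hR e T v = v := by
  rw [youngSubspace_eq hR hq] at hv
  rw [youngOp_apply hR hq e T T v hv, if_pos rfl]

theorem youngMatrix_mul (hR : IsHeckeRMatrix q R) (hq : IsGenericParam q)
    (e : Module.Basis (Fin n) ℂ V) {k : ℕ} (S T : Tableau k) :
    youngMatrix hR S * youngMatrix hR T = if S = T then youngMatrix hR T else 0 := by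
  apply opT_injective (tensorBasis e k)
  rw [opT_mul]
  -- `opT` reverses products, so the two tableaux trade places.
  refine (projector_mul (iSup_tableauSpace hR hq e k) (youngOp_apply hR hq e) T S).trans ?_
  by_cases h : S = T
  · rw [if_pos h, if_pos h.symm, h]
    rfl
  · rw [if_neg h, if_neg (Ne.symm h), opT_zero]

theorem isInternal_youngSubspace (hR : IsHeckeRMatrix q R) (hq : IsGenericParam q)
    (e : Module.Basis (Fin n) ℂ V) (k : ℕ) :
    DirectSum.IsInternal fun T : Tableau k => youngSubspace hR e T := by
  have h : (fun T : Tableau k => youngSubspace hR e T) = fun T => tableauSpace q R e T :=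
    funext (youngSubspace_eq hR hq e)
  rw [h]
  exact isInternal_of_projectors (iSup_tableauSpace hR hq e k) (youngOp_apply hR hq e)

theorem apply_mem_youngSubspace (hR : IsHeckeRMatrix q R) (hq : IsGenericParam q)
    (e : Module.Basis (Fin n) ℂ V) {k : ℕ} (T : Tableau k) {f : Module.End ℂ (TPow V k)}
    (hf : ∀ i, i + 1 < k → Commute f (siteOp R e k i)) {v : TPow V k}
    (hv : v ∈ youngSubspace hR e T) : f v ∈ youngSubspace hR e T := by
  rw [youngSubspace_eq hR hq] at hv ⊢
  exact jmElem_apply_mem hf hv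

/-- The restriction of a representation to an invariant subspace. -/
def restrictHom {A M : Type*} [Ring A] [Algebra ℂ A] [AddCommGroup M] [Module ℂ M]
    (ρ : A →ₐ[ℂ] Module.End ℂ M) (W : Submodule ℂ M) (h : ∀ x, ∀ v ∈ W, ρ x v ∈ W) :
    A →ₐ[ℂ] Module.End ℂ W where
  toFun x := (ρ x).restrict (h x)
  map_one' := by
    ext v
    simp
  map_mul' x y := by
    ext v
    simp
  map_zero' := by
    ext v
    simp
  map_add' x y := by
    ext v
    simp
  commutes' c := by
    ext v
    simp

/-- The map is a product of intertwiners along a chain of exchanges from one tableau to the other,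
and it commutes with every operator that commutes with the Hecke generators. -/
theorem exists_equiv_youngSubspace (hR : IsHeckeRMatrix q R) (hq : IsGenericParam q)
    (e : Module.Basis (Fin n) ℂ V) {k : ℕ} (ν : YoungDiagram) (S T : StandardTableau ν k) :
    ∃ F : youngSubspace hR e (⟨ν, S⟩ : Tableau k) ≃ₗ[ℂ] youngSubspace hR e (⟨ν, T⟩ : Tableau k),
      ∀ f : Module.End ℂ (TPow V k), (∀ i, i + 1 < k → Commute f (siteOp R e k i)) →
        ∀ v w : youngSubspace hR e (⟨ν, S⟩ : Tableau k), (w : TPow V k) = f v →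
          (F w : TPow V k) = f (F v) := by
  classical
  set S' : Tableau k := ⟨ν, S⟩
  set T' : Tableau k := ⟨ν, T⟩
  obtain ⟨g, g', hg, h1, h2, h3, h4⟩ := exists_exchange (isHeckeFamily_siteOp hR hq.ne_zero e k) hq
    -- The position function sends a box to its entry in `T`, counted from zero; the value outside
    -- the shape is immaterial.
    T'.isBoxSeq (fun b => if h : b ∈ ν.cells then (T.box.symm ⟨b, h⟩ : ℕ) else 0)
    (fun j hj => by
      have h : T'.boxSeq j ∈ ν.cells := T'.boxSeq_mem hj
      simp only [dif_pos h]
      have : (⟨T'.boxSeq j, h⟩ : ν.cells) = T.box ⟨j, hj⟩ :=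
        Subtype.ext (T'.boxSeq_of_lt hj)
      rw [this, Equiv.symm_apply_apply])
    -- With this initial budget the bound on the measure holds trivially.
    (k * (k * k)) S'.boxSeq S'.isBoxSeq
    (fun j hj => by
      obtain ⟨i, hi, h, -⟩ := T'.exists_boxSeq_eq (S'.boxSeq_mem hj)
      exact ⟨i, hi, h.symm⟩) (Nat.le_add_right _ _)
  have eS : youngSubspace hR e S' = weightSpace (siteOp R e k) k (boxWeight q S'.boxSeq) :=
    youngSubspace_eq hR hq e S'
  have eT : youngSubspace hR e T' = weightSpace (siteOp R e k) k (boxWeight q T'.boxSeq) :=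
    youngSubspace_eq hR hq e T'
  rw [← eS, ← eT] at h1 h2
  rw [← eS] at h3
  rw [← eT] at h4
  refine ⟨LinearEquiv.ofLinearMap (g.restrict h1) (g'.restrict h2)
    (LinearMap.ext fun v => Subtype.ext (h4 v v.2))
    (LinearMap.ext fun v => Subtype.ext (h3 v v.2)), fun f hf v w hw => ?_⟩
  change g w = f (g v)
  rw [hw]
  exact (apply_commute (hg f hf) (v : TPow V k)).symm

end Young

end HeckeREA

/-! ### The proposition -/

theorem proposition3 {n : ℕ} (q : ℂ) (hq : q ≠ 0) (hgen : ∀ m : ℕ, 0 < m → q ^ m ≠ 1)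
    (R Ψ : HeckeREA.TMat n 2 ℂ) (hR : HeckeREA.IsHeckeRMatrix q R)
    (hΨ : HeckeREA.IsSkewInverse R Ψ) (p : ℕ) (hp : HeckeREA.HasSymmetryRank hR p)
    {V : Type*} [AddCommGroup V] [Module ℂ V] (e : Module.Basis (Fin n) ℂ V)
    (k : ℕ) [NeZero k] :
    -- the fundamental module and its `k`-th tensor power
    ∃ π : HeckeREA.MREA R →ₐ[ℂ] Module.End ℂ V,
    ∃ ρ : HeckeREA.MREA R →ₐ[ℂ] Module.End ℂ (HeckeREA.TPow V k),
      (∀ i j a, π (HeckeREA.MREA.l R i j) (e a) = HeckeREA.matB Ψ a j • e i) ∧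
      (∀ i j, HeckeREA.matrixT (HeckeREA.tensorBasis e k) (ρ (HeckeREA.MREA.l R i j)) =
        HeckeREA.rhoT R k (HeckeREA.matrixT e (π (HeckeREA.MREA.l R i j)))) ∧
      -- the decomposition of `V^{⊗ k}` along the orthogonal projectors
      (∀ S T : HeckeREA.Tableau k,
        HeckeREA.youngMatrix hR S * HeckeREA.youngMatrix hR T =
          if S = T then HeckeREA.youngMatrix hR T else 0) ∧
      DirectSum.IsInternal
        (fun T : HeckeREA.Tableau k => HeckeREA.youngSubspace hR e T) ∧
      -- the components are submodules, with the stated matrices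
      ∃ πY : ∀ T : HeckeREA.Tableau k,
          HeckeREA.MREA R →ₐ[ℂ] Module.End ℂ (HeckeREA.youngSubspace hR e T),
        (∀ (T : HeckeREA.Tableau k) (x : HeckeREA.MREA R) (v : HeckeREA.youngSubspace hR e T),
          ((πY T x v : HeckeREA.youngSubspace hR e T) : HeckeREA.TPow V k) =
            ρ x (v : HeckeREA.TPow V k)) ∧
        (∀ (T : HeckeREA.Tableau k) (i j : Fin n),
          HeckeREA.matrixT (HeckeREA.tensorBasis e k)
              (HeckeREA.extendOp hR e T (πY T (HeckeREA.MREA.l R i j))) =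
            HeckeREA.youngMatrix hR T *
              HeckeREA.rhoT R k (HeckeREA.matrixT e (π (HeckeREA.MREA.l R i j))) *
              HeckeREA.youngMatrix hR T) ∧
        -- different tableaux of the same shape give equivalent modules
        (∀ (ν : YoungDiagram) (S T : HeckeREA.StandardTableau ν k),
          ∃ F : HeckeREA.youngSubspace hR e (⟨ν, S⟩ : HeckeREA.Tableau k) ≃ₗ[ℂ]
              HeckeREA.youngSubspace hR e (⟨ν, T⟩ : HeckeREA.Tableau k),
            ∀ (x : HeckeREA.MREA R)
              (v : HeckeREA.youngSubspace hR e (⟨ν, S⟩ : HeckeREA.Tableau k)),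
              F (πY ⟨ν, S⟩ x v) = πY ⟨ν, T⟩ x (F v)) := by
  have hg : HeckeREA.IsGenericParam q := HeckeREA.isGenericParam_of_pow_ne_one hq hgen
  obtain ⟨π, hπ⟩ := HeckeREA.exists_fundamental hΨ e
  obtain ⟨ρ, hρ⟩ := HeckeREA.exists_tensorPower hR hq hΨ e k
  have hcomm : ∀ (x : HeckeREA.MREA R) (i : ℕ), i + 1 < k →
      Commute (ρ x) (HeckeREA.siteOp R e k i) := fun x i hi =>
    HeckeREA.commute_site_rho hR hq e (fun i j => ⟨_, hρ i j⟩) x hi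
  have hmem : ∀ (T : HeckeREA.Tableau k) (x : HeckeREA.MREA R),
      ∀ v ∈ HeckeREA.youngSubspace hR e T, ρ x v ∈ HeckeREA.youngSubspace hR e T :=
    fun T x v hv => HeckeREA.apply_mem_youngSubspace hR hg e T (hcomm x) hv
  have hρ' : ∀ i j, ρ (HeckeREA.MREA.l R i j) = HeckeREA.opT (HeckeREA.tensorBasis e k)
      (HeckeREA.rhoT R k (HeckeREA.matrixT e (π (HeckeREA.MREA.l R i j)))) := by
    intro i j
    rw [hρ, hπ, HeckeREA.matrixT_opT]
  refine ⟨π, ρ, fun i j a => ?_, fun i j => ?_, HeckeREA.youngMatrix_mul hR hg e,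
    HeckeREA.isInternal_youngSubspace hR hg e k,
    fun T => HeckeREA.restrictHom ρ _ (hmem T), fun T x v => rfl, fun T i j => ?_, fun ν S T => ?_⟩
  · rw [hπ, HeckeREA.opT_B_single_apply]
  · rw [hρ', HeckeREA.matrixT_opT]
  -- Extending by the projector gives ρ Y. The left factor Y may be added because the image already
  -- lies in the submodule, on which Y is the identity.
  · have h : HeckeREA.extendOp hR e T
        (HeckeREA.restrictHom ρ _ (hmem T) (HeckeREA.MREA.l R i j)) =
        HeckeREA.youngOp hR e T * (ρ (HeckeREA.MREA.l R i j) * HeckeREA.youngOp hR e T) := by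
      refine LinearMap.ext fun v => ?_
      have hv : ρ (HeckeREA.MREA.l R i j) (HeckeREA.youngOp hR e T v) ∈
          HeckeREA.youngSubspace hR e T := hmem T _ _ (LinearMap.mem_range_self _ v)
      exact (HeckeREA.youngOp_apply_of_mem hR hg e T hv).symm
    rw [h, HeckeREA.youngOp, hρ', ← HeckeREA.opT_mul, ← HeckeREA.opT_mul, HeckeREA.matrixT_opT]
  · obtain ⟨F, hF⟩ := HeckeREA.exists_equiv_youngSubspace hR hg e ν S T
    exact ⟨F, fun x v => Subtype.ext (hF (ρ x) (hcomm x) v _ rfl)⟩
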